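/- **Theorem 2.2.** Let $\Omega\subset\mathbb R^2$ be a bounded domain with $C^\infty$ boundary, $\nu$ its unit outward normal, and $T>0$. Let $$f(x,t)=\sum_{j=1}^N\chi_{P_j\times[T_j,T]}(x,t)\,\rho_j(x,t),$$ where * each $P_j\subset\overline\Omega$ is the interior of a (simple) polygon, $0\le T_j<T$, and $\overline P_j\cap\overline P_{j'}=\emptyset$ for $j\ne j'$; * each real-valued $\rho_j$ belongs to $L^\infty(P_j\times\,]T_j,T[)$, and there is $\theta_j\in\,]0,1]$ such that for each vertex $p$ of the convex hull of $P_j$ the function $\rho_j$ coincides almost everywhere in $P_j\times\,]T_j,T[$ near $(p,T_j)$ with a function that is Hölder continuous with exponent $\theta_j$ in a neighbourhood of $(p,T_j)$ and does not vanish at $(p,T_j)$. Put $D=\bigcup_{j=1}^N P_j\times\,]T_j,T[$. Let $u=u(x,t)$ be a real-valued solution of $$u_t=\Delta u+f\ \text{ in }\Omega\times\,]0,T[\ \text{(in the sense of distributions)},\qquad u(\cdot,0)=0\ \text{ in }\Omega,$$ such that $u\in C([0,T];L^1(\Omega))$, $u$ and its spatial gradient exist and are continuous on $\overline\Omega\times\,]0,T[$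 (derivatives at $\partial\Omega$ being taken relative to $\overline\Omega$), and $u$ and $\partial u/\partial\nu$ are integrable on $\partial\Omega\times\,]0,T[$. No boundary condition is imposed on $u$. Let $c>0$ and let $\omega,\omega^\perp\in S^1$ with $\omega\cdot\omega^\perp=0$. For $\tau>c^{-2}$ put $$z=c\tau\Big(\omega+i\sqrt{1-\tfrac1{c^2\tau}}\;\omega^\perp\Big),\qquad v(x,t)=e^{-(z\cdot z)t+x\cdot z},$$ where $\cdot$ is the bilinear product on $\mathbb C^2$ (so that $v_t+\Delta v=0$), and for $s\in\mathbb R$ $$I_{\omega,\omega^\perp,c}(\tau;s)=e^{\tau s}\int_0^T\!\!\int_{\partial\Omega}\Big(\frac{\partial v}{\partial\nu}u-\frac{\partial u}{\partial\nu}v\Big)\,dS\,dt .$$ Let $$\omega(c)=\frac1{\sqrt{c^2+1}}\begin{pmatrix}c\,\omega\\-1\end{pmatrix}\in\mathbb R^2\times\mathbb R,\qquad h_D(\omega(c))=\sup_{(x,t)\in D}\begin{pmatrix}x\\t\end{pmatrix}\cdot\omega(c).$$ Suppose that $\omega(c)$ is regular with respect to $D$, that is, there is exactly one point $q\in\partial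 D$ with $q\cdot\omega(c)=h_D(\omega(c))$, and that $$\sup_{x\in\Omega}\begin{pmatrix}x\\T\end{pmatrix}\cdot\omega(c)<h_D(\omega(c)).$$ Then $I_{\omega,\omega^\perp,c}(\tau;0)\neq0$ for all sufficiently large $\tau$, and $$\lim_{\tau\to\infty}\frac{\log|I_{\omega,\omega^\perp,c}(\tau;0)|}{\tau}=\sqrt{c^2+1}\;h_D(\omega(c)).$$ Moreover, for every $s\in\mathbb R$: * if $h_D(\omega(c))\le -s/\sqrt{c^2+1}$, then $\lim_{\tau\to\infty}|I_{\omega,\omega^\perp,c}(\tau;s)|=0$; * if $h_D(\omega(c))>-s/\sqrt{c^2+1}$, then $\lim_{\tau\to\infty}|I_{\omega,\omega^\perp,c}(\tau;s)|=\infty$. -/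

import Mathlib

open Set Filter MeasureTheory
open scoped Topology

noncomputable section

namespace HeatSource

/-- The Euclidean plane. Space-time is `Plane × ℝ`, with points `(x, t)`. -/
abbrev Plane : Type := EuclideanSpace ℝ (Fin 2)

/-! ### The domain -/

/-- Near each of its boundary points, in suitable Cartesian coordinates centred at that point, the
set is the part below the graph of a `C^∞` function. -/
def HasSmoothBoundary (Ω : Set Plane) : Prop :=
  ∀ p ∈ frontier Ω, ∃ (e : Plane ≃ₗᵢ[ℝ] Plane) (g : ℝ → ℝ) (a b : ℝ),
    ContDiff ℝ (⊤ : ℕ∞) g ∧ 0 < a ∧ 0 < b ∧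
      ∀ y : Plane, |e (y - p) 0| < a → |e (y - p) 1| < b →
        (y ∈ Ω ↔ e (y - p) 1 < g (e (y - p) 0))

/-- A bounded domain (nonempty connected open set) of the plane with smooth boundary. -/
structure IsSmoothBoundedDomain (Ω : Set Plane) : Prop where
  isOpen : IsOpen Ω
  isConnected : IsConnected Ω
  isBounded : Bornology.IsBounded Ω
  smooth : HasSmoothBoundary Ω

/-- `n` is the unit outward normal to `Ω` at `x`: directions making an obtuse angle with `n` enter
`Ω`, those making an acute angle with `n` leave its closure. At a boundary point of a domain with
smooth boundary there is exactly one such vector. -/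
def IsOutwardNormal (Ω : Set Plane) (x n : Plane) : Prop :=
  ‖n‖ = 1 ∧
    (∀ w : Plane, inner ℝ w n < 0 → ∀ᶠ h : ℝ in 𝓝[>] 0, x + h • w ∈ Ω) ∧
    (∀ w : Plane, 0 < inner ℝ w n → ∀ᶠ h : ℝ in 𝓝[>] 0, x + h • w ∉ closure Ω)

/-- The unit outward normal `ν(x)` (meaningful at the boundary points of a smooth domain). -/
def outwardNormal (Ω : Set Plane) (x : Plane) : Plane :=
  Classical.epsilon (IsOutwardNormal Ω x)

/-- Arc length on the boundary of `Ω`. -/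
def boundaryMeasure (Ω : Set Plane) : Measure Plane :=
  (Measure.hausdorffMeasure 1 : Measure Plane).restrict (frontier Ω)

/-- `∂u/∂ν (x, t)` for a function `u` defined on (the closure of) `Ω` in the space variable. -/
def normalDeriv (Ω : Set Plane) (u : Plane → ℝ → ℝ) (x : Plane) (t : ℝ) : ℝ :=
  fderivWithin ℝ (fun y => u y t) (closure Ω) x (outwardNormal Ω x)

/-! ### The heat equation -/

/-- `u_t = Δu + f` in `Ω × ]0, T[` in the sense of distributions. -/
def SolvesHeatEq (Ω : Set Plane) (T : ℝ) (f : Plane × ℝ → ℝ) (u : Plane → ℝ → ℝ) : Prop :=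
  ∀ φ : Plane × ℝ → ℝ, ContDiff ℝ (⊤ : ℕ∞) φ → HasCompactSupport φ → tsupport φ ⊆ Ω ×ˢ Ioo 0 T →
    ∫ q in Ω ×ˢ Ioo 0 T,
      (u q.1 q.2 * (deriv (fun t => φ (q.1, t)) q.2 + Laplacian.laplacian (fun x => φ (x, q.2)) q.1)
        + f q * φ q) = 0

/-- `u` solves `u_t = Δu + f` in `Ω × ]0, T[` with `u(·, 0) = 0`, and has lateral Cauchy data
`u`, `∂u/∂ν` on `∂Ω × ]0, T[` in the classical sense. -/
structure IsHeatSolution (Ω : Set Plane) (T : ℝ) (f : Plane × ℝ → ℝ) (u : Plane → ℝ → ℝ) :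
    Prop where
  /-- the equation -/
  solves : SolvesHeatEq Ω T f u
  /-- `u` is continuous up to the lateral boundary -/
  continuousOn : ContinuousOn (fun q : Plane × ℝ => u q.1 q.2) (closure Ω ×ˢ Ioo 0 T)
  /-- `u` is `C^1` in space up to the lateral boundary -/
  differentiableOn : ∀ t ∈ Ioo 0 T, DifferentiableOn ℝ (fun y => u y t) (closure Ω)
  continuousOn_fderiv : ContinuousOn
    (fun q : Plane × ℝ => fderivWithin ℝ (fun y => u y q.2) (closure Ω) q.1)
    (closure Ω ×ˢ Ioo 0 T)
  /-- `u` belongs to `C([0, T]; L¹(Ω))` -/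
  integrableOn : ∀ t ∈ Icc 0 T, IntegrableOn (fun x => u x t) Ω
  continuous_L1 : ∀ t₀ ∈ Icc 0 T,
    Tendsto (fun t => ∫⁻ x in Ω, ‖u x t - u x t₀‖ₑ) (𝓝[Icc 0 T] t₀) (𝓝 0)
  /-- the initial value vanishes -/
  initial : ∀ x ∈ Ω, u x 0 = 0
  /-- the lateral data are integrable -/
  integrable_trace : Integrable (fun q : Plane × ℝ => u q.1 q.2)
    ((boundaryMeasure Ω).prod (volume.restrict (Ioo 0 T)))
  integrable_normalDeriv : Integrable (fun q : Plane × ℝ => normalDeriv Ω u q.1 q.2)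
    ((boundaryMeasure Ω).prod (volume.restrict (Ioo 0 T)))

/-! ### The source -/

/-- `P` is the interior of a simple polygon, with vertices `v 0, …, v (k + 2)` in cyclic order:
distinct edges of the closed polygonal curve meet at most in common end points, and `P` is the
bounded domain bounded by this curve. -/
def IsPolygonInterior (P : Set Plane) : Prop :=
  ∃ (k : ℕ) (v : Fin (k + 3) → Plane),
    Function.Injective v ∧
    (∀ i j : Fin (k + 3), i ≠ j →
      segment ℝ (v i) (v (i + 1)) ∩ segment ℝ (v j) (v (j + 1))
        ⊆ {v i, v (i + 1)} ∩ {v j, v (j + 1)}) ∧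
    IsOpen P ∧ IsConnected P ∧ Bornology.IsBounded P ∧
    frontier P = ⋃ i, segment ℝ (v i) (v (i + 1))

/-- The vertices of the convex hull of a polygon with interior `P`. -/
def hullVertices (P : Set Plane) : Set Plane :=
  (convexHull ℝ (closure P)).extremePoints ℝ

/-- The conditions on the pieces `P_j × [T_j, T]`, `ρ_j` of the source. -/
structure IsAdmissibleSource (Ω : Set Plane) (T : ℝ) {N : ℕ} (P : Fin N → Set Plane)
    (Tj : Fin N → ℝ) (ρ : Fin N → Plane × ℝ → ℝ) : Prop where
  polygon : ∀ j, IsPolygonInterior (P j)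
  subset : ∀ j, P j ⊆ closure Ω
  time_nonneg : ∀ j, 0 ≤ Tj j
  time_lt : ∀ j, Tj j < T
  disjoint : ∀ i j, i ≠ j → Disjoint (closure (P i)) (closure (P j))
  /-- `ρ_j ∈ L^∞(P_j × ]T_j, T[)` -/
  bounded : ∀ j, MemLp (ρ j) ⊤ (volume.restrict (P j ×ˢ Ioo (Tj j) T))
  /-- near `(p, T_j)`, for `p` a vertex of the convex hull of `P_j`, `ρ_j` coincides (almost
  everywhere) with a Hölder continuous function that does not vanish at `(p, T_j)` -/
  holder : ∀ j, ∃ θ : NNReal, 0 < θ ∧ θ ≤ 1 ∧ ∀ p ∈ hullVertices (P j),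
    ∃ U ∈ 𝓝 (p, Tj j), ∃ (C : NNReal) (g : Plane × ℝ → ℝ),
      HolderOnWith C θ g U ∧ g (p, Tj j) ≠ 0 ∧
        ∀ᵐ q ∂(volume.restrict (U ∩ (P j ×ˢ Ioo (Tj j) T))), ρ j q = g q

/-- `f = ∑_j χ_{P_j × [T_j, T]} ρ_j`. -/
def source (T : ℝ) {N : ℕ} (P : Fin N → Set Plane) (Tj : Fin N → ℝ)
    (ρ : Fin N → Plane × ℝ → ℝ) (q : Plane × ℝ) : ℝ :=
  ∑ j, (P j ×ˢ Icc (Tj j) T).indicator (ρ j) q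

/-- `D = ⋃_j P_j × ]T_j, T[`. -/
def sourceSet (T : ℝ) {N : ℕ} (P : Fin N → Set Plane) (Tj : Fin N → ℝ) : Set (Plane × ℝ) :=
  ⋃ j, P j ×ˢ Ioo (Tj j) T

/-! ### Directions in space-time and the support function -/

/-- The Euclidean inner product of space-time. -/
def stDot (q r : Plane × ℝ) : ℝ := inner ℝ q.1 r.1 + q.2 * r.2

/-- The unit vector `ω(c) = (c ω, -1) / √(c² + 1)`. -/
def omegaC (ω : Plane) (c : ℝ) : Plane × ℝ :=
  (Real.sqrt (c ^ 2 + 1))⁻¹ • (c • ω, (-1 : ℝ))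

/-- The support function `h_D(ϑ) = sup_{q ∈ D} q · ϑ`. -/
def supportFun (D : Set (Plane × ℝ)) (ϑ : Plane × ℝ) : ℝ :=
  sSup ((fun q => stDot q ϑ) '' D)

/-- `ϑ` is regular with respect to `D`: the supporting hyperplane of `D` in direction `ϑ` meets
the boundary of `D` in exactly one point. -/
def IsRegularDir (D : Set (Plane × ℝ)) (ϑ : Plane × ℝ) : Prop :=
  ∃! q, q ∈ frontier D ∧ stDot q ϑ = supportFun D ϑ

/-! ### The complex solutions of the backward heat equation and the indicator function -/

/-- `z = c τ (ω + i √(1 - 1 / (c² τ)) ω^⊥)`. -/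
def zVec (ω ωp : Plane) (c τ : ℝ) : Fin 2 → ℂ := fun k =>
  ((c * τ : ℝ) : ℂ) *
    ((ω k : ℂ) + Complex.I * ((Real.sqrt (1 - 1 / (c ^ 2 * τ)) : ℝ) : ℂ) * (ωp k : ℂ))

/-- `v(x, t) = e^{-(z · z) t + x · z}`, with the bilinear dot product of `ℂ²`. -/
def vSol (ω ωp : Plane) (c τ : ℝ) (x : Plane) (t : ℝ) : ℂ :=
  Complex.exp (-(∑ k, zVec ω ωp c τ k * zVec ω ωp c τ k) * (t : ℂ)
    + ∑ k, (x k : ℂ) * zVec ω ωp c τ k)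

/-- The indicator function
`I(τ; s) = e^{τ s} ∫_0^T ∫_{∂Ω} (∂v/∂ν u - ∂u/∂ν v) dS dt`, to be used for `τ > c⁻²`. -/
def indicatorFun (Ω : Set Plane) (T : ℝ) (u : Plane → ℝ → ℝ) (ω ωp : Plane) (c τ s : ℝ) : ℂ :=
  (Real.exp (τ * s) : ℂ) * ∫ t in (0 : ℝ)..T, ∫ x,
    (fderiv ℝ (fun y => vSol ω ωp c τ y t) x (outwardNormal Ω x) * (u x t : ℂ)
      - (normalDeriv Ω u x t : ℂ) * vSol ω ωp c τ x t) ∂(boundaryMeasure Ω)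

end HeatSource

end

open HeatSource

namespace HeatSource

/-! Testing the equation against the backward heat solution `v` gives (`IsHeatSolution.green_exp`,
`indicatorFun_zero_eq`) that the lateral integral equals `∫ f v` over the space-time cylinder minus
the final contribution `∫ u(x,T) v(x,T) dx`. The frequency is chosen so that `z · z = τ`, hence `|v|
= exp (τ (c x·ω - t))`, and the exponent is `τ √(c²+1)` times the linear functional defining `h_D`.
The exponential rate of `∫ f v` is therefore governed by the point where the support plane touches
`D`, and the assumption at time `T` makes the final contribution exponentially smaller.

The functional decreases in `t`, so the contact point lies on the bottom of a cylinder. By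
regularity it is a single point `(p, T_j)`, where `p` is the strict maximum point of `x·ω` on the
closure of `P_j`; such a point is a vertex of the convex hull, where the density is nonzero by
assumption. The closures of the other polygons are disjoint from that of `P_j`, so their cylinders
stay strictly below the support plane and contribute exponentially less
(`IsAdmissibleSource.exists_peak`).

At the vertex, the blow-up `q = (p, T_j) + τ⁻¹ y` turns the cylinder into a convex sector times a
half-line and produces the Jacobian `τ⁻³` (`tendsto_integral_vertex`). The limit is the density at
the vertex times the integral of `exp (c (ω + i ω^⊥)·y)` over the sector times the integral of
`e^{-s}` over the half-line. In the oblique coordinates of the sector this is a product of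
one-dimensional exponential integrals, so it is nonzero. Hence `τ³ e^{-τ H} |I(τ;0)|` has a positive
limit, with `H = √(c²+1) h_D`, and all the assertions follow (`asymptotics_of_tendsto`).

The analytic labour is in Green's formula, since `u` solves the equation only as a distribution. The
test function is `v` times a space cutoff and a time cutoff. The space cutoff is sharpened first,
its gradient converging to `-ν dS`. The time cutoff is sharpened afterwards, its derivative
converging to the difference of the Dirac masses at `0` and `T`. -/

/-! ### Polygons near a strict maximum of a linear functional -/

/-- A convex cone with apex `p` that contains the vertices contains the edges, hence the frontier. A
point of `P` outside the cone could escape to infinity in direction `ω` without meeting the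
frontier, against boundedness. This global cone bound later dominates the rescaled integrands. -/
theorem IsPolygonInterior.inner_sub_le {P : Set Plane} (hP : IsPolygonInterior P) {p ω : Plane}
    (hω : ‖ω‖ = 1) (hmax : ∀ x ∈ closure P, x ≠ p → inner ℝ x ω < inner ℝ p ω) :
    ∃ δ > 0, ∀ x ∈ P, inner ℝ (x - p) ω ≤ -δ * ‖x - p‖ := by
  obtain ⟨k, v, hv, hseg, hopen, hconn, hbd, hfr⟩ := hP
  have hvm : ∀ i, v i ∈ frontier P := fun i => by
    rw [hfr]; exact mem_iUnion.2 ⟨i, left_mem_segment ℝ _ _⟩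
  have h1 : ∀ i, ∃ δ > 0, inner ℝ (v i - p) ω ≤ -δ * ‖v i - p‖ := by
    intro i
    by_cases h : v i = p
    · exact ⟨1, one_pos, by simp [h]⟩
    · have h2 := hmax (v i) (frontier_subset_closure (hvm i)) h
      have h3 : 0 < ‖v i - p‖ := norm_pos_iff.2 (sub_ne_zero.2 h)
      refine ⟨(inner ℝ p ω - inner ℝ (v i) ω) / ‖v i - p‖, div_pos (by linarith) h3, ?_⟩
      rw [neg_mul, div_mul_cancel₀ _ h3.ne', inner_sub_left]
      linarith
  choose d hd hd' using h1
  obtain ⟨i0, hi0⟩ := Finite.exists_min d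
  -- The cap below 1 makes translation in direction `ω` increase `⟨x - p, ω⟩ + δ ‖x - p‖`, so that
  -- rays in this direction never re-enter the cone `K`.
  set δ := min (d i0) (1 / 2) with hδ
  have hδ0 : 0 < δ := lt_min (hd i0) (by norm_num)
  have hδ1 : δ < 1 := lt_of_le_of_lt (min_le_right _ _) (by norm_num)
  set K : Set Plane := {x | inner ℝ (x - p) ω + δ * ‖x - p‖ ≤ 0} with hK
  have hKc : Convex ℝ K := by
    intro x hx y hy a b ha hb hab
    simp only [hK, mem_ofPred_eq] at hx hy ⊢
    have e : a • x + b • y - p = a • (x - p) + b • (y - p) := by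
      have : p = (a + b) • p := by rw [hab, one_smul]
      nth_rw 1 [this]; module
    have h2 : ‖a • (x - p) + b • (y - p)‖ ≤ a * ‖x - p‖ + b * ‖y - p‖ := by
      refine (norm_add_le _ _).trans ?_
      rw [norm_smul, norm_smul, Real.norm_of_nonneg ha, Real.norm_of_nonneg hb]
    rw [e, inner_add_left, real_inner_smul_left, real_inner_smul_left]
    nlinarith [mul_le_mul_of_nonneg_left h2 hδ0.le]
  have hvK : ∀ i, v i ∈ K := fun i => by
    simp only [hK, mem_ofPred_eq]
    nlinarith [hd' i, hi0 i, min_le_left (d i0) (1 / 2), norm_nonneg (v i - p)]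
  have hfK : frontier P ⊆ K := by
    rw [hfr]; exact iUnion_subset fun i => hKc.segment_subset (hvK _) (hvK _)
  refine ⟨δ, hδ0, fun x hx => ?_⟩
  by_contra hcon
  push Not at hcon
  have hray : ∀ s : ℝ, 0 ≤ s → x + s • ω ∉ K := by
    intro s hs hmem
    simp only [hK, mem_ofPred_eq] at hmem
    have e : x + s • ω - p = (x - p) + s • ω := by abel
    rw [e, inner_add_left, real_inner_smul_left, real_inner_self_eq_norm_sq, hω] at hmem
    have h4 : ‖x - p‖ - s ≤ ‖x - p + s • ω‖ := by
      have := norm_sub_le (x - p + s • ω) (s • ω)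
      rw [add_sub_cancel_right, norm_smul, hω, Real.norm_of_nonneg hs] at this
      linarith
    nlinarith [mul_le_mul_of_nonneg_left h4 hδ0.le, mul_nonneg hs (sub_nonneg.2 hδ1.le)]
  set R : Set Plane := (fun s : ℝ => x + s • ω) '' Ici 0 with hR
  have hRc : IsPreconnected R :=
    isPreconnected_Ici.image _ (by fun_prop)
  -- A connected set that meets the open set `P` and avoids its frontier lies in `P`.
  have hRP : R ⊆ P := by
    refine hRc.subset_of_closure_inter_subset hopen ⟨x, ⟨0, by simp, by simp⟩, hx⟩ ?_
    rintro y ⟨hy, s, hs, rfl⟩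
    by_contra hn
    exact hray s hs (hfK ⟨hy, by rwa [hopen.interior_eq]⟩)
  obtain ⟨C, hC⟩ := hbd.exists_norm_le
  have h5 := hC (x + (C + ‖x‖ + 1) • ω)
    (hRP ⟨_, by have := norm_nonneg x; have := (norm_nonneg _).trans (hC x hx); simp only [mem_Ici]; positivity, rfl⟩)
  have h6 := norm_sub_le (x + (C + ‖x‖ + 1) • ω) x
  rw [add_sub_cancel_left, norm_smul, hω] at h6
  have := le_abs_self (C + ‖x‖ + 1)
  rw [Real.norm_eq_abs] at h6
  linarith

theorem exists_planeEquiv {a b : Plane}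
    (h : ∀ α β : ℝ, α • a + β • b = 0 → α = 0 ∧ β = 0) :
    ∃ L : (ℝ × ℝ) ≃L[ℝ] Plane, ∀ α β : ℝ, L (α, β) = α • a + β • b := by
  let l : (ℝ × ℝ) →ₗ[ℝ] Plane :=
    (LinearMap.toSpanSingleton ℝ Plane a).coprod (LinearMap.toSpanSingleton ℝ Plane b)
  have hl : ∀ α β : ℝ, l (α, β) = α • a + β • b := fun α β => by simp [l]
  have hinj : Function.Injective l := by
    rw [← LinearMap.ker_eq_bot, LinearMap.ker_eq_bot']
    rintro ⟨α, β⟩ h0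
    rw [hl] at h0
    obtain ⟨rfl, rfl⟩ := h α β h0
    rfl
  have hfin : Module.finrank ℝ (ℝ × ℝ) = Module.finrank ℝ Plane := by simp
  exact ⟨(LinearEquiv.ofInjectiveOfFinrankEq l hinj hfin).toContinuousLinearEquiv, hl⟩

/-- Near a vertex at which a linear functional attains its strict maximum, the polygon is a convex
sector. -/
theorem IsPolygonInterior.exists_sector {P : Set Plane} (hP : IsPolygonInterior P) {p ω : Plane}
    (hp : p ∈ closure P) (hmax : ∀ x ∈ closure P, x ≠ p → inner ℝ x ω < inner ℝ p ω) :
    ∃ L : (ℝ × ℝ) ≃L[ℝ] Plane, inner ℝ (L (1, 0)) ω < 0 ∧ inner ℝ (L (0, 1)) ω < 0 ∧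
      ∃ r > 0, ∀ α β : ℝ, ‖L (α, β)‖ < r → (p + L (α, β) ∈ P ↔ 0 < α ∧ 0 < β) := by
  obtain ⟨k, v, hv, hseg, hopen, hconn, hbd, hfr⟩ := hP
  have hsegcl : ∀ i, segment ℝ (v i) (v (i + 1)) ⊆ closure P := fun i =>
    (subset_iUnion (fun i => segment ℝ (v i) (v (i + 1))) i).trans
      (hfr ▸ frontier_subset_closure)
  -- An interior point could be pushed in direction `ω`, raising the functional. If `ω = 0`, a
  -- second point of the closure already contradicts strictness.
  have hpP : p ∉ P := by
    intro hpP
    obtain ⟨ε, hε, hb⟩ := Metric.isOpen_iff.1 hopen p hpP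
    by_cases hω : ω = 0
    · obtain ⟨x, hx, hxp⟩ : ∃ x ∈ closure P, x ≠ p := by
        by_cases h0 : v 0 = p
        · exact ⟨v 1, hsegcl 1 (left_mem_segment ℝ _ _), fun h1 => by
            have := hv (h1.trans h0.symm); simp at this⟩
        · exact ⟨v 0, hsegcl 0 (left_mem_segment ℝ _ _), h0⟩
      simpa [hω] using hmax x hx hxp
    · have hn : 0 < ‖ω‖ := norm_pos_iff.2 hω
      set s := ε / 2 / ‖ω‖
      have hs : 0 < s := by positivity
      have := hmax (p + s • ω) (subset_closure (hb (by
        rw [Metric.mem_ball, dist_eq_norm, add_sub_cancel_left, norm_smul,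
          Real.norm_of_nonneg hs.le, div_mul_cancel₀ _ hn.ne']
        linarith))) (by simpa using ⟨hs.ne', hω⟩)
      rw [inner_add_left, real_inner_smul_left, real_inner_self_eq_norm_sq] at this
      nlinarith [mul_pos hs (pow_pos hn 2)]
  have hpf : p ∈ frontier P := ⟨hp, by rwa [hopen.interior_eq]⟩
  -- If `p` were no vertex, it would be a convex combination of two end points of an edge, both with
  -- strictly smaller value.
  obtain ⟨i, hi⟩ : ∃ i, v i = p := by
    rw [hfr] at hpf
    obtain ⟨i, a, b, ha, hb, hab, hx⟩ := mem_iUnion.1 hpf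
    by_contra! hne
    have h1 := hmax _ (hsegcl i (left_mem_segment ℝ _ _)) (hne i)
    have h2 := hmax _ (hsegcl i (right_mem_segment ℝ _ _)) (hne (i + 1))
    have h3 : inner ℝ p ω = a * inner ℝ (v i) ω + b * inner ℝ (v (i + 1)) ω := by
      rw [← hx, inner_add_left, real_inner_smul_left, real_inner_smul_left]
    have h4 : b = 1 - a := by linarith
    subst h4
    rcases ha.eq_or_lt with rfl | ha
    · simp at h3; linarith
    · nlinarith
  have hi1 : i - 1 + 1 = i := sub_add_cancel i 1
  have hne1 : i - 1 ≠ i := by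
    intro h
    simp at h
  have hne2 : i + 1 ≠ i := by
    intro h
    simp at h
  set a := v (i + 1) - p with ha
  set b := v (i - 1) - p with hb
  have hva : v (i + 1) = p + a := by simp [ha]
  have hvb : v (i - 1) = p + b := by simp [hb]
  have ha0 : v (i + 1) ≠ p := fun h => hne2 (hv (h.trans hi.symm))
  have hb0 : v (i - 1) ≠ p := fun h => hne1 (hv (h.trans hi.symm))
  have haω : inner ℝ a ω < 0 := by
    rw [ha, inner_sub_left]
    linarith [hmax _ (hsegcl i (right_mem_segment ℝ _ _)) ha0]
  have hbω : inner ℝ b ω < 0 := by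
    rw [hb, inner_sub_left]
    linarith [hmax _ (hsegcl (i - 1) (left_mem_segment ℝ _ _)) hb0]
  have hsa : ∀ t : ℝ, 0 ≤ t → t ≤ 1 → p + t • a ∈ segment ℝ (v i) (v (i + 1)) := by
    intro t h0 h1
    refine ⟨1 - t, t, by linarith, h0, by ring, ?_⟩
    rw [hi, hva]; module
  have hsb : ∀ t : ℝ, 0 ≤ t → t ≤ 1 → p + t • b ∈ segment ℝ (v (i - 1)) (v (i - 1 + 1)) := by
    intro t h0 h1
    refine ⟨t, 1 - t, h0, by linarith, by ring, ?_⟩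
    rw [hi1, hi, hvb]; module
  -- Parallel edges at `p` would overlap: `p + (1 / (1 + l)) • a` lies on both, the parameters `1 /
  -- (1 + l)` and `l / (1 + l)` being at most 1, while only end points may be shared.
  have key : ∀ l : ℝ, 0 < l → a ≠ l • b := by
    intro l hl hab
    have ht : 0 < 1 / (1 + l) := by positivity
    have ht1 : 1 / (1 + l) < 1 := by rw [div_lt_one (by positivity)]; linarith
    have ht2 : 1 / (1 + l) * l ≤ 1 := by
      rw [div_mul_eq_mul_div, one_mul, div_le_one (by positivity)]; linarith
    have m1 := hsa _ ht.le ht1.le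
    have m2 := hsb _ (mul_nonneg ht.le hl.le) ht2
    have e : p + (1 / (1 + l) * l) • b = p + (1 / (1 + l)) • a := by rw [hab, smul_smul]
    rw [e] at m2
    have hane : a ≠ 0 := sub_ne_zero.2 ha0
    rcases (hseg i (i - 1) hne1.symm ⟨m1, m2⟩).1 with h | h
    · rw [hi] at h
      rcases smul_eq_zero.1 (add_eq_left.1 h) with h | h
      · exact ht.ne' h
      · exact hane h
    · rw [hva] at h
      have h := add_left_cancel h
      have : (1 / (1 + l) - 1) • a = 0 := by rw [sub_smul, h, one_smul, sub_self]
      rcases smul_eq_zero.1 this with h | h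
      · linarith
      · exact hane h
  -- Both edge vectors have negative product with `ω`, so a linear relation would make one a
  -- positive multiple of the other, which `key` excludes.
  obtain ⟨L, hL⟩ := exists_planeEquiv (a := a) (b := b) (by
    intro α β h
    have h1 : α * inner ℝ a ω + β * inner ℝ b ω = 0 := by
      rw [← real_inner_smul_left, ← real_inner_smul_left, ← inner_add_left, h, inner_zero_left]
    by_cases hα : α = 0
    · subst hα
      refine ⟨rfl, ?_⟩
      have : β * inner ℝ b ω = 0 := by linarith
      exact (mul_eq_zero.1 this).resolve_right hbω.ne
    · exfalso
      refine key (-β / α) ?_ ?_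
      · have : -β / α = inner ℝ a ω / inner ℝ b ω := by
          rw [div_eq_div_iff hα hbω.ne]; linarith
        rw [this]; exact div_pos_of_neg_of_neg haω hbω
      · have h2 : α • a = (-β) • b := by
          rw [neg_smul]; exact eq_neg_of_add_eq_zero_left h
        rw [div_eq_inv_mul, mul_smul, ← h2, smul_smul, inv_mul_cancel₀ hα, one_smul])
  -- the radius
  obtain ⟨r₁, hr₁, hball⟩ : ∃ r > 0, ∀ j, j ≠ i → j ≠ i - 1 → ∀ x ∈ Metric.ball p r,
      x ∉ segment ℝ (v j) (v (j + 1)) := by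
    have : ∀ᶠ x in 𝓝 p, ∀ j, j ≠ i → j ≠ i - 1 → x ∉ segment ℝ (v j) (v (j + 1)) := by
      rw [eventually_all]
      intro j
      by_cases h1 : j = i
      · exact Eventually.of_forall fun x h => absurd h1 h
      by_cases h2 : j = i - 1
      · exact Eventually.of_forall fun x _ h => absurd h2 h
      have hcl : IsClosed (segment ℝ (v j) (v (j + 1))) := by
        rw [segment_eq_image_lineMap]
        exact (isCompact_Icc.image (by fun_prop)).isClosed
      have hnot : p ∉ segment ℝ (v j) (v (j + 1)) := by
        intro hm
        have := (hseg i j (Ne.symm h1) ⟨hi ▸ left_mem_segment ℝ _ _, hm⟩).2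
        rcases this with h | h
        · exact h1 (hv (h.symm.trans hi.symm))
        · exact h2 (eq_sub_of_add_eq (hv (h.symm.trans hi.symm)))
      filter_upwards [hcl.isOpen_compl.mem_nhds hnot] with x hx _ _ using hx
    obtain ⟨r, hr, h⟩ := Metric.eventually_nhds_iff_ball.1 this
    exact ⟨r, hr, fun j h1 h2 x hx => h x hx j h1 h2⟩
  have hna : 0 < ‖a‖ := norm_pos_iff.2 (sub_ne_zero.2 ha0)
  have hnb : 0 < ‖b‖ := norm_pos_iff.2 (sub_ne_zero.2 hb0)
  set r := min r₁ (min ‖a‖ ‖b‖) with hr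
  have hr0 : 0 < r := lt_min hr₁ (lt_min hna hnb)
  have hLinj : ∀ {α β α' β' : ℝ}, L (α, β) = L (α', β') → α = α' ∧ β = β' := by
    intro α β α' β' h
    simpa using L.injective h
  -- the frontier in the ball consists of two rays
  have hfront : ∀ α β : ℝ, ‖L (α, β)‖ < r →
      (p + L (α, β) ∈ frontier P ↔ (0 ≤ α ∧ β = 0) ∨ (α = 0 ∧ 0 ≤ β)) := by
    intro α β hn
    constructor
    · intro h
      rw [hfr] at h
      obtain ⟨j, hj⟩ := mem_iUnion.1 h
      have hin : p + L (α, β) ∈ Metric.ball p r₁ := by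
        rw [Metric.mem_ball, dist_eq_norm, add_sub_cancel_left]
        exact hn.trans_le (min_le_left _ _)
      by_cases h1 : j = i
      · subst h1
        obtain ⟨s, t, hs, ht, hst, hx⟩ := hj
        have : L (α, β) = L (t, 0) := by
          rw [hL t 0]
          have hs' : s = 1 - t := by linarith
          have : p + L (α, β) = p + (t • a + (0 : ℝ) • b) := by
            rw [← hx, hs', hi, hva]; module
          exact add_left_cancel this
        obtain ⟨rfl, rfl⟩ := hLinj this
        exact Or.inl ⟨ht, rfl⟩
      by_cases h2 : j = i - 1
      · subst h2
        obtain ⟨s, t, hs, ht, hst, hx⟩ := hj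
        have : L (α, β) = L (0, s) := by
          rw [hL 0 s]
          have hs' : t = 1 - s := by linarith
          have : p + L (α, β) = p + ((0 : ℝ) • a + s • b) := by
            rw [← hx, hs', hi1, hi, hvb]; module
          exact add_left_cancel this
        obtain ⟨rfl, rfl⟩ := hLinj this
        exact Or.inr ⟨rfl, hs⟩
      exact absurd hj (hball j h1 h2 _ hin)
    · intro h
      rw [hfr]
      rcases h with ⟨h, rfl⟩ | ⟨rfl, h⟩
      · rw [hL, zero_smul, add_zero] at hn ⊢
        refine mem_iUnion.2 ⟨i, hsa α h ?_⟩
        rw [norm_smul, Real.norm_of_nonneg h] at hn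
        have : α * ‖a‖ < ‖a‖ := hn.trans_le ((min_le_right _ _).trans (min_le_left _ _))
        nlinarith
      · rw [hL, zero_smul, zero_add] at hn ⊢
        refine mem_iUnion.2 ⟨i - 1, hsb β h ?_⟩
        rw [norm_smul, Real.norm_of_nonneg h] at hn
        have : β * ‖b‖ < ‖b‖ := hn.trans_le ((min_le_right _ _).trans (min_le_right _ _))
        nlinarith
  have hPf : ∀ x ∈ P, x ∉ frontier P := fun x hx h => by
    rw [frontier, hopen.interior_eq] at h; exact h.2 hx
  -- connectedness along convex sets of parameters
  have hconv : ∀ C : Set (ℝ × ℝ), Convex ℝ C → (∀ y ∈ C, ‖L y‖ < r) →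
      (∀ y ∈ C, ¬ ((0 ≤ y.1 ∧ y.2 = 0) ∨ (y.1 = 0 ∧ 0 ≤ y.2))) →
      (∃ y ∈ C, p + L y ∈ P) → ∀ y ∈ C, p + L y ∈ P := by
    intro C hC h1 h2 ⟨y₀, hy₀, hy₀P⟩ y hy
    have : (fun y => p + L y) '' C ⊆ P := by
      refine (hC.isPreconnected.image _ (by fun_prop)).subset_of_closure_inter_subset hopen
        ⟨_, ⟨y₀, hy₀, rfl⟩, hy₀P⟩ ?_
      rintro _ ⟨hc, y, hy, rfl⟩
      by_contra hn
      exact h2 y hy ((hfront y.1 y.2 (h1 y hy)).1 ⟨hc, by rwa [hopen.interior_eq]⟩)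
    exact this ⟨y, hy, rfl⟩
  have hbc : Convex ℝ {y : ℝ × ℝ | ‖L y‖ < r} := by
    intro x hx y hy s t hs ht hst
    rw [mem_ofPred_eq, map_add, map_smul, map_smul, ← mem_ball_zero_iff]
    exact convex_ball (0 : Plane) r (mem_ball_zero_iff.2 hx) (mem_ball_zero_iff.2 hy) hs ht hst
  -- outside the closed sector there are no points of the polygon
  have hout : ∀ α β : ℝ, ‖L (α, β)‖ < r → p + L (α, β) ∈ P → 0 ≤ α ∧ 0 ≤ β := by
    intro α β hn hm
    by_contra hcon
    -- From a parameter outside the closed quadrant, the segment to `(-ε, -ε)` avoids the two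
    -- frontier rays. Thus `p + L (-ε, -ε)` would be in `P`, where the functional exceeds its value
    -- at `p`.
    have hlim : Tendsto (fun ε : ℝ => L (-ε, -ε)) (𝓝[>] 0) (𝓝 0) := by
      have : Continuous fun ε : ℝ => L (-ε, -ε) := by fun_prop
      have := this.tendsto 0
      simp only [neg_zero] at this
      rw [show ((0 : ℝ), (0 : ℝ)) = 0 from rfl, map_zero] at this
      exact this.mono_left nhdsWithin_le_nhds
    obtain ⟨ε, hεn, hε⟩ := ((hlim.norm.eventually (gt_mem_nhds (by simpa using hr0))).and
      self_mem_nhdsWithin).exists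
    have hε : 0 < ε := hε
    have hnot : ∀ y ∈ segment ℝ (α, β) (-ε, -ε), ¬ ((0 ≤ y.1 ∧ y.2 = 0) ∨ (y.1 = 0 ∧ 0 ≤ y.2)) := by
      rintro _ ⟨s, t, hs, ht, hst, rfl⟩
      simp only [Prod.smul_mk, smul_eq_mul, Prod.mk_add_mk]
      have hst' : t = 1 - s := by linarith
      subst hst'
      rcases not_and_or.1 hcon with h | h <;> push Not at h
      · have : s * α + (1 - s) * -ε < 0 := by
          rcases hs.eq_or_lt with rfl | hs
          · linarith
          · nlinarith
        rintro (h' | h') <;> linarith [h'.1]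
      · have : s * β + (1 - s) * -ε < 0 := by
          rcases hs.eq_or_lt with rfl | hs
          · linarith
          · nlinarith
        rintro (h' | h') <;> linarith [h'.2]
    have := hconv _ (convex_segment (α, β) (-ε, -ε)) (fun y hy => hbc.segment_subset hn hεn hy) hnot
      ⟨_, left_mem_segment ℝ _ _, hm⟩ _ (right_mem_segment ℝ _ _)
    have h2 : inner ℝ (p + L (-ε, -ε)) ω ≤ inner ℝ p ω := by
      by_cases h : p + L (-ε, -ε) = p
      · rw [h]
      · exact (hmax _ (subset_closure this) h).le
    rw [inner_add_left, hL, inner_add_left, real_inner_smul_left, real_inner_smul_left] at h2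
    nlinarith
  have hpos : ∀ α β : ℝ, ‖L (α, β)‖ < r → p + L (α, β) ∈ P → 0 < α ∧ 0 < β := by
    intro α β hn hm
    obtain ⟨h1, h2⟩ := hout α β hn hm
    have h3 := hPf _ hm
    rw [hfront α β hn] at h3
    constructor
    · refine h1.lt_of_ne' fun h => h3 (Or.inr ⟨h, h2⟩)
    · refine h2.lt_of_ne' fun h => h3 (Or.inl ⟨h1, h⟩)
  refine ⟨L, by simpa [hL] using haω, by simpa [hL] using hbω, r, hr0, fun α β hn =>
    ⟨hpos α β hn, fun hαβ => ?_⟩⟩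
  -- The open sector inside the ball is convex and free of frontier points. It contains a point of
  -- `P` because `p` is in the closure of `P`, hence it lies in `P`.
  refine hconv ({y | ‖L y‖ < r} ∩ (Ioi 0 ×ˢ Ioi 0)) (hbc.inter ((convex_Ioi 0).prod (convex_Ioi 0)))
    (fun y hy => hy.1) ?_ ?_ (α, β) ⟨hn, hαβ⟩
  · rintro y ⟨-, h1, h2⟩ (h | h)
    · exact (h2 : 0 < y.2).ne' h.2
    · exact (h1 : 0 < y.1).ne' h.1
  · obtain ⟨x, hx, hxp⟩ := Metric.mem_closure_iff.1 hp r hr0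
    obtain ⟨y, hy⟩ := L.surjective (x - p)
    have hyn : ‖L y‖ < r := by rw [hy, ← dist_eq_norm, dist_comm]; exact hxp
    have hyP : p + L y ∈ P := by rw [hy, add_sub_cancel]; exact hx
    exact ⟨y, ⟨hyn, hpos y.1 y.2 hyn hyP⟩, hyP⟩

instance isAddHaarMeasure_volume_spaceTime : (volume : Measure (Plane × ℝ)).IsAddHaarMeasure :=
  Measure.prod.instIsAddHaarMeasure volume volume

/-! ### Asymptotics of the source term -/

/-- In polar coordinates this is the integral of `r e^{-δ r}`. It supplies the spatial factor of the
dominating function at the vertex. -/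
theorem integrable_exp_neg_mul_norm {δ : ℝ} (hδ : 0 < δ) :
    Integrable (fun x : Plane => Real.exp (-δ * ‖x‖)) := by
  rw [integrable_fun_norm_addHaar volume (f := fun r => Real.exp (-δ * r))]
  have := integrableOn_rpow_mul_exp_neg_mul_rpow (s := 1) (p := 1) (b := δ) (by norm_num)
    one_pos hδ
  refine this.congr_fun (fun x hx => ?_) measurableSet_Ioi
  simp

/-- The Laplace transform of the characteristic function of a sector does not vanish. -/
theorem integral_sector_exp_ne_zero (L : (ℝ × ℝ) ≃L[ℝ] Plane) (ℓ : Plane →L[ℝ] ℂ)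
    (h1 : (ℓ (L (1, 0))).re < 0) (h2 : (ℓ (L (0, 1))).re < 0) :
    ∫ y : Plane, (if 0 < (L.symm y).1 ∧ 0 < (L.symm y).2 then Complex.exp (ℓ y) else 0) ≠ 0 := by
  set μ : Measure Plane := (volume : Measure (ℝ × ℝ)).map L with hμ
  have hμH : μ.IsAddHaarMeasure := inferInstance
  -- Uniqueness of Haar measure replaces the Jacobian of `L`; only `k ≠ 0` matters.
  obtain ⟨k, hk, e⟩ : ∃ k : NNReal, k ≠ 0 ∧ (volume : Measure Plane) = k • μ :=
    ⟨_, (Measure.addHaarScalarFactor_pos_of_isAddHaarMeasure _ _).ne',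
      Measure.isAddLeftInvariant_eq_smul (volume : Measure Plane) μ⟩
  -- In the coordinates of the two edges the sector is a quadrant and the exponential splits into a
  -- product.
  have hf : (fun y : ℝ × ℝ => (if 0 < y.1 ∧ 0 < y.2 then Complex.exp (ℓ (L y)) else 0))
      = fun y => (Ioi (0 : ℝ)).indicator (fun a : ℝ => Complex.exp (ℓ (L (1, 0)) * a)) y.1
        * (Ioi (0 : ℝ)).indicator (fun b : ℝ => Complex.exp (ℓ (L (0, 1)) * b)) y.2 := by
    ext ⟨a, b⟩
    have : (a, b) = a • ((1 : ℝ), (0 : ℝ)) + b • ((0 : ℝ), (1 : ℝ)) := by simp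
    by_cases ha : 0 < a <;> by_cases hb : 0 < b <;> simp [ha, hb]
    rw [← Complex.exp_add, this, map_add, map_smul, map_smul, map_add, map_smul, map_smul]
    simp only [Complex.real_smul]
    ring_nf
  have hemb : MeasurableEmbedding L := L.toHomeomorph.measurableEmbedding
  rw [e, integral_smul_nnreal_measure, hμ, hemb.integral_map]
  simp only [ContinuousLinearEquiv.symm_apply_apply]
  rw [hf, Measure.volume_eq_prod, integral_prod_mul, integral_indicator measurableSet_Ioi,
    integral_indicator measurableSet_Ioi, integral_exp_mul_complex_Ioi h1,
    integral_exp_mul_complex_Ioi h2]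
  have n1 : ℓ (L (1, 0)) ≠ 0 := fun h => by simp [h] at h1
  have n2 : ℓ (L (0, 1)) ≠ 0 := fun h => by simp [h] at h2
  refine smul_ne_zero hk (mul_ne_zero ?_ ?_) <;>
  · refine div_ne_zero (neg_ne_zero.2 (Complex.exp_ne_zero _)) ?_
    assumption

/-- The wave `exp (τ (-t + c x · ω + i κ x · ω^⊥))`. -/
noncomputable def expWave (ω ωp : Plane) (c κ τ : ℝ) (q : Plane × ℝ) : ℂ :=
  Complex.exp (τ * ((-q.2 + c * inner ℝ q.1 ω : ℝ) + (κ * inner ℝ q.1 ωp : ℝ) * Complex.I))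

theorem norm_expWave (ω ωp : Plane) (c κ τ : ℝ) (q : Plane × ℝ) :
    ‖expWave ω ωp c κ τ q‖ = Real.exp (τ * (-q.2 + c * inner ℝ q.1 ω)) := by
  simp [expWave, Complex.norm_exp]

theorem continuous_expWave (ω ωp : Plane) (c κ τ : ℝ) : Continuous (expWave ω ωp c κ τ) := by
  unfold expWave
  fun_prop

theorem expWave_add (ω ωp : Plane) (c κ τ : ℝ) (q r : Plane × ℝ) :
    expWave ω ωp c κ τ (q + r) = expWave ω ωp c κ τ q * expWave ω ωp c κ τ r := by
  unfold expWave
  rw [← Complex.exp_add]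
  simp only [Prod.fst_add, Prod.snd_add, inner_add_left]
  push_cast
  ring_nf

/-- The exponent is `τ` times a linear form, so the blow-up by `τ⁻¹` removes `τ` except through `κ`.
-/
theorem expWave_inv_smul (ω ωp : Plane) (c κ : ℝ) {τ : ℝ} (hτ : τ ≠ 0) (q : Plane × ℝ) :
    expWave ω ωp c κ τ (τ⁻¹ • q) = expWave ω ωp c κ 1 q := by
  unfold expWave
  simp only [Prod.smul_fst, Prod.smul_snd, real_inner_smul_left, smul_eq_mul]
  have : (τ : ℂ) ≠ 0 := by exact_mod_cast hτ
  congr 1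
  push_cast
  field_simp

/-- Leading asymptotics of the integral of an exponential wave against a density on `P × ]T₀, T₁[`,
at a vertex of `P` where the density is continuous and does not vanish. -/
theorem tendsto_integral_vertex {P : Set Plane} (hP : IsPolygonInterior P) {p ω ωp : Plane}
    (hω : ‖ω‖ = 1) (hp : p ∈ closure P)
    (hmax : ∀ x ∈ closure P, x ≠ p → inner ℝ x ω < inner ℝ p ω)
    {T₀ T₁ : ℝ} (hT : T₀ < T₁) {ρ : Plane × ℝ → ℝ}
    (hρ : MemLp ρ ⊤ (volume.restrict (P ×ˢ Ioo T₀ T₁)))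
    {U : Set (Plane × ℝ)} (hU : U ∈ 𝓝 (p, T₀)) {g : Plane × ℝ → ℝ}
    (hg : ContinuousAt g (p, T₀)) (hg0 : g (p, T₀) ≠ 0)
    (hρg : ∀ᵐ q ∂(volume.restrict (U ∩ (P ×ˢ Ioo T₀ T₁))), ρ q = g q)
    {c : ℝ} (hc : 0 < c) {κ : ℝ → ℝ} (hκ : Tendsto κ atTop (𝓝 c)) :
    ∃ l : ℂ, l ≠ 0 ∧ Tendsto (fun τ : ℝ => ((τ ^ 3 : ℝ) : ℂ) *
      ((expWave ω ωp c (κ τ) τ (p, T₀))⁻¹ *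
        ∫ q in P ×ˢ Ioo T₀ T₁, (ρ q : ℂ) * expWave ω ωp c (κ τ) τ q)) atTop (𝓝 l) := by
  obtain ⟨δ, hδ, hcone⟩ := hP.inner_sub_le hω hmax
  obtain ⟨L, hL1, hL2, r, hr, hsec⟩ := hP.exists_sector hp hmax
  have hPo : IsOpen P := by obtain ⟨k, v, -, -, h, -⟩ := hP; exact h
  have hPb : Bornology.IsBounded P := by obtain ⟨k, v, -, -, -, -, h, -⟩ := hP; exact h
  set S : Set (Plane × ℝ) := P ×ˢ Ioo T₀ T₁ with hS
  have hSm : MeasurableSet S := hPo.measurableSet.prod measurableSet_Ioo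
  have hSfin : volume S ≠ ⊤ := by
    have : Bornology.IsBounded S := hPb.prod (Metric.isBounded_Ioo _ _)
    exact this.measure_lt_top.ne
  obtain ⟨M, hM⟩ : ∃ M : ℝ, ∀ᵐ q ∂(volume.restrict S), |ρ q| ≤ M := by
    refine ⟨(eLpNorm ρ ⊤ (volume.restrict S)).toReal, ?_⟩
    have h := hρ.eLpNorm_ne_top
    rw [eLpNorm_exponent_top] at h ⊢
    filter_upwards [ae_le_eLpNormEssSup (f := ρ) (μ := volume.restrict S)] with q hq
    have := ENNReal.toReal_mono h hq
    simpa using this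
  -- a bounded representative of the density
  obtain ⟨V, hVo, hVmem, hVU, hVg⟩ : ∃ V : Set (Plane × ℝ), IsOpen V ∧ (p, T₀) ∈ V ∧ V ⊆ U ∧
      ∀ q ∈ V, |g q| ≤ |g (p, T₀)| + 1 := by
    have h1 : ∀ᶠ q in 𝓝 (p, T₀), |g q| < |g (p, T₀)| + 1 :=
      hg.abs.eventually (gt_mem_nhds (lt_add_one _))
    obtain ⟨V, hV, hVo, hVm⟩ := mem_nhds_iff.1 (inter_mem hU h1)
    exact ⟨V, hVo, hVm, fun x hx => (hV hx).1, fun x hx => (hV hx).2.le⟩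
  classical
  -- Changing `ρ` on a null set makes it equal to `g` everywhere near the vertex within the cylinder
  -- and bounded everywhere, so the rescaled integrands can be bounded and have limits at every `y`.
  set σ : Plane × ℝ → ℝ := fun q => if q ∈ V then g q else if |ρ q| ≤ M then ρ q else 0 with hσ
  have hσρ : σ =ᵐ[volume.restrict S] ρ := by
    have h1 : ∀ᵐ q ∂(volume.restrict S), q ∈ V → ρ q = g q := by
      rw [← ae_restrict_iff' hVo.measurableSet, Measure.restrict_restrict hVo.measurableSet]
      exact ae_mono (Measure.restrict_mono_set _ (inter_subset_inter_left _ hVU)) hρg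
    filter_upwards [h1, hM] with q hq hq2
    by_cases hqV : q ∈ V
    · simp [hσ, hqV, hq hqV]
    · simp [hσ, hqV, hq2]
  set B : ℝ := |g (p, T₀)| + 1 + |M| with hB
  have hσB : ∀ q, |σ q| ≤ B := by
    intro q
    simp only [hσ]
    split_ifs with h1 h2
    · linarith [hVg q h1, abs_nonneg M]
    · linarith [le_abs_self M, abs_nonneg (g (p, T₀))]
    · rw [abs_zero]; positivity
  have hB0 : 0 ≤ B := by positivity
  have hσm : AEStronglyMeasurable σ (volume.restrict S) :=
    hρ.aestronglyMeasurable.congr hσρ.symm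
  set F : ℝ → Plane × ℝ → ℂ := fun τ =>
    S.indicator fun q => (σ q : ℂ) * expWave ω ωp c (κ τ) τ (q - (p, T₀)) with hF
  have hFint : ∀ τ, Integrable (F τ) := by
    intro τ
    rw [hF, integrable_indicator_iff hSm]
    have hcont : Continuous fun q : Plane × ℝ => expWave ω ωp c (κ τ) τ (q - (p, T₀)) :=
      (continuous_expWave _ _ _ _ _).comp (by fun_prop)
    have hSb : Bornology.IsBounded S := hPb.prod (Metric.isBounded_Ioo _ _)
    obtain ⟨C, hC⟩ := hSb.isCompact_closure.exists_bound_of_continuousOn hcont.continuousOn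
    refine IntegrableOn.of_bound hSfin.lt_top
      ((Complex.continuous_ofReal.comp_aestronglyMeasurable hσm).mul
        hcont.aestronglyMeasurable) (B * C) ?_
    filter_upwards [ae_restrict_mem hSm] with q hq
    rw [norm_mul, Complex.norm_real, Real.norm_eq_abs]
    exact mul_le_mul (hσB q) (hC q (subset_closure hq)) (norm_nonneg _) hB0
  set G : ℝ → Plane × ℝ → ℂ := fun τ y => F τ ((p, T₀) + τ⁻¹ • y) with hG
  have hGint : ∀ τ, 0 < τ → Integrable (G τ) := fun τ hτ =>
    ((hFint τ).comp_add_left (p, T₀)).comp_smul (inv_ne_zero hτ.ne')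
  -- The factor `τ ^ 3` is the Jacobian of the blow-up: space-time has dimension three.
  have hGeq : ∀ τ, 0 < τ → ((τ ^ 3 : ℝ) : ℂ) * ((expWave ω ωp c (κ τ) τ (p, T₀))⁻¹ *
        ∫ q in S, (ρ q : ℂ) * expWave ω ωp c (κ τ) τ q) = ∫ y, G τ y := by
    intro τ hτ
    have h1 : ∫ y, G τ y = |((τ⁻¹) ^ 3)⁻¹| • ∫ y, F τ y := by
      have := Measure.integral_comp_smul (volume : Measure (Plane × ℝ))
        (fun y => F τ ((p, T₀) + y)) τ⁻¹
      rw [integral_add_left_eq_self (F τ)] at this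
      simpa using this
    have h2 : ∫ y, F τ y = (expWave ω ωp c (κ τ) τ (p, T₀))⁻¹ *
        ∫ q in S, (ρ q : ℂ) * expWave ω ωp c (κ τ) τ q := by
      rw [hF, integral_indicator hSm, ← integral_const_mul]
      refine integral_congr_ae ?_
      filter_upwards [hσρ] with q hq
      have h3 := expWave_add ω ωp c (κ τ) τ (p, T₀) (q - (p, T₀))
      rw [add_sub_cancel] at h3
      have h4 : expWave ω ωp c (κ τ) τ (p, T₀) ≠ 0 := Complex.exp_ne_zero _
      rw [hq, h3]
      field_simp
    rw [h1, h2, abs_of_pos (by positivity), inv_pow, inv_inv, Complex.real_smul]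
  -- the limit
  set ℓ : Plane →L[ℝ] ℂ := (c : ℂ) • (Complex.ofRealCLM.comp (innerSL ℝ ω) +
    Complex.I • Complex.ofRealCLM.comp (innerSL ℝ ωp)) with hℓ
  have hℓa : ∀ y, ℓ y = c * (inner ℝ y ω : ℝ) + c * (inner ℝ y ωp : ℝ) * Complex.I := by
    intro y
    simp only [hℓ, smul_apply, add_apply,
      ContinuousLinearMap.comp_apply, innerSL_apply_apply, Complex.ofRealCLM_apply, smul_eq_mul,
      real_inner_comm]
    ring
  have hℓre : ∀ y, (ℓ y).re = c * inner ℝ y ω := fun y => by rw [hℓa]; simp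
  set Φ : Plane → ℂ := fun y =>
    if 0 < (L.symm y).1 ∧ 0 < (L.symm y).2 then Complex.exp (ℓ y) else 0 with hΦ
  set Ψ : ℝ → ℂ := (Ioi 0).indicator fun s : ℝ => Complex.exp ((-1 : ℂ) * s) with hΨ
  have hlim : Tendsto (fun τ => ∫ y, G τ y) atTop
      (𝓝 (∫ y : Plane × ℝ, (g (p, T₀) : ℂ) * (Φ y.1 * Ψ y.2))) := by
    -- The cone bound `⟨x - p, ω⟩ ≤ -δ ‖x - p‖` is homogeneous, hence survives the rescaling and
    -- gives `e^{-cδ‖y‖}` uniformly in `τ`; the time variable gives `e^{-s}`.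
    refine tendsto_integral_filter_of_dominated_convergence
      (fun y => B * (Real.exp (-(c * δ) * ‖y.1‖) * (Ioi 0).indicator (fun s => Real.exp (-s)) y.2))
      ?_ ?_ ?_ ?_
    · filter_upwards [eventually_gt_atTop 0] with τ hτ using (hGint τ hτ).aestronglyMeasurable
    · filter_upwards [eventually_gt_atTop 0] with τ hτ
      refine Eventually.of_forall fun y => ?_
      have hpos : 0 ≤ (Ioi (0 : ℝ)).indicator (fun s => Real.exp (-s)) y.2 :=
        indicator_nonneg (fun s _ => (Real.exp_pos _).le) _
      simp only [hG, hF]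
      by_cases hy : (p, T₀) + τ⁻¹ • y ∈ S
      · rw [indicator_of_mem hy, add_sub_cancel_left, expWave_inv_smul _ _ _ _ hτ.ne', norm_mul,
          norm_expWave, Complex.norm_real, Real.norm_eq_abs]
        obtain ⟨hy1, hy2⟩ := hy
        simp only [Prod.snd_add, Prod.smul_snd, smul_eq_mul, mem_Ioo, lt_add_iff_pos_right] at hy2
        have hy20 : 0 < y.2 := pos_of_mul_pos_right hy2.1 (inv_nonneg.2 hτ.le)
        rw [indicator_of_mem (show y.2 ∈ Ioi (0 : ℝ) from hy20), ← Real.exp_add]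
        refine mul_le_mul (hσB _) (Real.exp_le_exp.2 ?_) (Real.exp_pos _).le hB0
        have h3 := hcone _ hy1
        simp only [Prod.fst_add, Prod.smul_fst, add_sub_cancel_left, real_inner_smul_left,
          norm_smul, Real.norm_of_nonneg (inv_nonneg.2 hτ.le)] at h3
        have h4 : inner ℝ y.1 ω ≤ -δ * ‖y.1‖ := by
          have h5 : τ⁻¹ * inner ℝ y.1 ω ≤ τ⁻¹ * (-δ * ‖y.1‖) := by linarith
          exact le_of_mul_le_mul_left h5 (inv_pos.2 hτ)
        nlinarith
      · rw [indicator_of_notMem hy, norm_zero]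
        positivity
    · have hs : Integrable ((Ioi (0 : ℝ)).indicator fun s => Real.exp (-s)) := by
        rw [integrable_indicator_iff measurableSet_Ioi]
        exact integrableOn_exp_neg_Ioi 0
      exact ((integrable_exp_neg_mul_norm (mul_pos hc hδ)).mul_prod hs).const_mul B
    · refine Eventually.of_forall fun y => ?_
      have hto : Tendsto (fun τ : ℝ => (p, T₀) + τ⁻¹ • y) atTop (𝓝 (p, T₀)) := by
        have := (tendsto_inv_atTop_zero (𝕜 := ℝ)).smul_const y
        simpa using this.const_add (p, T₀)
      -- For fixed `y`, the rescaled cylinder eventually looks like the sector times the half-line: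
      -- its upper end and the rest of the polygon move off to infinity.
      have hmem : ∀ᶠ τ : ℝ in atTop, ((p, T₀) + τ⁻¹ • y ∈ S ↔
          (0 < (L.symm y.1).1 ∧ 0 < (L.symm y.1).2) ∧ 0 < y.2) := by
        have h1 : Tendsto (fun τ : ℝ => ‖τ⁻¹ • y.1‖) atTop (𝓝 0) := by
          have := ((tendsto_inv_atTop_zero (𝕜 := ℝ)).smul_const y.1).norm
          simpa using this
        have h2 : Tendsto (fun τ : ℝ => T₀ + τ⁻¹ * y.2) atTop (𝓝 T₀) := by
          have := (tendsto_inv_atTop_zero (𝕜 := ℝ)).mul_const y.2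
          simpa using this.const_add T₀
        filter_upwards [h1.eventually (gt_mem_nhds hr), h2.eventually (gt_mem_nhds hT),
          eventually_gt_atTop 0] with τ hτ1 hτ2 hτ
        have h3 : τ⁻¹ • y.1 = L (τ⁻¹ * (L.symm y.1).1, τ⁻¹ * (L.symm y.1).2) := by
          rw [show (τ⁻¹ * (L.symm y.1).1, τ⁻¹ * (L.symm y.1).2) = τ⁻¹ • L.symm y.1 from rfl,
            map_smul, L.apply_symm_apply]
        have hi : 0 < τ⁻¹ := inv_pos.2 hτ
        have h4 := hsec (τ⁻¹ * (L.symm y.1).1) (τ⁻¹ * (L.symm y.1).2) (by rw [← h3]; exact hτ1)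
        rw [← h3, mul_pos_iff_of_pos_left hi, mul_pos_iff_of_pos_left hi] at h4
        rw [hS, mem_prod, ← h4]
        simp only [Prod.fst_add, Prod.smul_fst, Prod.snd_add, Prod.smul_snd, smul_eq_mul, mem_Ioo,
          lt_add_iff_pos_right, mul_pos_iff_of_pos_left hi, hτ2, and_true]
      by_cases hy : (0 < (L.symm y.1).1 ∧ 0 < (L.symm y.1).2) ∧ 0 < y.2
      · have hval : Φ y.1 * Ψ y.2 = expWave ω ωp c c 1 y := by
          simp only [hΦ, hΨ]
          rw [if_pos hy.1, indicator_of_mem (show y.2 ∈ Ioi (0 : ℝ) from hy.2), ← Complex.exp_add,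
            expWave, hℓa]
          congr 1
          push_cast
          ring
        rw [hval]
        have hlim2 : Tendsto (fun τ => (g ((p, T₀) + τ⁻¹ • y) : ℂ) * expWave ω ωp c (κ τ) 1 y) atTop
            (𝓝 ((g (p, T₀) : ℂ) * expWave ω ωp c c 1 y)) := by
          refine Tendsto.mul ?_ ?_
          · exact (Complex.continuous_ofReal.tendsto _).comp (hg.tendsto.comp hto)
          · have : Continuous fun k : ℝ => expWave ω ωp c k 1 y := by
              unfold expWave; fun_prop
            exact (this.tendsto c).comp hκ
        refine hlim2.congr' ?_
        filter_upwards [hmem, hto.eventually (hVo.mem_nhds hVmem), eventually_gt_atTop 0]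
          with τ h1 h2 hτ
        have h2 : (p, T₀) + τ⁻¹ • y ∈ V := h2
        simp only [hG, hF]
        rw [indicator_of_mem (h1.2 hy), add_sub_cancel_left, expWave_inv_smul _ _ _ _ hτ.ne']
        simp [hσ, h2]
      · have hval : Φ y.1 * Ψ y.2 = 0 := by
          simp only [hΦ, hΨ]
          by_cases h1 : 0 < (L.symm y.1).1 ∧ 0 < (L.symm y.1).2
          · have h2 : ¬ 0 < y.2 := fun h => hy ⟨h1, h⟩
            rw [indicator_of_notMem (show y.2 ∉ Ioi (0 : ℝ) from h2), mul_zero]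
          · rw [if_neg h1, zero_mul]
        rw [hval, mul_zero]
        refine tendsto_const_nhds.congr' ?_
        filter_upwards [hmem] with τ h1
        simp only [hG, hF]
        rw [indicator_of_notMem (fun h => hy (h1.1 h))]
  refine ⟨_, ?_, hlim.congr' ?_⟩
  · rw [integral_const_mul, Measure.volume_eq_prod, integral_prod_mul]
    refine mul_ne_zero (by exact_mod_cast hg0) (mul_ne_zero ?_ ?_)
    · refine integral_sector_exp_ne_zero L ℓ ?_ ?_
      · rw [hℓre]; exact mul_neg_of_pos_of_neg hc hL1
      · rw [hℓre]; exact mul_neg_of_pos_of_neg hc hL2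
    · rw [hΨ, integral_indicator measurableSet_Ioi, integral_exp_mul_complex_Ioi (by simp)]
      simp
  · filter_upwards [eventually_gt_atTop 0] with τ hτ using (hGeq τ hτ).symm

/-! ### Arc length of curves -/

/-- **Area formula** for an injective `C¹` curve. -/
theorem comap_hausdorffMeasure_curve {γ : ℝ → Plane} (hγ : ContDiff ℝ 1 γ)
    (hinj : Function.Injective γ) :
    Measure.comap γ (Measure.hausdorffMeasure 1 : Measure Plane)
      = volume.withDensity fun r => ‖deriv γ r‖ₑ := by
  have hemb : MeasurableEmbedding γ := hγ.continuous.measurableEmbedding hinj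
  set ν : Measure ℝ := Measure.comap γ (Measure.hausdorffMeasure 1 : Measure Plane) with hν
  have hνa : ∀ s, ν s = (Measure.hausdorffMeasure 1 : Measure Plane) (γ '' s) := fun s =>
    hemb.comap_apply _ _
  have hupper : ∀ (K : NNReal) (t : Set ℝ), LipschitzOnWith K γ t → ∀ s ⊆ t, ν s ≤ K * volume s := by
    intro K t h s hs
    rw [hνa]
    have := (h.mono hs).hausdorffMeasure_image_le (d := 1) zero_le_one
    rwa [hausdorffMeasure_real, ENNReal.rpow_one] at this
  -- The inverse of `γ` on the image is Lipschitz with constant `k⁻¹`, and Lipschitz maps control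
  -- `hausdorffMeasure 1`.
  have hlower : ∀ (k : NNReal) (t : Set ℝ), 0 < k →
      (∀ a ∈ t, ∀ b ∈ t, k * dist a b ≤ dist (γ a) (γ b)) → ∀ s ⊆ t, k * volume s ≤ ν s := by
    intro k t hk h s hs
    have hl : LipschitzOnWith k⁻¹ (Function.invFun γ) (γ '' s) := by
      refine LipschitzOnWith.of_dist_le_mul ?_
      rintro _ ⟨a, ha, rfl⟩ _ ⟨b, hb, rfl⟩
      rw [Function.leftInverse_invFun hinj a, Function.leftInverse_invFun hinj b, NNReal.coe_inv,
        ← div_eq_inv_mul, le_div_iff₀ (by exact_mod_cast hk), mul_comm]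
      exact h a (hs ha) b (hs hb)
    have := hl.hausdorffMeasure_image_le (d := 1) zero_le_one
    rw [hausdorffMeasure_real, ENNReal.rpow_one, ← image_comp,
      (Function.leftInverse_invFun hinj).comp_eq_id, image_id, ← hνa, ENNReal.coe_inv hk.ne',
      ← ENNReal.div_eq_inv_mul] at this
    rw [mul_comm]
    exact (ENNReal.le_div_iff_mul_le (Or.inl (by exact_mod_cast hk.ne'))
      (Or.inl ENNReal.coe_ne_top)).1 this
  have hlip : ∀ n : ℝ, ∃ K : NNReal, LipschitzOnWith K γ (Icc (-n) n) := fun n =>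
    hγ.contDiffOn.exists_lipschitzOnWith one_ne_zero (convex_Icc _ _) isCompact_Icc
  have hlf : IsLocallyFiniteMeasure ν := by
    refine ⟨fun x => ⟨Icc (-(|x| + 1)) (|x| + 1), Icc_mem_nhds ?_ ?_, ?_⟩⟩
    · linarith [neg_abs_le x]
    · linarith [le_abs_self x]
    · obtain ⟨K, hK⟩ := hlip (|x| + 1)
      refine (hupper K _ hK _ subset_rfl).trans_lt (ENNReal.mul_lt_top ENNReal.coe_lt_top ?_)
      exact measure_Icc_lt_top
  have hac : ν ≪ volume := by
    intro s hs
    have hu : s = ⋃ n : ℕ, s ∩ Icc (-(n : ℝ)) n := by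
      rw [← inter_iUnion, eq_comm, inter_eq_left]
      intro x _
      obtain ⟨n, hn⟩ := exists_nat_ge |x|
      exact mem_iUnion.2 ⟨n, abs_le.1 hn⟩
    rw [hu, measure_iUnion_null_iff]
    intro n
    obtain ⟨K, hK⟩ := hlip n
    have := hupper K _ hK _ (inter_subset_right (s := s))
    rw [measure_mono_null inter_subset_left hs, mul_zero] at this
    exact le_antisymm this (zero_le)
  -- By absolute continuity only the Radon-Nikodym density is unknown. It is found by
  -- differentiating `ν` along shrinking closed balls.
  rw [← Measure.withDensity_rnDeriv_eq ν volume hac]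
  refine withDensity_congr_ae ?_
  filter_upwards [Besicovitch.ae_tendsto_rnDeriv ν volume] with x hx
  refine tendsto_nhds_unique hx ?_
  have hstrict : HasStrictDerivAt γ (deriv γ x) x :=
    hγ.contDiffAt.hasStrictDerivAt one_ne_zero
  rw [ENNReal.tendsto_nhds (by simp)]
  intro ε hε
  obtain ⟨e, he0, heε⟩ : ∃ e : NNReal, 0 < e ∧ (e : ENNReal) ≤ ε := by
    obtain ⟨e, he, h⟩ := ENNReal.lt_iff_exists_nnreal_btwn.1 hε
    exact ⟨e, by exact_mod_cast he, h.le⟩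
  -- Strict differentiability compares any two points near `x`, so on small balls `γ` is
  -- bi-Lipschitz with constants `‖γ'(x)‖ ± e`. The lower one is informative only when it is
  -- positive.
  have hlo := hstrict.isLittleO.def (c := e) (by exact_mod_cast he0)
  rw [nhds_prod_eq] at hlo
  obtain ⟨t, ht, hts⟩ := mem_prod_self_iff.1 hlo
  obtain ⟨d, hd, hdt⟩ := Metric.mem_nhds_iff.1 ht
  have hbd : ∀ a ∈ t, ∀ b ∈ t, ‖γ a - γ b - (a - b) • deriv γ x‖ ≤ e * ‖a - b‖ := by
    intro a ha b hb
    have := hts (mk_mem_prod ha hb)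
    simpa using this
  have hL : LipschitzOnWith (‖deriv γ x‖₊ + e) γ t := by
    refine LipschitzOnWith.of_dist_le_mul fun a ha b hb => ?_
    have h1 := hbd a ha b hb
    have h2 := norm_add_le (γ a - γ b - (a - b) • deriv γ x) ((a - b) • deriv γ x)
    rw [sub_add_cancel, norm_smul] at h2
    rw [dist_eq_norm, dist_eq_norm, NNReal.coe_add, coe_nnnorm]
    linarith
  have hLo : ∀ a ∈ t, ∀ b ∈ t, (‖deriv γ x‖ - e) * dist a b ≤ dist (γ a) (γ b) := by
    intro a ha b hb
    have h1 := hbd a ha b hb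
    have h2 := norm_sub_le (γ a - γ b) (γ a - γ b - (a - b) • deriv γ x)
    rw [sub_sub_cancel, norm_smul] at h2
    rw [dist_eq_norm, dist_eq_norm]
    linarith
  filter_upwards [Ioo_mem_nhdsGT hd] with r hr
  have hsub : Metric.closedBall x r ⊆ t :=
    (Metric.closedBall_subset_ball hr.2).trans hdt
  have hv : volume (Metric.closedBall x r) ≠ 0 :=
    (Metric.measure_closedBall_pos volume x hr.1).ne'
  have hv2 : volume (Metric.closedBall x r) ≠ ⊤ := measure_closedBall_lt_top.ne
  constructor
  · rw [ENNReal.le_div_iff_mul_le (Or.inl hv) (Or.inl hv2)]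
    refine (mul_le_mul_left (tsub_le_tsub_left heε _) _).trans ?_
    -- In this case truncated subtraction makes the lower bound zero; this covers the points where
    -- `γ'` vanishes.
    by_cases h : ‖deriv γ x‖₊ ≤ e
    · rw [tsub_eq_zero_of_le (by exact_mod_cast h), zero_mul]
      exact zero_le
    · have hpos : 0 < ‖deriv γ x‖₊ - e := tsub_pos_of_lt (not_le.1 h)
      have := hlower (‖deriv γ x‖₊ - e) t hpos (by
        rw [NNReal.coe_sub (not_le.1 h).le, coe_nnnorm]; exact hLo) _ hsub
      rwa [ENNReal.coe_sub] at this
  · refine ENNReal.div_le_of_le_mul ?_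
    refine (hupper _ t hL _ hsub).trans (mul_le_mul_left ?_ _)
    rw [ENNReal.coe_add]
    exact add_le_add_right heε _

/-! ### Boundary charts -/

/-- The height below the graph of `g`, in the Cartesian coordinates `e` centred at `p`. -/
noncomputable def depth (p : Plane) (e : Plane ≃ₗᵢ[ℝ] Plane) (g : ℝ → ℝ) (x : Plane) : ℝ :=
  g (e (x - p) 0) - e (x - p) 1

/-- The point with abscissa `y.1` and depth `y.2`. -/
noncomputable def graphChart (p : Plane) (e : Plane ≃ₗᵢ[ℝ] Plane) (g : ℝ → ℝ) (y : ℝ × ℝ) : Plane :=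
  p + e.symm !₂[y.1, g y.1 - y.2]

section chart

variable {p : Plane} {e : Plane ≃ₗᵢ[ℝ] Plane} {g : ℝ → ℝ}

theorem chart_apply_zero (y : ℝ × ℝ) : e (graphChart p e g y - p) 0 = y.1 := by
  simp [graphChart]

theorem chart_apply_one (y : ℝ × ℝ) : e (graphChart p e g y - p) 1 = g y.1 - y.2 := by
  simp [graphChart]

theorem depth_chart (y : ℝ × ℝ) : depth p e g (graphChart p e g y) = y.2 := by
  rw [depth, chart_apply_zero, chart_apply_one, sub_sub_cancel]

theorem chart_depth (x : Plane) : graphChart p e g (e (x - p) 0, depth p e g x) = x := by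
  rw [graphChart, depth]
  simp only [sub_sub_cancel]
  have : !₂[e (x - p) 0, e (x - p) 1] = e (x - p) := by
    ext i; fin_cases i <;> simp
  rw [this, e.symm_apply_apply, add_sub_cancel]

theorem contDiff_depth (hg : ContDiff ℝ (⊤ : ℕ∞) g) : ContDiff ℝ (⊤ : ℕ∞) (depth p e g) := by
  have h : ∀ i, ContDiff ℝ (⊤ : ℕ∞) fun x : Plane => e (x - p) i := fun i =>
    ((EuclideanSpace.proj (𝕜 := ℝ) i).comp (e : Plane →L[ℝ] Plane)).contDiff.comp
      (contDiff_id.sub contDiff_const)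
  exact (hg.comp (h 0)).sub (h 1)

theorem fderiv_depth (hg : ContDiff ℝ (⊤ : ℕ∞) g) (x w : Plane) :
    fderiv ℝ (depth p e g) x w = deriv g (e (x - p) 0) * e w 0 - e w 1 := by
  have h : ∀ i, HasFDerivAt (fun x : Plane => e (x - p) i)
      ((EuclideanSpace.proj (𝕜 := ℝ) i).comp (e : Plane →L[ℝ] Plane)) x := fun i =>
    (((EuclideanSpace.proj (𝕜 := ℝ) i).comp (e : Plane →L[ℝ] Plane)).hasFDerivAt).comp x
      ((hasFDerivAt_id x).sub_const p)
  have hgd : HasDerivAt g (deriv g (e (x - p) 0)) (e (x - p) 0) :=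
    (hg.differentiable (by simp) _).hasDerivAt
  have := (hgd.comp_hasFDerivAt x (h 0)).sub (h 1)
  have e1 : depth p e g = (g ∘ fun x : Plane => e (x - p) 0) - fun x : Plane => e (x - p) 1 := rfl
  rw [e1, this.fderiv]
  simp

theorem continuous_chart (hg : Continuous g) : Continuous (graphChart p e g) := by
  unfold graphChart
  have : Continuous fun y : ℝ × ℝ => (!₂[y.1, g y.1 - y.2] : Plane) := by
    refine (PiLp.continuous_toLp 2 _).comp (continuous_pi fun i => ?_)
    fin_cases i
    · exact continuous_fst
    · exact (hg.comp continuous_fst).sub continuous_snd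
  exact continuous_const.add (e.symm.continuous.comp this)

theorem injective_chart : Function.Injective (graphChart p e g) := by
  intro y z h
  have h1 := chart_apply_zero (p := p) (e := e) (g := g) y
  have h2 := depth_chart (p := p) (e := e) (g := g) y
  rw [h, chart_apply_zero] at h1
  rw [h, depth_chart] at h2
  exact (Prod.ext h1 h2).symm

/-- On each vertical line the chart is the reflection `s ↦ g r - s`, which preserves length; what
remains is an isometry and a translation. Depth is thus measured vertically, with Jacobian one. -/
theorem measurePreserving_chart (hg : Continuous g) : MeasurePreserving (graphChart p e g) := by
  have h1 : MeasurePreserving (fun y : ℝ × ℝ => (y.1, g y.1 - y.2)) := by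
    refine (MeasurePreserving.id volume).skew_product (g := fun a b => g a - b) ?_ ?_
    · exact ((hg.comp continuous_fst).sub continuous_snd).measurable
    · exact Eventually.of_forall fun a => (Measure.measurePreserving_sub_left volume (g a)).map_eq
  have h2 := (volume_preserving_finTwoArrow ℝ).symm.comp h1
  have h3 := (PiLp.volume_preserving_toLp (Fin 2)).comp h2
  have h4 := e.symm.measurePreserving.comp h3
  have h5 := (measurePreserving_add_left volume p).comp h4
  exact h5

/-- Change of variables in a layer along a graph. -/
theorem integral_layer (hg : Continuous g) {K : Plane → ℝ} (hK : Continuous K) {a : ℝ}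
    (hKa : ∀ x, a ≤ |e (x - p) 0| → K x = 0)
    {m : ℝ → ℝ} (hm : Continuous m) (hm0 : ∀ σ ∉ Icc (1 : ℝ) 2, m σ = 0) {ε : ℝ} (hε : 0 < ε) :
    ∫ x, K x * (m (depth p e g x / ε) / ε)
      = ∫ y : ℝ × ℝ, K (graphChart p e g (y.1, ε * y.2)) * m y.2 := by
  have hΦ := continuous_chart (p := p) (e := e) hg
  have hemb : MeasurableEmbedding (graphChart p e g) :=
    hΦ.measurableEmbedding injective_chart
  rw [← (measurePreserving_chart (p := p) (e := e) hg).integral_comp hemb]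
  simp only [depth_chart]
  have hKc : ∀ y : ℝ × ℝ, y.1 ∉ Icc (-a) a → K (graphChart p e g y) = 0 := fun y hy => by
    refine hKa _ ?_
    rw [chart_apply_zero]
    by_contra h
    exact hy (abs_le.1 (not_le.1 h).le)
  have hint : ∀ (k : ℝ → ℝ), Continuous k → (HasCompactSupport k) → ∀ δ : ℝ,
      Integrable fun y : ℝ × ℝ => K (graphChart p e g (y.1, δ * y.2)) * k y.2 := by
    intro k hk hkc δ
    refine Continuous.integrable_of_hasCompactSupport ?_ ?_
    · exact (hK.comp (hΦ.comp (by fun_prop))).mul (hk.comp continuous_snd)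
    · refine HasCompactSupport.intro (isCompact_Icc.prod hkc) (K := Icc (-a) a ×ˢ tsupport k) ?_
      intro y hy
      by_cases h1 : y.1 ∈ Icc (-a) a
      · have h2 : y.2 ∉ tsupport k := fun h => hy ⟨h1, h⟩
        rw [image_eq_zero_of_notMem_tsupport h2, mul_zero]
      · rw [hKc (y.1, δ * y.2) h1, zero_mul]
  have hmc : HasCompactSupport m := HasCompactSupport.intro isCompact_Icc hm0
  have i1 := hint m hm hmc ε
  have i2 := hint (fun s => m (s / ε) / ε) (by fun_prop) (by
    refine HasCompactSupport.intro (isCompact_Icc (a := ε) (b := 2 * ε)) fun s hs => ?_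
    rw [hm0, zero_div]
    rintro ⟨h1, h2⟩
    exact hs ⟨(one_le_div hε).1 h1, (div_le_iff₀ hε).1 h2⟩) 1
  simp only [one_mul] at i2
  rw [Measure.volume_eq_prod] at i1 i2 ⊢
  rw [integral_prod _ i1, integral_prod _ i2]
  congr 1
  ext r
  -- The rescaling of depth by `ε` is done on each vertical line separately.
  have := Measure.integral_comp_div (fun σ => K (graphChart p e g (r, ε * σ)) * (m σ / ε)) ε
  simp only [mul_div_cancel₀ _ hε.ne'] at this
  rw [this, abs_of_pos hε, smul_eq_mul, ← integral_const_mul]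
  congr 1
  ext σ
  field_simp

/-- The mass of `m` concentrates at depth zero as `ε` tends to `0`. The limit carries the measure
`dr` of the abscissa, not arc length; the missing factor comes from the gradient of the depth. -/
theorem tendsto_integral_layer (hg : Continuous g) {K : Plane → ℝ} (hK : Continuous K) {a : ℝ}
    (hKa : ∀ x, a ≤ |e (x - p) 0| → K x = 0) {B : ℝ} (hB : ∀ x, |K x| ≤ B)
    {m : ℝ → ℝ} (hm : Continuous m) (hm0 : ∀ σ ∉ Icc (1 : ℝ) 2, m σ = 0) (hm1 : ∫ σ, m σ = 1) :
    Tendsto (fun ε : ℝ => ∫ x, K x * (m (depth p e g x / ε) / ε)) (𝓝[>] 0)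
      (𝓝 (∫ r, K (graphChart p e g (r, 0)))) := by
  have hΦ := continuous_chart (p := p) (e := e) hg
  have hmc : HasCompactSupport m := HasCompactSupport.intro isCompact_Icc hm0
  have hmi : Integrable m := hm.integrable_of_hasCompactSupport hmc
  have hlim : Tendsto (fun ε : ℝ => ∫ y : ℝ × ℝ, K (graphChart p e g (y.1, ε * y.2)) * m y.2)
      (𝓝[>] 0) (𝓝 (∫ y : ℝ × ℝ, K (graphChart p e g (y.1, 0)) * m y.2)) := by
    refine tendsto_integral_filter_of_dominated_convergence
      (fun y => (Icc (-a) a).indicator (fun _ => B) y.1 * |m y.2|) ?_ ?_ ?_ ?_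
    · refine Eventually.of_forall fun ε => Continuous.aestronglyMeasurable ?_
      exact (hK.comp (hΦ.comp (by fun_prop))).mul (hm.comp continuous_snd)
    · refine Eventually.of_forall fun ε => Eventually.of_forall fun y => ?_
      rw [norm_mul, Real.norm_eq_abs, Real.norm_eq_abs]
      refine mul_le_mul_of_nonneg_right ?_ (abs_nonneg _)
      by_cases h : y.1 ∈ Icc (-a) a
      · rw [indicator_of_mem h]; exact hB _
      · rw [indicator_of_notMem h, hKa _ ?_, abs_zero]
        rw [chart_apply_zero]
        by_contra h'
        exact h (abs_le.1 (not_le.1 h').le)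
    · refine Integrable.mul_prod ?_ hmi.abs
      rw [integrable_indicator_iff measurableSet_Icc]
      exact integrableOn_const measure_Icc_lt_top.ne
    · refine Eventually.of_forall fun y => ?_
      have hc : Continuous fun ε : ℝ => K (graphChart p e g (y.1, ε * y.2)) * m y.2 :=
        (hK.comp (hΦ.comp (by fun_prop))).mul continuous_const
      have := hc.tendsto 0
      rw [zero_mul] at this
      exact this.mono_left nhdsWithin_le_nhds
  have hval : ∫ y : ℝ × ℝ, K (graphChart p e g (y.1, 0)) * m y.2
      = ∫ r, K (graphChart p e g (r, 0)) := by
    rw [Measure.volume_eq_prod, integral_prod_mul (fun r => K (graphChart p e g (r, 0))) m, hm1,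
      mul_one]
  rw [hval] at hlim
  refine hlim.congr' ?_
  filter_upwards [self_mem_nhdsWithin] with ε hε
  exact (integral_layer hg hK hKa hm hm0 hε).symm

/-- The bound does not depend on `ε`. It is what later allows dominated convergence in the time
variable. -/
theorem integral_layer_le (hg : Continuous g) {K : Plane → ℝ} (hK : Continuous K) {a : ℝ}
    (hKa : ∀ x, a ≤ |e (x - p) 0| → K x = 0) {B : ℝ} (hB : ∀ x, |K x| ≤ B)
    {m : ℝ → ℝ} (hm : Continuous m) (hm0 : ∀ σ ∉ Icc (1 : ℝ) 2, m σ = 0) {ε : ℝ} (hε : 0 < ε) :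
    ∫ x, |K x * (m (depth p e g x / ε) / ε)|
      ≤ (∫ r, (Icc (-a) a).indicator (fun _ => B) r) * ∫ σ, |m σ| := by
  have hΦ := continuous_chart (p := p) (e := e) hg
  have h1 := integral_layer (p := p) (e := e) hg hK.abs (a := a)
    (fun x hx => by simp only [hKa x hx, abs_zero]) hm.abs
    (fun σ hσ => by simp only [hm0 σ hσ, abs_zero]) hε
  have h2 : ∀ x, |K x * (m (depth p e g x / ε) / ε)|
      = |K x| * (|m (depth p e g x / ε)| / ε) := fun x => by
    rw [abs_mul, abs_div, abs_of_pos hε]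
  simp only [h2]
  rw [h1, ← integral_prod_mul, ← Measure.volume_eq_prod]
  have hmi : Integrable m :=
    hm.integrable_of_hasCompactSupport (HasCompactSupport.intro isCompact_Icc hm0)
  refine integral_mono_of_nonneg (Eventually.of_forall fun y => by positivity)
    (Integrable.mul_prod ?_ hmi.abs) (Eventually.of_forall fun y => ?_)
  · rw [integrable_indicator_iff measurableSet_Icc]
    exact integrableOn_const measure_Icc_lt_top.ne
  · refine mul_le_mul_of_nonneg_right ?_ (abs_nonneg _)
    by_cases h : y.1 ∈ Icc (-a) a
    · rw [indicator_of_mem h]; exact hB _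
    · rw [indicator_of_notMem h, hKa _ ?_, abs_zero]
      rw [chart_apply_zero]
      by_contra h'
      exact h (abs_le.1 (not_le.1 h').le)

theorem contDiff_chart_zero (hg : ContDiff ℝ (⊤ : ℕ∞) g) :
    ContDiff ℝ (⊤ : ℕ∞) fun r => graphChart p e g (r, 0) := by
  unfold graphChart
  have : ContDiff ℝ (⊤ : ℕ∞) fun r : ℝ => (!₂[r, g r - 0] : Plane) := by
    rw [contDiff_piLp]
    intro i
    fin_cases i
    · exact contDiff_id
    · simpa using hg
  exact contDiff_const.add (e.symm.contDiff.comp this)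

theorem norm_deriv_chart_zero (hg : ContDiff ℝ (⊤ : ℕ∞) g) (r : ℝ) :
    ‖deriv (fun r => graphChart p e g (r, 0)) r‖ = Real.sqrt (1 + deriv g r ^ 2) := by
  have hgd : HasDerivAt g (deriv g r) r := (hg.differentiable (by simp) _).hasDerivAt
  have h1 : HasDerivAt (fun r : ℝ => (!₂[r, g r - 0] : Plane)) !₂[1, deriv g r] r := by
    have h0 : HasDerivAt (fun r : ℝ => (![r, g r - 0] : Fin 2 → ℝ)) ![1, deriv g r] r := by
      rw [hasDerivAt_pi]
      intro i
      fin_cases i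
      · exact hasDerivAt_id r
      · simpa using hgd
    exact (PiLp.continuousLinearEquiv 2 ℝ fun _ : Fin 2 => ℝ).symm.hasFDerivAt.comp_hasDerivAt r h0
  have h2 : HasDerivAt (fun r => graphChart p e g (r, 0)) (e.symm !₂[1, deriv g r]) r :=
    ((e.symm : Plane →L[ℝ] Plane).hasFDerivAt.comp_hasDerivAt r h1).const_add p
  rw [h2.deriv, e.symm.norm_map, EuclideanSpace.norm_eq]
  simp

/-- Arc length of a graph. -/
theorem restrict_hausdorffMeasure_graph (hg : ContDiff ℝ (⊤ : ℕ∞) g) :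
    (Measure.hausdorffMeasure 1 : Measure Plane).restrict (range fun r => graphChart p e g (r, 0))
      = (volume.withDensity fun r => ENNReal.ofReal (Real.sqrt (1 + deriv g r ^ 2))).map
          (fun r => graphChart p e g (r, 0)) := by
  have hinj : Function.Injective fun r => graphChart p e g (r, 0) := fun r s h => by
    simpa using injective_chart h
  have hc := contDiff_chart_zero (p := p) (e := e) hg
  have hemb := hc.continuous.measurableEmbedding hinj
  rw [← hemb.map_comap, comap_hausdorffMeasure_curve (hc.of_le (by exact_mod_cast le_top)) hinj]
  congr 2
  ext r
  rw [← norm_deriv_chart_zero (p := p) (e := e) hg, ofReal_norm]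

end chart

/-- The box on which the Cartesian coordinates `e` centred at `p` are less than `a` and `b`. -/
def chartBox (p : Plane) (e : Plane ≃ₗᵢ[ℝ] Plane) (a b : ℝ) : Set Plane :=
  {x | |e (x - p) 0| < a ∧ |e (x - p) 1| < b}

/-- The upward unit normal of the graph of `g`, in the Cartesian coordinates `e`. -/
noncomputable def chartNormal (e : Plane ≃ₗᵢ[ℝ] Plane) (g : ℝ → ℝ) (r : ℝ) : Plane :=
  (Real.sqrt (1 + deriv g r ^ 2))⁻¹ • e.symm !₂[-deriv g r, 1]

section chart

variable {Ω : Set Plane} {p : Plane} {e : Plane ≃ₗᵢ[ℝ] Plane} {g : ℝ → ℝ} {a b : ℝ}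

theorem isOpen_chartBox : IsOpen (chartBox p e a b) := by
  have h : ∀ i, Continuous fun x : Plane => |e (x - p) i| := fun i =>
    ((PiLp.continuous_apply 2 _ i).comp (e.continuous.comp (continuous_id.sub continuous_const))).abs
  exact (isOpen_lt (h 0) continuous_const).inter (isOpen_lt (h 1) continuous_const)

theorem mem_iff_depth_pos
    (hloc : ∀ y : Plane, |e (y - p) 0| < a → |e (y - p) 1| < b →
      (y ∈ Ω ↔ e (y - p) 1 < g (e (y - p) 0))) {x : Plane} (hx : x ∈ chartBox p e a b) :
    x ∈ Ω ↔ 0 < depth p e g x := by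
  rw [hloc x hx.1 hx.2, depth, sub_pos]

theorem notMem_closure_of_depth_neg (hg : ContDiff ℝ (⊤ : ℕ∞) g)
    (hloc : ∀ y : Plane, |e (y - p) 0| < a → |e (y - p) 1| < b →
      (y ∈ Ω ↔ e (y - p) 1 < g (e (y - p) 0))) {x : Plane} (hx : x ∈ chartBox p e a b)
    (hd : depth p e g x < 0) : x ∉ closure Ω := by
  have ho : IsOpen (chartBox p e a b ∩ {x | depth p e g x < 0}) :=
    isOpen_chartBox.inter (isOpen_lt (contDiff_depth hg).continuous continuous_const)
  intro hc
  obtain ⟨y, ⟨hy1, hy2⟩, hy3⟩ := mem_closure_iff.1 hc _ ho ⟨hx, hd⟩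
  exact absurd ((mem_iff_depth_pos hloc hy1).1 hy3) (not_lt.2 (le_of_lt hy2))

theorem mem_frontier_iff_depth_eq_zero (hΩ : IsOpen Ω) (hg : ContDiff ℝ (⊤ : ℕ∞) g)
    (hloc : ∀ y : Plane, |e (y - p) 0| < a → |e (y - p) 1| < b →
      (y ∈ Ω ↔ e (y - p) 1 < g (e (y - p) 0))) {x : Plane} (hx : x ∈ chartBox p e a b) :
    x ∈ frontier Ω ↔ depth p e g x = 0 := by
  rw [frontier, hΩ.interior_eq, Set.mem_sdiff, mem_iff_depth_pos hloc hx, not_lt]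
  constructor
  · rintro ⟨h1, h2⟩
    exact h2.antisymm (not_lt.1 fun h => notMem_closure_of_depth_neg hg hloc hx h h1)
  · intro h
    refine ⟨?_, h.le⟩
    have hx' : graphChart p e g (e (x - p) 0, 0) = x := by
      have := chart_depth (p := p) (e := e) (g := g) x
      rwa [h] at this
    have hc : Tendsto (fun s : ℝ => graphChart p e g (e (x - p) 0, s)) (𝓝[>] 0) (𝓝 x) := by
      have h1 : Continuous fun s : ℝ => graphChart p e g (e (x - p) 0, s) :=
        (continuous_chart hg.continuous).comp (by fun_prop)
      have := h1.tendsto 0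
      rw [hx'] at this
      exact this.mono_left nhdsWithin_le_nhds
    refine mem_closure_of_tendsto hc ?_
    filter_upwards [hc.eventually (isOpen_chartBox.mem_nhds hx), self_mem_nhdsWithin] with s hs hs0
    rw [mem_iff_depth_pos hloc hs, depth_chart]
    exact hs0

/-- The length of the gradient of the depth is exactly the arc length density of the graph, so a
layer in depth converges to surface measure times the inward normal. -/
theorem fderiv_depth_eq_inner (hg : ContDiff ℝ (⊤ : ℕ∞) g) (x w : Plane) :
    fderiv ℝ (depth p e g) x w = -(Real.sqrt (1 + deriv g (e (x - p) 0) ^ 2) *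
      inner ℝ w (chartNormal e g (e (x - p) 0))) := by
  have h : ∀ z, inner ℝ w (e.symm z) = inner ℝ (e w) z := fun z => by
    rw [← e.inner_map_map w, e.apply_symm_apply]
  have hs : Real.sqrt (1 + deriv g (e (x - p) 0) ^ 2) ≠ 0 := (Real.sqrt_pos.2 (by positivity)).ne'
  rw [fderiv_depth hg, chartNormal, real_inner_smul_right, h, mul_inv_cancel_left₀ hs,
    PiLp.inner_apply, Fin.sum_univ_two]
  simp
  ring

/-- At a boundary point the depth vanishes, so along `x + h • w` its sign for small `h > 0` is that
of its derivative, which is opposite to that of the product of `w` with the normal. -/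
theorem isOutwardNormal_chartNormal (hΩ : IsOpen Ω) (hg : ContDiff ℝ (⊤ : ℕ∞) g)
    (hloc : ∀ y : Plane, |e (y - p) 0| < a → |e (y - p) 1| < b →
      (y ∈ Ω ↔ e (y - p) 1 < g (e (y - p) 0))) {x : Plane} (hx : x ∈ chartBox p e a b)
    (hxf : x ∈ frontier Ω) : IsOutwardNormal Ω x (chartNormal e g (e (x - p) 0)) := by
  have hs : 0 < Real.sqrt (1 + deriv g (e (x - p) 0) ^ 2) := Real.sqrt_pos.2 (by positivity)
  have hd0 := (mem_frontier_iff_depth_eq_zero hΩ hg hloc hx).1 hxf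
  have hder : ∀ w : Plane, HasDerivAt (fun h : ℝ => depth p e g (x + h • w))
      (fderiv ℝ (depth p e g) x w) 0 := by
    intro w
    have h1 : HasFDerivAt (depth p e g) (fderiv ℝ (depth p e g) x) (x + (0 : ℝ) • w) := by
      rw [zero_smul, add_zero]
      exact ((contDiff_depth hg).differentiable (by simp) x).hasFDerivAt
    have h2 : HasDerivAt (fun h : ℝ => x + h • w) w 0 := by
      simpa using ((hasDerivAt_id (0 : ℝ)).smul_const w).const_add x
    exact h1.comp_hasDerivAt 0 h2
  have hbox : ∀ w : Plane, ∀ᶠ h : ℝ in 𝓝[>] 0, x + h • w ∈ chartBox p e a b := by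
    intro w
    have : Tendsto (fun h : ℝ => x + h • w) (𝓝[>] 0) (𝓝 x) := by
      have : Continuous fun h : ℝ => x + h • w := by fun_prop
      have := this.tendsto 0
      rw [zero_smul, add_zero] at this
      exact this.mono_left nhdsWithin_le_nhds
    exact this.eventually (isOpen_chartBox.mem_nhds hx)
  have hslope : ∀ w : Plane, Tendsto (fun h : ℝ => h⁻¹ * depth p e g (x + h • w)) (𝓝[>] 0)
      (𝓝 (fderiv ℝ (depth p e g) x w)) := by
    intro w
    have := (hasDerivAt_iff_tendsto_slope.1 (hder w)).mono_left
      (nhdsWithin_mono 0 (fun h (hh : 0 < h) => hh.ne'))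
    refine this.congr fun h => ?_
    simp [slope, hd0]
  refine ⟨?_, fun w hw => ?_, fun w hw => ?_⟩
  · rw [chartNormal, norm_smul, e.symm.norm_map, EuclideanSpace.norm_eq, Fin.sum_univ_two, norm_inv,
      Real.norm_of_nonneg hs.le]
    have : ‖(!₂[-deriv g (e (x - p) 0), 1] : Plane) 0‖ ^ 2 +
        ‖(!₂[-deriv g (e (x - p) 0), 1] : Plane) 1‖ ^ 2 = 1 + deriv g (e (x - p) 0) ^ 2 := by
      simp
      ring
    rw [this, inv_mul_cancel₀ hs.ne']
  · have hpos : 0 < fderiv ℝ (depth p e g) x w := by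
      rw [fderiv_depth_eq_inner hg, ← mul_neg]
      exact mul_pos hs (neg_pos.2 hw)
    filter_upwards [hbox w, (hslope w).eventually (lt_mem_nhds hpos), self_mem_nhdsWithin]
      with h h1 h2 h3
    rw [mem_iff_depth_pos hloc h1]
    exact (mul_pos_iff_of_pos_left (inv_pos.2 h3)).1 h2
  · have hneg : fderiv ℝ (depth p e g) x w < 0 := by
      rw [fderiv_depth_eq_inner hg, neg_lt_zero]
      exact mul_pos hs hw
    filter_upwards [hbox w, (hslope w).eventually (gt_mem_nhds hneg), self_mem_nhdsWithin]
      with h h1 h2 h3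
    refine notMem_closure_of_depth_neg hg hloc h1 ?_
    exact (pos_iff_neg_of_mul_neg h2).1 (inv_pos.2 h3)

/-- For two distinct unit normals, the direction `n - n'` would both enter the domain and leave its
closure. -/
theorem IsOutwardNormal.unique {x n n' : Plane} (h : IsOutwardNormal Ω x n)
    (h' : IsOutwardNormal Ω x n') : n = n' := by
  by_contra hne
  have hlt : inner ℝ n n' < 1 := by
    refine lt_of_le_of_ne ?_ fun h1 => hne ?_
    · simpa [h.1, h'.1] using real_inner_le_norm n n'
    · exact (inner_eq_one_iff_of_norm_eq_one h.1 h'.1).1 h1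
  have h1 : inner ℝ (n - n') n' < 0 := by
    rw [inner_sub_left, real_inner_self_eq_norm_sq, h'.1]; linarith
  have h2 : 0 < inner ℝ (n - n') n := by
    rw [inner_sub_left, real_inner_self_eq_norm_sq, h.1, real_inner_comm]; linarith
  obtain ⟨s, hs1, hs2⟩ := ((h'.2.1 _ h1).and (h.2.2 _ h2)).exists
  exact hs2 (subset_closure hs1)

theorem outwardNormal_eq {x n : Plane} (h : IsOutwardNormal Ω x n) : outwardNormal Ω x = n :=
  (Classical.epsilon_spec (p := IsOutwardNormal Ω x) ⟨n, h⟩).unique h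

theorem outwardNormal_eq_chartNormal (hΩ : IsOpen Ω) (hg : ContDiff ℝ (⊤ : ℕ∞) g)
    (hloc : ∀ y : Plane, |e (y - p) 0| < a → |e (y - p) 1| < b →
      (y ∈ Ω ↔ e (y - p) 1 < g (e (y - p) 0))) {x : Plane} (hx : x ∈ chartBox p e a b)
    (hxf : x ∈ frontier Ω) : outwardNormal Ω x = chartNormal e g (e (x - p) 0) :=
  outwardNormal_eq (isOutwardNormal_chartNormal hΩ hg hloc hx hxf)

theorem continuous_chartNormal (hg : ContDiff ℝ (⊤ : ℕ∞) g) : Continuous (chartNormal e g) := by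
  have h1 : Continuous (deriv g) := hg.continuous_deriv (by exact_mod_cast le_top)
  unfold chartNormal
  refine Continuous.smul (Continuous.inv₀ (by fun_prop) fun r =>
    (Real.sqrt_pos.2 (by positivity)).ne') (e.symm.continuous.comp ?_)
  refine (PiLp.continuous_toLp 2 _).comp (continuous_pi fun i => ?_)
  fin_cases i
  · exact h1.neg
  · exact continuous_const

theorem mem_box_inter_frontier_iff (hΩ : IsOpen Ω) (hg : ContDiff ℝ (⊤ : ℕ∞) g)
    (hloc : ∀ y : Plane, |e (y - p) 0| < a → |e (y - p) 1| < b →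
      (y ∈ Ω ↔ e (y - p) 1 < g (e (y - p) 0))) {x : Plane} (hx : x ∈ chartBox p e a b) :
    x ∈ frontier Ω ↔ x ∈ range fun r => graphChart p e g (r, 0) := by
  rw [mem_frontier_iff_depth_eq_zero hΩ hg hloc hx]
  constructor
  · intro h
    have := chart_depth (p := p) (e := e) (g := g) x
    rw [h] at this
    exact ⟨_, this⟩
  · rintro ⟨r, rfl⟩
    exact depth_chart _

/-- Boundary integrals in a chart. -/
theorem integral_boundaryMeasure_chart (hΩ : IsOpen Ω) (hg : ContDiff ℝ (⊤ : ℕ∞) g)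
    (hloc : ∀ y : Plane, |e (y - p) 0| < a → |e (y - p) 1| < b →
      (y ∈ Ω ↔ e (y - p) 1 < g (e (y - p) 0))) {K : Plane → ℝ}
    (hK : ∀ x ∉ chartBox p e a b, K x = 0) :
    ∫ x, K x ∂(boundaryMeasure Ω)
      = ∫ r, Real.sqrt (1 + deriv g r ^ 2) * K (graphChart p e g (r, 0)) := by
  have hinj : Function.Injective fun r => graphChart p e g (r, 0) := fun r s h => by
    simpa using injective_chart h
  have hc := contDiff_chart_zero (p := p) (e := e) hg
  have hemb := hc.continuous.measurableEmbedding hinj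
  have h1 : Continuous (deriv g) := hg.continuous_deriv (by exact_mod_cast le_top)
  rw [boundaryMeasure, ← integral_indicator isClosed_frontier.measurableSet]
  have : (frontier Ω).indicator K = (range fun r => graphChart p e g (r, 0)).indicator K := by
    ext x
    by_cases hx : x ∈ chartBox p e a b
    · by_cases hxf : x ∈ frontier Ω
      · rw [indicator_of_mem hxf,
          indicator_of_mem ((mem_box_inter_frontier_iff hΩ hg hloc hx).1 hxf)]
      · rw [indicator_of_notMem hxf,
          indicator_of_notMem fun h => hxf ((mem_box_inter_frontier_iff hΩ hg hloc hx).2 h)]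
    · simp [indicator, hK x hx]
  rw [this, integral_indicator hemb.measurableSet_range, restrict_hausdorffMeasure_graph hg,
    hemb.integral_map, integral_withDensity_eq_integral_toReal_smul (by fun_prop)
    (Eventually.of_forall fun _ => ENNReal.ofReal_lt_top)]
  congr 1
  ext r
  rw [ENNReal.toReal_ofReal (Real.sqrt_nonneg _), smul_eq_mul]

theorem finiteAtFilter_boundary (hΩ : IsOpen Ω) (hg : ContDiff ℝ (⊤ : ℕ∞) g)
    (hloc : ∀ y : Plane, |e (y - p) 0| < a → |e (y - p) 1| < b →
      (y ∈ Ω ↔ e (y - p) 1 < g (e (y - p) 0))) (ha : 0 < a) (hb : 0 < b) :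
    (Measure.hausdorffMeasure 1 : Measure Plane).FiniteAtFilter (𝓝[frontier Ω] p) := by
  have hinj : Function.Injective fun r => graphChart p e g (r, 0) := fun r s h => by
    simpa using injective_chart h
  have hc := contDiff_chart_zero (p := p) (e := e) hg
  have hemb := hc.continuous.measurableEmbedding hinj
  have h1 : Continuous (deriv g) := hg.continuous_deriv (by exact_mod_cast le_top)
  have hpb : p ∈ chartBox p e a b := by simp [chartBox, ha, hb]
  refine ⟨chartBox p e a b ∩ frontier Ω, inter_mem (mem_nhdsWithin_of_mem_nhds
    (isOpen_chartBox.mem_nhds hpb)) self_mem_nhdsWithin, ?_⟩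
  have hsub : chartBox p e a b ∩ frontier Ω ⊆ chartBox p e a b ∩ range fun r => graphChart p e g (r, 0) :=
    fun x hx => ⟨hx.1, (mem_box_inter_frontier_iff hΩ hg hloc hx.1).1 hx.2⟩
  refine (measure_mono hsub).trans_lt ?_
  rw [← Measure.restrict_apply isOpen_chartBox.measurableSet, restrict_hausdorffMeasure_graph hg,
    hemb.map_apply]
  refine (measure_mono (t := Icc (-a) a) fun r hr => ?_).trans_lt ?_
  · have := hr.1
    rw [chart_apply_zero] at this
    exact abs_le.1 this.le
  · rw [withDensity_apply _ measurableSet_Icc]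
    have : IntegrableOn (fun r => Real.sqrt (1 + deriv g r ^ 2)) (Icc (-a) a) :=
      (Continuous.continuousOn (by fun_prop)).integrableOn_Icc
    exact this.lintegral_lt_top

end chart

/-! ### Global properties of a smooth bounded domain -/

theorem IsSmoothBoundedDomain.isCompact_closure {Ω : Set Plane} (h : IsSmoothBoundedDomain Ω) :
    IsCompact (closure Ω) := h.isBounded.isCompact_closure

theorem IsSmoothBoundedDomain.isCompact_frontier {Ω : Set Plane} (h : IsSmoothBoundedDomain Ω) :
    IsCompact (frontier Ω) :=
  h.isCompact_closure.of_isClosed_subset isClosed_frontier frontier_subset_closure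

theorem IsSmoothBoundedDomain.isFiniteMeasure_boundaryMeasure {Ω : Set Plane}
    (h : IsSmoothBoundedDomain Ω) : IsFiniteMeasure (boundaryMeasure Ω) := by
  refine ⟨?_⟩
  rw [boundaryMeasure, Measure.restrict_apply_univ]
  refine h.isCompact_frontier.measure_lt_top_of_nhdsWithin fun p hp => ?_
  obtain ⟨e, g, a, b, hg, ha, hb, hloc⟩ := h.smooth p hp
  exact finiteAtFilter_boundary h.isOpen hg hloc ha hb

theorem IsSmoothBoundedDomain.isOutwardNormal {Ω : Set Plane} (h : IsSmoothBoundedDomain Ω)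
    {x : Plane} (hx : x ∈ frontier Ω) : IsOutwardNormal Ω x (outwardNormal Ω x) := by
  obtain ⟨e, g, a, b, hg, ha, hb, hloc⟩ := h.smooth x hx
  have hpb : x ∈ chartBox x e a b := by simp [chartBox, ha, hb]
  have := isOutwardNormal_chartNormal h.isOpen hg hloc hpb hx
  rwa [outwardNormal_eq this]

theorem IsSmoothBoundedDomain.continuousOn_outwardNormal {Ω : Set Plane}
    (h : IsSmoothBoundedDomain Ω) : ContinuousOn (outwardNormal Ω) (frontier Ω) := by
  intro x hx
  obtain ⟨e, g, a, b, hg, ha, hb, hloc⟩ := h.smooth x hx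
  have hpb : x ∈ chartBox x e a b := by simp [chartBox, ha, hb]
  have hc : ContinuousWithinAt (fun y => chartNormal e g (e (y - x) 0)) (frontier Ω) x :=
    ((continuous_chartNormal hg).comp ((PiLp.continuous_apply 2 _ 0).comp
      (e.continuous.comp (continuous_id.sub continuous_const)))).continuousWithinAt
  refine hc.congr_of_eventuallyEq ?_ (outwardNormal_eq_chartNormal h.isOpen hg hloc hpb hx)
  filter_upwards [mem_nhdsWithin_of_mem_nhds (isOpen_chartBox.mem_nhds hpb), self_mem_nhdsWithin]
    with y hy hyf
  exact outwardNormal_eq_chartNormal h.isOpen hg hloc hy hyf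

/-- At a frontier point, arbitrarily small steps along the outward normal leave the closure. This
places the open polygons, given only inside the closure, inside the domain itself. -/
theorem IsSmoothBoundedDomain.interior_closure_subset {Ω : Set Plane}
    (h : IsSmoothBoundedDomain Ω) : interior (closure Ω) ⊆ Ω := by
  intro x hx
  by_contra hxΩ
  have hxf : x ∈ frontier Ω := ⟨interior_subset hx, by rwa [h.isOpen.interior_eq]⟩
  have hn := h.isOutwardNormal hxf
  have h1 := hn.2.2 (outwardNormal Ω x) (by rw [real_inner_self_eq_norm_sq, hn.1]; norm_num)
  have h2 : Tendsto (fun s : ℝ => x + s • outwardNormal Ω x) (𝓝[>] 0) (𝓝 x) := by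
    have : Continuous fun s : ℝ => x + s • outwardNormal Ω x := by fun_prop
    have := this.tendsto 0
    rw [zero_smul, add_zero] at this
    exact this.mono_left nhdsWithin_le_nhds
  obtain ⟨s, hs1, hs2⟩ := (h1.and (h2.eventually (isOpen_interior.mem_nhds hx))).exists
  exact hs1 (interior_subset hs2)

/-! ### Cutoff functions -/

/-- A continuous density on `[1, 2]`: the derivative of a shifted smooth step. -/
noncomputable def stepDeriv (σ : ℝ) : ℝ := deriv Real.smoothTransition (σ - 1)

theorem continuous_stepDeriv : Continuous stepDeriv := by
  have : Continuous (deriv Real.smoothTransition) :=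
    (Real.smoothTransition.contDiff (n := 1)).continuous_deriv le_rfl
  exact this.comp (continuous_id.sub continuous_const)

theorem hasDerivAt_step (σ : ℝ) :
    HasDerivAt (fun s => Real.smoothTransition (s - 1)) (stepDeriv σ) σ := by
  have h : HasDerivAt Real.smoothTransition (stepDeriv σ) (σ - 1) :=
    ((Real.smoothTransition.contDiff (n := 1)).differentiable one_ne_zero _).hasDerivAt
  exact h.comp_sub_const σ 1

theorem stepDeriv_eq_zero {σ : ℝ} (hσ : σ ∉ Icc (1 : ℝ) 2) : stepDeriv σ = 0 := by
  rcases lt_or_ge σ 1 with h | h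
  · have : Real.smoothTransition =ᶠ[𝓝 (σ - 1)] fun _ => 0 := by
      filter_upwards [gt_mem_nhds (show σ - 1 < 0 by linarith)] with x hx
      exact Real.smoothTransition.zero_of_nonpos (le_of_lt hx)
    rw [stepDeriv, this.deriv_eq, deriv_const]
  · have h2 : 2 < σ := not_le.1 fun h2 => hσ ⟨h, h2⟩
    have : Real.smoothTransition =ᶠ[𝓝 (σ - 1)] fun _ => 1 := by
      filter_upwards [lt_mem_nhds (show 1 < σ - 1 by linarith)] with x hx
      exact Real.smoothTransition.one_of_one_le (le_of_lt hx)
    rw [stepDeriv, this.deriv_eq, deriv_const]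

theorem integrable_stepDeriv : Integrable stepDeriv :=
  continuous_stepDeriv.integrable_of_hasCompactSupport
    (HasCompactSupport.intro isCompact_Icc fun _ h => stepDeriv_eq_zero h)

theorem integral_stepDeriv : ∫ σ, stepDeriv σ = 1 := by
  have h0 : Tendsto (fun s => Real.smoothTransition (s - 1)) atBot (𝓝 0) := by
    refine tendsto_const_nhds.congr' ?_
    filter_upwards [eventually_le_atBot 1] with s hs
    exact (Real.smoothTransition.zero_of_nonpos (by linarith)).symm
  have h1 : Tendsto (fun s => Real.smoothTransition (s - 1)) atTop (𝓝 1) := by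
    refine tendsto_const_nhds.congr' ?_
    filter_upwards [eventually_ge_atTop 2] with s hs
    exact (Real.smoothTransition.one_of_one_le (by linarith)).symm
  rw [integral_of_hasDerivAt_of_tendsto hasDerivAt_step integrable_stepDeriv h0 h1, sub_zero]

/-- Cutoff functions near a point of the closure of a smooth domain. -/
theorem IsSmoothBoundedDomain.exists_local_cutoff {Ω : Set Plane} (hΩ : IsSmoothBoundedDomain Ω)
    {p : Plane} (hp : p ∈ closure Ω) :
    ∃ W : Set Plane, IsOpen W ∧ p ∈ W ∧ ∃ χ : ℝ → Plane → ℝ,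
      (∀ ε > 0, ContDiff ℝ (⊤ : ℕ∞) (χ ε)) ∧
      (∀ ε x, 0 ≤ χ ε x ∧ χ ε x ≤ 1) ∧
      (∀ ε > 0, W ∩ tsupport (χ ε) ⊆ Ω) ∧
      (∀ x ∈ W ∩ Ω, ∀ᶠ ε in 𝓝[>] (0 : ℝ), χ ε x = 1) ∧
      ∀ θ : Plane → ℝ, Continuous θ → HasCompactSupport θ → tsupport θ ⊆ W → ∀ w : Plane,
        (∃ C, ∀ ε > 0, ∫ x in Ω, |θ x * fderiv ℝ (χ ε) x w| ≤ C) ∧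
        ∀ f : Plane → ℝ, Continuous f →
          Tendsto (fun ε => ∫ x in Ω, f x * (θ x * fderiv ℝ (χ ε) x w)) (𝓝[>] 0)
            (𝓝 (-∫ x, f x * (θ x * inner ℝ w (outwardNormal Ω x)) ∂(boundaryMeasure Ω))) := by
  -- At an interior point the constant cutoff works: `θ` is then supported in the open set `Ω`, so
  -- the boundary term vanishes as well.
  by_cases hpΩ : p ∈ Ω
  · refine ⟨Ω, hΩ.isOpen, hpΩ, fun _ _ => 1, fun _ _ => contDiff_const, fun _ _ => by norm_num,
      fun _ _ => inter_subset_left, fun _ _ => Eventually.of_forall fun _ => rfl,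
      fun θ _ _ hθ w => ⟨⟨0, fun ε _ => by simp⟩, fun f _ => ?_⟩⟩
    have : ∫ x, f x * (θ x * inner ℝ w (outwardNormal Ω x)) ∂(boundaryMeasure Ω) = 0 := by
      rw [boundaryMeasure]
      refine setIntegral_eq_zero_of_forall_eq_zero fun x hx => ?_
      rw [hΩ.isOpen.frontier_eq] at hx
      rw [show θ x = 0 from image_eq_zero_of_notMem_tsupport fun h => hx.2 (hθ h), zero_mul,
        mul_zero]
    simp [this]
  have hpf : p ∈ frontier Ω := ⟨hp, by rwa [hΩ.isOpen.interior_eq]⟩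
  obtain ⟨e, g, a, b, hg, ha, hb, hloc⟩ := hΩ.smooth p hpf
  have hd := contDiff_depth (p := p) (e := e) hg
  have hpW : p ∈ chartBox p e a b := by simp [chartBox, ha, hb]
  have hder : ∀ ε x w, fderiv ℝ (fun x => Real.smoothTransition (depth p e g x / ε - 1)) x w
      = fderiv ℝ (depth p e g) x w * (stepDeriv (depth p e g x / ε) / ε) := by
    intro ε x w
    have h1 : HasFDerivAt (fun x => depth p e g x / ε) (ε⁻¹ • fderiv ℝ (depth p e g) x) x := by
      have := ((hd.differentiable (by simp) x).hasFDerivAt).const_smul ε⁻¹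
      refine this.congr_of_eventuallyEq (Eventually.of_forall fun y => ?_)
      simp [div_eq_inv_mul]
    have h2 := (hasDerivAt_step (depth p e g x / ε)).comp_hasFDerivAt x h1
    have h3 : (fun x => Real.smoothTransition (depth p e g x / ε - 1)) =
      (fun s => Real.smoothTransition (s - 1)) ∘ fun x => depth p e g x / ε := rfl
    rw [h3, h2.fderiv]
    simp
    ring
  have hsupp : ∀ ε > 0, tsupport (fun x => Real.smoothTransition (depth p e g x / ε - 1)) ⊆
      {x | ε ≤ depth p e g x} := by
    intro ε hε
    refine closure_minimal (fun x hx => ?_) (isClosed_le continuous_const hd.continuous)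
    by_contra hlt
    have hlt : depth p e g x < ε := not_le.1 hlt
    refine hx (Real.smoothTransition.zero_of_nonpos ?_)
    rw [sub_nonpos, div_le_one hε]
    exact hlt.le
  -- The cutoff rises from 0 at depth `ε` to 1 at depth `2ε`. Only inside the chart box does depth
  -- describe `Ω`, hence the localization by `θ`.
  refine ⟨chartBox p e a b, isOpen_chartBox, hpW,
    fun ε x => Real.smoothTransition (depth p e g x / ε - 1), fun ε _ => ?_, fun ε x =>
    ⟨Real.smoothTransition.nonneg _, Real.smoothTransition.le_one _⟩, fun ε hε x hx => ?_,
    fun x hx => ?_, fun θ hθ hθc hθW w => ?_⟩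
  · exact Real.smoothTransition.contDiff.comp ((hd.div_const ε).sub contDiff_const)
  · exact (mem_iff_depth_pos hloc hx.1).2 (lt_of_lt_of_le hε (hsupp ε hε hx.2))
  · have hpos := (mem_iff_depth_pos hloc hx.1).1 hx.2
    filter_upwards [Ioo_mem_nhdsGT (half_pos hpos)] with ε hε
    refine Real.smoothTransition.one_of_one_le ?_
    have : 2 ≤ depth p e g x / ε := (le_div_iff₀ hε.1).2 (by linarith [hε.2])
    linarith
  have hθ0 : ∀ x ∉ chartBox p e a b, θ x = 0 := fun x hx =>
    image_eq_zero_of_notMem_tsupport fun h => hx (hθW h)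
  have hdw : Continuous fun x => fderiv ℝ (depth p e g) x w :=
    (hd.continuous_fderiv (by simp)).clm_apply continuous_const
  have hKc : ∀ f : Plane → ℝ, Continuous f →
      Continuous fun x => f x * (θ x * fderiv ℝ (depth p e g) x w) := fun f hf =>
    hf.mul (hθ.mul hdw)
  have hK0 : ∀ (f : Plane → ℝ) (x : Plane), a ≤ |e (x - p) 0| →
      f x * (θ x * fderiv ℝ (depth p e g) x w) = 0 := by
    intro f x hx
    rw [hθ0 x fun h => absurd h.1 (not_lt.2 hx), zero_mul, mul_zero]
  have hKb : ∀ f : Plane → ℝ, Continuous f → ∃ B, ∀ x,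
      |f x * (θ x * fderiv ℝ (depth p e g) x w)| ≤ B := fun f hf =>
    (hKc f hf).bounded_above_of_compact_support ((hθc.mul_right).mul_left)
  -- The transition layer lies at positive depth, so integrals over `Ω` may be extended to the whole
  -- plane.
  have hext : ∀ ε > 0, ∀ x ∉ Ω,
      θ x * (fderiv ℝ (depth p e g) x w * (stepDeriv (depth p e g x / ε) / ε)) = 0 := by
    intro ε hε x hx
    by_cases hxW : x ∈ chartBox p e a b
    · have h1 : depth p e g x ≤ 0 := not_lt.1 fun h => hx ((mem_iff_depth_pos hloc hxW).2 h)
      have h2 : depth p e g x / ε ≤ 0 := div_nonpos_of_nonpos_of_nonneg h1 hε.le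
      rw [stepDeriv_eq_zero fun h => by linarith [h.1], zero_div, mul_zero, mul_zero]
    · rw [hθ0 x hxW, zero_mul]
  simp only [hder]
  refine ⟨?_, fun f hf => ?_⟩
  · obtain ⟨B, hB⟩ := hKb (fun _ => 1) continuous_const
    refine ⟨_, fun ε hε => le_trans (le_of_eq ?_) (integral_layer_le hg.continuous
      (hKc (fun _ => 1) continuous_const) (hK0 _) hB continuous_stepDeriv
      (fun _ h => stepDeriv_eq_zero h) hε)⟩
    rw [setIntegral_eq_integral_of_forall_compl_eq_zero fun x hx => by
      rw [hext ε hε x hx, abs_zero]]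
    congr 1
    ext x
    ring_nf
  · obtain ⟨B, hB⟩ := hKb f hf
    have hlim := tendsto_integral_layer hg.continuous (hKc f hf) (hK0 f) hB continuous_stepDeriv
      (fun _ h => stepDeriv_eq_zero h) integral_stepDeriv
    rw [integral_boundaryMeasure_chart hΩ.isOpen hg hloc (fun x hx => by
      rw [hθ0 x hx, zero_mul, mul_zero]), ← integral_neg]
    -- The arc length density cancels against the length of the gradient of the depth.
    have hval : ∀ r, -(Real.sqrt (1 + deriv g r ^ 2) * (f (graphChart p e g (r, 0)) *
        (θ (graphChart p e g (r, 0)) *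
          inner ℝ w (outwardNormal Ω (graphChart p e g (r, 0))))))
        = f (graphChart p e g (r, 0)) * (θ (graphChart p e g (r, 0)) *
          fderiv ℝ (depth p e g) (graphChart p e g (r, 0)) w) := by
      intro r
      by_cases hxW : graphChart p e g (r, 0) ∈ chartBox p e a b
      · have hxf : graphChart p e g (r, 0) ∈ frontier Ω :=
          (mem_frontier_iff_depth_eq_zero hΩ.isOpen hg hloc hxW).2 (depth_chart _)
        rw [outwardNormal_eq_chartNormal hΩ.isOpen hg hloc hxW hxf, fderiv_depth_eq_inner hg,
          chart_apply_zero]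
        ring
      · rw [hθ0 _ hxW]; ring
    simp only [hval]
    refine hlim.congr' ?_
    filter_upwards [self_mem_nhdsWithin] with ε hε
    rw [setIntegral_eq_integral_of_forall_compl_eq_zero fun x hx => by
      rw [hext ε hε x hx, mul_zero]]
    congr 1
    ext x
    ring

theorem IsSmoothBoundedDomain.integrable_boundaryMeasure {Ω : Set Plane}
    (hΩ : IsSmoothBoundedDomain Ω) {k : Plane → ℝ} (hk : ContinuousOn k (frontier Ω)) :
    Integrable k (boundaryMeasure Ω) := by
  have := hΩ.isFiniteMeasure_boundaryMeasure
  obtain ⟨C, hC⟩ := hΩ.isCompact_frontier.exists_bound_of_continuousOn hk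
  refine Integrable.of_bound (hk.aestronglyMeasurable isClosed_frontier.measurableSet) C ?_
  filter_upwards [ae_restrict_mem isClosed_frontier.measurableSet] with x hx using hC x hx

/-- **Cutoff functions** of a smooth bounded domain. Their gradients converge to the surface measure
of the boundary times the inward normal. -/
theorem IsSmoothBoundedDomain.exists_cutoff {Ω : Set Plane} (hΩ : IsSmoothBoundedDomain Ω) :
    ∃ η : ℝ → Plane → ℝ,
      (∀ ε > 0, ContDiff ℝ (⊤ : ℕ∞) (η ε)) ∧
      (∀ ε > 0, tsupport (η ε) ⊆ Ω) ∧
      (∀ ε, ∀ x ∈ closure Ω, 0 ≤ η ε x ∧ η ε x ≤ 1) ∧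
      (∀ x ∈ Ω, Tendsto (fun ε => η ε x) (𝓝[>] 0) (𝓝 1)) ∧
      ∀ w : Plane,
        (∃ C, ∀ ε > 0, ∫ x in Ω, |fderiv ℝ (η ε) x w| ≤ C) ∧
        ∀ f : Plane → ℝ, ContinuousOn f (closure Ω) →
          Tendsto (fun ε => ∫ x in Ω, f x * fderiv ℝ (η ε) x w) (𝓝[>] 0)
            (𝓝 (-∫ x, f x * inner ℝ w (outwardNormal Ω x) ∂(boundaryMeasure Ω))) := by
  choose! W hWo hpW χ hχs hχ01 hχΩ hχ1 hχ using fun p (hp : p ∈ closure Ω) =>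
    hΩ.exists_local_cutoff hp
  -- Intersecting with unit balls gives the partition functions compact support.
  obtain ⟨t, htΩ⟩ := hΩ.isCompact_closure.elim_nhds_subcover' (fun p _ => W p ∩ Metric.ball p 1)
    (fun p hp => ((hWo p hp).inter Metric.isOpen_ball).mem_nhds
      ⟨hpW p hp, Metric.mem_ball_self one_pos⟩)
  have hcov : closure Ω ⊆ ⋃ i : t, W i.1.1 ∩ Metric.ball i.1.1 1 := fun x hx => by
    obtain ⟨i, hi, hxi⟩ := mem_iUnion₂.1 (htΩ hx)
    exact mem_iUnion.2 ⟨⟨i, hi⟩, hxi⟩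
  obtain ⟨F, hF⟩ := SmoothPartitionOfUnity.exists_isSubordinate
    (modelWithCornersSelf ℝ Plane) isClosed_closure
    (fun i : t => W i.1.1 ∩ Metric.ball i.1.1 1)
    (fun i => (hWo _ i.1.2).inter Metric.isOpen_ball) hcov
  set θ : t → Plane → ℝ := fun i => F i with hθdef
  have hθs : ∀ i, ContDiff ℝ (⊤ : ℕ∞) (θ i) := fun i => (F i).contMDiff.contDiff
  have hθc : ∀ i, HasCompactSupport (θ i) := fun i =>
    (isCompact_closedBall i.1.1 1).of_isClosed_subset (isClosed_tsupport _)
      ((hF i).trans (inter_subset_right.trans Metric.ball_subset_closedBall))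
  have hθW : ∀ i, tsupport (θ i) ⊆ W i.1.1 := fun i => (hF i).trans inter_subset_left
  have hθ0 : ∀ i x, 0 ≤ θ i x := fun i x => F.nonneg i x
  have hθ1 : ∀ x ∈ closure Ω, ∑ i, θ i x = 1 := fun x hx => by
    rw [← F.sum_eq_one hx, finsum_eq_sum_of_fintype]
  have hθd : ∀ i w, Continuous fun x => fderiv ℝ (θ i) x w := fun i w =>
    ((hθs i).continuous_fderiv (by simp)).clm_apply continuous_const
  have hθdc : ∀ i w, HasCompactSupport fun x => fderiv ℝ (θ i) x w := fun i w =>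
    (hθc i).fderiv_apply ℝ w
  have hχd : ∀ i : t, ∀ ε > 0, ∀ w, Continuous fun x => fderiv ℝ (χ i.1.1 ε) x w :=
    fun i ε hε w => ((hχs _ i.1.2 ε hε).continuous_fderiv (by simp)).clm_apply continuous_const
  -- The partition sums to one throughout the open set `Ω`, so the gradients of its members cancel
  -- there.
  have hsum0 : ∀ x ∈ Ω, ∀ w, ∑ i, fderiv ℝ (θ i) x w = 0 := by
    intro x hx w
    have h1 : (fun y => ∑ i, θ i y) =ᶠ[𝓝 x] fun _ => 1 := by
      filter_upwards [hΩ.isOpen.mem_nhds hx] with y hy using hθ1 y (subset_closure hy)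
    have h2 := h1.fderiv_eq (𝕜 := ℝ)
    rw [fderiv_fun_sum fun i _ => (hθs i).differentiable (by simp) x, fderiv_fun_const] at h2
    have h3 := congrArg (fun l : Plane →L[ℝ] ℝ => l w) h2
    simpa using h3
  refine ⟨fun ε x => ∑ i, θ i x * χ i.1.1 ε x, fun ε hε => ?_, fun ε hε => ?_, fun ε x hx => ?_,
    fun x hx => ?_, fun w => ?_⟩
  · exact ContDiff.sum fun i _ => (hθs i).mul (hχs _ i.1.2 ε hε)
  · have hcl : IsClosed (⋃ i : t, tsupport (θ i) ∩ tsupport (χ i.1.1 ε)) :=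
      isClosed_iUnion_of_finite fun i => (isClosed_tsupport _).inter (isClosed_tsupport _)
    refine (closure_minimal (fun x hx => ?_) hcl).trans (iUnion_subset fun i => ?_)
    · obtain ⟨i, -, hi⟩ := Finset.exists_ne_zero_of_sum_ne_zero hx
      exact mem_iUnion.2 ⟨i, subset_tsupport _ (left_ne_zero_of_mul hi),
        subset_tsupport _ (right_ne_zero_of_mul hi)⟩
    · exact (inter_subset_inter_left _ (hθW i)).trans (hχΩ _ i.1.2 ε hε)
  · refine ⟨Finset.sum_nonneg fun i _ => mul_nonneg (hθ0 i x) (hχ01 _ i.1.2 ε x).1, ?_⟩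
    rw [← hθ1 x hx]
    exact Finset.sum_le_sum fun i _ => mul_le_of_le_one_right (hθ0 i x) (hχ01 _ i.1.2 ε x).2
  · refine tendsto_const_nhds.congr' ?_
    have : ∀ᶠ ε in 𝓝[>] (0 : ℝ), ∀ i : t, θ i x * χ i.1.1 ε x = θ i x := by
      rw [eventually_all]
      intro i
      by_cases hxi : x ∈ W i.1.1
      · filter_upwards [hχ1 _ i.1.2 x ⟨hxi, hx⟩] with ε hε
        rw [hε, mul_one]
      · refine Eventually.of_forall fun ε => ?_
        rw [show θ i x = 0 from image_eq_zero_of_notMem_tsupport fun h => hxi (hθW i h), zero_mul]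
    filter_upwards [this] with ε hε
    rw [Finset.sum_congr rfl fun i _ => hε i, hθ1 x (subset_closure hx)]
  have hder : ∀ ε > 0, ∀ x, fderiv ℝ (fun x => ∑ i, θ i x * χ i.1.1 ε x) x w
      = ∑ i, (fderiv ℝ (θ i) x w * χ i.1.1 ε x + θ i x * fderiv ℝ (χ i.1.1 ε) x w) := by
    intro ε hε x
    have h1 : ∀ i : t, HasFDerivAt (fun x => θ i x * χ i.1.1 ε x)
        (θ i x • fderiv ℝ (χ i.1.1 ε) x + χ i.1.1 ε x • fderiv ℝ (θ i) x) x := fun i =>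
      ((hθs i).differentiable (by simp) x).hasFDerivAt.mul
        ((hχs _ i.1.2 ε hε).differentiable (by simp) x).hasFDerivAt
    rw [(HasFDerivAt.fun_sum fun i _ => h1 i).fderiv]
    simp only [sum_apply, add_apply, smul_apply, smul_eq_mul]
    refine Finset.sum_congr rfl fun i _ => ?_
    ring
  have hint1 : ∀ f : Plane → ℝ, Continuous f → ∀ i, ∀ ε > 0,
      IntegrableOn (fun x => f x * (fderiv ℝ (θ i) x w * χ i.1.1 ε x)) Ω := fun f hf i ε hε =>
    (Continuous.integrable_of_hasCompactSupport
      (hf.mul ((hθd i w).mul (hχs _ i.1.2 ε hε).continuous))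
      (((hθdc i w).mul_right).mul_left)).integrableOn
  have hint2 : ∀ f : Plane → ℝ, Continuous f → ∀ i, ∀ ε > 0,
      IntegrableOn (fun x => f x * (θ i x * fderiv ℝ (χ i.1.1 ε) x w)) Ω := fun f hf i ε hε =>
    (Continuous.integrable_of_hasCompactSupport
      (hf.mul ((hθs i).continuous.mul (hχd i ε hε w)))
      (((hθc i).mul_right).mul_left)).integrableOn
  have hint0 : ∀ f : Plane → ℝ, Continuous f → ∀ i,
      IntegrableOn (fun x => f x * fderiv ℝ (θ i) x w) Ω := fun f hf i =>
    (Continuous.integrable_of_hasCompactSupport (hf.mul (hθd i w))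
      ((hθdc i w).mul_left)).integrableOn
  refine ⟨?_, fun f hf => ?_⟩
  · choose C hC using fun i : t =>
      (hχ _ i.1.2 (θ i) (hθs i).continuous (hθc i) (hθW i) w).1
    refine ⟨∑ i, ((∫ x in Ω, |fderiv ℝ (θ i) x w|) + C i), fun ε hε => ?_⟩
    have hi1 : ∀ i, IntegrableOn (fun x => |fderiv ℝ (θ i) x w|) Ω := fun i => by
      have h := (hint0 (fun _ => 1) continuous_const i).abs
      simp only [one_mul] at h
      exact h
    have hi2 : ∀ i : t, IntegrableOn (fun x => |θ i x * fderiv ℝ (χ i.1.1 ε) x w|) Ω := fun i => by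
      have h := (hint2 (fun _ => 1) continuous_const i ε hε).abs
      simp only [one_mul] at h
      exact h
    have hi3 : ∀ i : t, IntegrableOn
        (fun x => |fderiv ℝ (θ i) x w| + |θ i x * fderiv ℝ (χ i.1.1 ε) x w|) Ω := fun i =>
      (hi1 i).add (hi2 i)
    calc ∫ x in Ω, |fderiv ℝ (fun x => ∑ i, θ i x * χ i.1.1 ε x) x w|
        ≤ ∫ x in Ω, ∑ i, (|fderiv ℝ (θ i) x w| + |θ i x * fderiv ℝ (χ i.1.1 ε) x w|) := by
          refine integral_mono_of_nonneg (Eventually.of_forall fun x => abs_nonneg _)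
            (integrable_finsetSum _ fun i _ => hi3 i)
            (Eventually.of_forall fun x => ?_)
          simp only
          rw [hder ε hε]
          refine (Finset.abs_sum_le_sum_abs _ _).trans (Finset.sum_le_sum fun i _ => ?_)
          refine (abs_add_le _ _).trans (add_le_add_left ?_ _)
          rw [abs_mul, abs_of_nonneg (hχ01 _ i.1.2 ε x).1]
          exact mul_le_of_le_one_right (abs_nonneg _) (hχ01 _ i.1.2 ε x).2
      _ = ∑ i, ((∫ x in Ω, |fderiv ℝ (θ i) x w|)
            + ∫ x in Ω, |θ i x * fderiv ℝ (χ i.1.1 ε) x w|) := by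
          rw [integral_finsetSum _ fun i _ => hi3 i]
          exact Finset.sum_congr rfl fun i _ => integral_add (hi1 i) (hi2 i)
      _ ≤ _ := Finset.sum_le_sum fun i _ => add_le_add_right (hC i ε hε) _
  -- the limit
  obtain ⟨f', hf'⟩ := ContinuousMap.exists_restrict_eq isClosed_closure
    (⟨(closure Ω).domRestrict f, hf.domRestrict⟩ : C(closure Ω, ℝ))
  -- The Tietze extension `f'` is used because the local convergence concerns functions continuous
  -- on the whole plane.
  have hff' : ∀ x ∈ closure Ω, f x = f' x := fun x hx =>
    (congrArg (fun h : C(closure Ω, ℝ) => h ⟨x, hx⟩) hf').symm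
  have hf'c : Continuous f' := f'.continuous
  have hL1 : ∀ i : t, Tendsto
      (fun ε => ∫ x in Ω, f' x * (fderiv ℝ (θ i) x w * χ i.1.1 ε x)) (𝓝[>] 0)
      (𝓝 (∫ x in Ω, f' x * fderiv ℝ (θ i) x w)) := by
    intro i
    refine tendsto_integral_filter_of_dominated_convergence
      (fun x => |f' x * fderiv ℝ (θ i) x w|) ?_ ?_ (hint0 f' hf'c i).abs ?_
    · filter_upwards [self_mem_nhdsWithin] with ε hε
      exact (hint1 f' hf'c i ε hε).aestronglyMeasurable
    · refine Eventually.of_forall fun ε => Eventually.of_forall fun x => ?_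
      rw [← mul_assoc, Real.norm_eq_abs, abs_mul, abs_of_nonneg (hχ01 _ i.1.2 ε x).1]
      exact mul_le_of_le_one_right (abs_nonneg _) (hχ01 _ i.1.2 ε x).2
    · filter_upwards [ae_restrict_mem hΩ.isOpen.measurableSet] with x hx
      refine tendsto_const_nhds.congr' ?_
      by_cases hxi : x ∈ W i.1.1
      · filter_upwards [hχ1 _ i.1.2 x ⟨hxi, hx⟩] with ε hε
        rw [hε, mul_one]
      · refine Eventually.of_forall fun ε => ?_
        have : fderiv ℝ (θ i) x = 0 := image_eq_zero_of_notMem_tsupport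
          fun h => hxi (hθW i (tsupport_fderiv_subset ℝ h))
        simp [this]
  have hL2 : ∀ i : t, Tendsto
      (fun ε => ∫ x in Ω, f' x * (θ i x * fderiv ℝ (χ i.1.1 ε) x w)) (𝓝[>] 0)
      (𝓝 (-∫ x, f' x * (θ i x * inner ℝ w (outwardNormal Ω x)) ∂(boundaryMeasure Ω))) := fun i =>
    (hχ _ i.1.2 (θ i) (hθs i).continuous (hθc i) (hθW i) w).2 f' hf'c
  have hL := tendsto_finsetSum Finset.univ fun i _ => (hL1 i).add (hL2 i)
  -- The terms where the derivative falls on the partition cancel by `hsum0`; the boundary terms add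
  -- up because the partition sums to one on the frontier too.
  have e1 : ∑ i, ((∫ x in Ω, f' x * fderiv ℝ (θ i) x w) +
      -∫ x, f' x * (θ i x * inner ℝ w (outwardNormal Ω x)) ∂(boundaryMeasure Ω))
      = -∫ x, f x * inner ℝ w (outwardNormal Ω x) ∂(boundaryMeasure Ω) := by
    have hbi : ∀ i, Integrable (fun x => f' x * (θ i x * inner ℝ w (outwardNormal Ω x)))
        (boundaryMeasure Ω) := fun i =>
      hΩ.integrable_boundaryMeasure (hf'c.continuousOn.mul ((hθs i).continuous.continuousOn.mul
        (continuousOn_const.inner hΩ.continuousOn_outwardNormal)))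
    rw [Finset.sum_add_distrib, Finset.sum_neg_distrib, ← integral_finsetSum _ fun i _ => hint0 f' hf'c i,
      ← integral_finsetSum _ fun i _ => hbi i]
    have z1 : ∫ x in Ω, ∑ i, f' x * fderiv ℝ (θ i) x w = 0 := by
      refine setIntegral_eq_zero_of_forall_eq_zero fun x hx => ?_
      rw [← Finset.mul_sum, hsum0 x hx w, mul_zero]
    rw [z1, zero_add]
    congr 1
    refine setIntegral_congr_fun isClosed_frontier.measurableSet fun x hx => ?_
    have hx' := frontier_subset_closure hx
    rw [← Finset.mul_sum, ← Finset.sum_mul, hθ1 x hx', one_mul, hff' x hx']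
  rw [e1] at hL
  refine hL.congr' ?_
  filter_upwards [self_mem_nhdsWithin] with ε hε
  have hint3 : ∀ i : t, IntegrableOn (fun x => f' x * (fderiv ℝ (θ i) x w * χ i.1.1 ε x) +
      f' x * (θ i x * fderiv ℝ (χ i.1.1 ε) x w)) Ω := fun i =>
    (hint1 f' hf'c i ε hε).add (hint2 f' hf'c i ε hε)
  rw [Finset.sum_congr rfl fun i _ => (integral_add (hint1 f' hf'c i ε hε)
    (hint2 f' hf'c i ε hε)).symm, ← integral_finsetSum _ fun i _ => hint3 i]
  refine setIntegral_congr_fun hΩ.isOpen.measurableSet fun x hx => ?_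
  rw [hder ε hε, hff' x (subset_closure hx), Finset.mul_sum]
  exact Finset.sum_congr rfl fun i _ => (mul_add _ _ _).symm

/-! ### Green's formula -/

/-- The vectors of the standard basis of the plane. -/
noncomputable def stdVec (i : Fin 2) : Plane := EuclideanSpace.basisFun (Fin 2) ℝ i

theorem sum_inner_smul_stdVec (x : Plane) : ∑ i, inner ℝ (stdVec i) x • stdVec i = x :=
  (EuclideanSpace.basisFun (Fin 2) ℝ).sum_repr' x

section slices

variable {F : Plane × ℝ → ℝ}

theorem fderiv_slice_space (hF : Differentiable ℝ F) (x v : Plane) (t : ℝ) :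
    fderiv ℝ (fun y => F (y, t)) x v = fderiv ℝ F (x, t) (v, 0) := by
  have h := ((hF (x, t)).hasFDerivAt).comp x (hasFDerivAt_prodMk_left (𝕜 := ℝ) x t)
  have h' : HasFDerivAt (fun y => F (y, t))
      ((fderiv ℝ F (x, t)).comp (ContinuousLinearMap.inl ℝ Plane ℝ)) x := h
  rw [h'.fderiv]
  simp

theorem deriv_slice_time (hF : Differentiable ℝ F) (x : Plane) (t : ℝ) :
    deriv (fun s => F (x, s)) t = fderiv ℝ F (x, t) (0, 1) := by
  have h := ((hF (x, t)).hasFDerivAt).comp t (hasFDerivAt_prodMk_right (𝕜 := ℝ) x t)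
  have h' : HasFDerivAt (fun s => F (x, s))
      ((fderiv ℝ F (x, t)).comp (ContinuousLinearMap.inr ℝ Plane ℝ)) t := h
  rw [← fderiv_apply_one_eq_deriv, h'.fderiv]
  simp

theorem contDiff_dirDeriv (hF : ContDiff ℝ (⊤ : ℕ∞) F) (v : Plane × ℝ) :
    ContDiff ℝ (⊤ : ℕ∞) fun q => fderiv ℝ F q v :=
  (hF.fderiv_right (m := (⊤ : ℕ∞)) (by simp)).clm_apply contDiff_const

theorem laplacian_slice (hF : ContDiff ℝ (⊤ : ℕ∞) F) (x : Plane) (t : ℝ) :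
    Laplacian.laplacian (fun y => F (y, t)) x = ∑ i, fderiv ℝ
      (fun q => fderiv ℝ F q (stdVec i, 0)) (x, t) (stdVec i, 0) := by
  rw [InnerProductSpace.laplacian_eq_iteratedFDeriv_orthonormalBasis _
    (EuclideanSpace.basisFun (Fin 2) ℝ)]
  refine Finset.sum_congr rfl fun i _ => ?_
  have hs : ContDiff ℝ (⊤ : ℕ∞) fun y => F (y, t) := hF.comp (contDiff_id.prodMk contDiff_const)
  have h1 : ∀ y, fderiv ℝ F (y, t) (stdVec i, 0) = fderiv ℝ (fun y => F (y, t)) y (stdVec i) :=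
    fun y => (fderiv_slice_space (hF.differentiable (by simp)) y (stdVec i) t).symm
  rw [← fderiv_slice_space ((contDiff_dirDeriv hF _).differentiable (by simp)), iteratedFDeriv_two_apply]
  simp only [h1]
  have h2 : DifferentiableAt ℝ (fderiv ℝ fun y => F (y, t)) x :=
    (hs.fderiv_right (m := (⊤ : ℕ∞)) (by simp)).differentiable (by simp) x
  rw [fderiv_clm_apply h2 (differentiableAt_const _)]
  simp [stdVec]

end slices

theorem integrable_mul_of_tsupport_subset {E : Type*} [TopologicalSpace E] [MeasurableSpace E]
    [OpensMeasurableSpace E] {μ : Measure E} [IsFiniteMeasureOnCompacts μ]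
    {Q : Set E} (hQ : IsOpen Q) {A G : E → ℝ} (hA : ContinuousOn A Q)
    (hG : Continuous G) (hGc : HasCompactSupport G) (hGQ : tsupport G ⊆ Q) :
    Integrable (fun q => A q * G q) μ := by
  refine Continuous.integrable_of_hasCompactSupport (continuous_of_tsupport fun q hq => ?_)
    hGc.mul_left
  exact (hA.continuousAt (hQ.mem_nhds (hGQ (tsupport_mul_subset_right hq)))).mul hG.continuousAt

/-- The spatial derivative of `u` in direction `v`, relative to the closure of `Ω`. -/
noncomputable def spaceDeriv (Ω : Set Plane) (u : Plane → ℝ → ℝ) (v : Plane) (q : Plane × ℝ) : ℝ :=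
  fderivWithin ℝ (fun y => u y q.2) (closure Ω) q.1 v

section

variable {Ω : Set Plane} {T : ℝ} {f : Plane × ℝ → ℝ} {u : Plane → ℝ → ℝ}

theorem IsHeatSolution.continuousOn_spaceDeriv (hu : IsHeatSolution Ω T f u) (v : Plane) :
    ContinuousOn (spaceDeriv Ω u v) (closure Ω ×ˢ Ioo 0 T) :=
  hu.continuousOn_fderiv.clm_apply continuousOn_const

/-- The solution need not be differentiable in time, so in space-time only its spatial line
derivatives are available. -/
theorem IsHeatSolution.hasLineDerivAt (hΩ : IsOpen Ω) (hu : IsHeatSolution Ω T f u) (v : Plane)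
    {q : Plane × ℝ} (hq : q ∈ Ω ×ˢ Ioo 0 T) :
    HasLineDerivAt ℝ (fun q : Plane × ℝ => u q.1 q.2) (spaceDeriv Ω u v q) q (v, 0) := by
  have hn : closure Ω ∈ 𝓝 q.1 := mem_of_superset (hΩ.mem_nhds hq.1) subset_closure
  have h1 : HasFDerivAt (fun y => u y q.2) (fderivWithin ℝ (fun y => u y q.2) (closure Ω) q.1) q.1 :=
    ((hu.differentiableOn q.2 hq.2 q.1 (subset_closure hq.1)).hasFDerivWithinAt).hasFDerivAt hn
  have h2 := h1.hasLineDerivAt v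
  unfold HasLineDerivAt at h2 ⊢
  simpa [spaceDeriv] using h2

/-- Integration by parts needs only the line derivative of `u`; no boundary term appears because `G`
is compactly supported in the open cylinder. -/
theorem IsHeatSolution.integral_mul_dirDeriv (hΩ : IsOpen Ω) (hu : IsHeatSolution Ω T f u)
    {G : Plane × ℝ → ℝ} (hG : ContDiff ℝ (⊤ : ℕ∞) G) (hGc : HasCompactSupport G)
    (hGQ : tsupport G ⊆ Ω ×ˢ Ioo 0 T) (v : Plane) :
    ∫ q in Ω ×ˢ Ioo 0 T, u q.1 q.2 * fderiv ℝ G q (v, 0)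
      = -∫ q in Ω ×ˢ Ioo 0 T, spaceDeriv Ω u v q * G q := by
  have hQ : IsOpen (Ω ×ˢ Ioo 0 T) := hΩ.prod isOpen_Ioo
  have hsub : Ω ×ˢ Ioo 0 T ⊆ closure Ω ×ˢ Ioo 0 T := prod_mono_left subset_closure
  have hUc := hu.continuousOn.mono hsub
  have hVc := (hu.continuousOn_spaceDeriv v).mono hsub
  have hG0 : ∀ q ∉ Ω ×ˢ Ioo 0 T, G q = 0 := fun q hq =>
    image_eq_zero_of_notMem_tsupport fun h => hq (hGQ h)
  have hDs : tsupport (fun q => fderiv ℝ G q (v, 0)) ⊆ Ω ×ˢ Ioo 0 T :=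
    (tsupport_fderiv_apply_subset ℝ (v, 0)).trans hGQ
  have hD0 : ∀ q ∉ Ω ×ˢ Ioo 0 T, fderiv ℝ G q (v, 0) = 0 := fun q hq =>
    image_eq_zero_of_notMem_tsupport (f := fun q => fderiv ℝ G q (v, 0)) fun h => hq (hDs h)
  rw [setIntegral_eq_integral_of_forall_compl_eq_zero fun q hq => by rw [hD0 q hq, mul_zero],
    setIntegral_eq_integral_of_forall_compl_eq_zero fun q hq => by rw [hG0 q hq, mul_zero]]
  exact integral_bilinear_hasLineDerivAt_right_eq_neg_left_of_integrable (v := ((v, 0) : Plane × ℝ))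
    (B := ContinuousLinearMap.mul ℝ ℝ)
    (integrable_mul_of_tsupport_subset hQ hVc hG.continuous hGc hGQ)
    (integrable_mul_of_tsupport_subset hQ hUc (contDiff_dirDeriv hG _).continuous
      (hGc.fderiv_apply ℝ _) hDs)
    (integrable_mul_of_tsupport_subset hQ hUc hG.continuous hGc hGQ)
    (fun q hq => hu.hasLineDerivAt hΩ v (hGQ hq))
    (fun q _ => ((hG.differentiable (by simp) q).hasFDerivAt).hasLineDerivAt _)

/-- The weak formulation of the heat equation, tested with a cutoff of a smooth solution of the
backward heat equation. -/
theorem IsHeatSolution.weak_green (hΩ : IsOpen Ω) (hu : IsHeatSolution Ω T f u)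
    (hf : IntegrableOn f (Ω ×ˢ Ioo 0 T)) {φ : Plane × ℝ → ℝ} (hφ : ContDiff ℝ (⊤ : ℕ∞) φ)
    (hφe : ∀ q, fderiv ℝ φ q (0, 1) +
      ∑ i, fderiv ℝ (fun q => fderiv ℝ φ q (stdVec i, 0)) q (stdVec i, 0) = 0)
    {κ : Plane × ℝ → ℝ} (hκ : ContDiff ℝ (⊤ : ℕ∞) κ) (hκc : HasCompactSupport κ)
    (hκQ : tsupport κ ⊆ Ω ×ˢ Ioo 0 T) :
    (∫ q in Ω ×ˢ Ioo 0 T, u q.1 q.2 * φ q * fderiv ℝ κ q (0, 1))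
      + ∑ i, (∫ q in Ω ×ˢ Ioo 0 T, (u q.1 q.2 * fderiv ℝ φ q (stdVec i, 0)
          - φ q * spaceDeriv Ω u (stdVec i) q) * fderiv ℝ κ q (stdVec i, 0))
      + ∫ q in Ω ×ˢ Ioo 0 T, f q * φ q * κ q = 0 := by
  have hQ : IsOpen (Ω ×ˢ Ioo 0 T) := hΩ.prod isOpen_Ioo
  have hsub : Ω ×ˢ Ioo 0 T ⊆ closure Ω ×ˢ Ioo 0 T := prod_mono_left subset_closure
  have hUc := hu.continuousOn.mono hsub
  have hVc := fun v => (hu.continuousOn_spaceDeriv v).mono hsub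
  have hΨ : ContDiff ℝ (⊤ : ℕ∞) fun q => κ q * φ q := hκ.mul hφ
  have hΨc : HasCompactSupport fun q => κ q * φ q := hκc.mul_right
  have hΨQ : tsupport (fun q => κ q * φ q) ⊆ Ω ×ˢ Ioo 0 T :=
    (tsupport_mul_subset_left).trans hκQ
  have hmul : ∀ {F G : Plane × ℝ → ℝ}, ContDiff ℝ (⊤ : ℕ∞) F → ContDiff ℝ (⊤ : ℕ∞) G → ∀ q v,
      fderiv ℝ (fun q => F q * G q) q v = fderiv ℝ F q v * G q + F q * fderiv ℝ G q v := by
    intro F G hF hG q v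
    rw [fderiv_fun_mul (hF.differentiable (by simp) q) (hG.differentiable (by simp) q)]
    simp
    ring
  have hκd : ∀ v, Continuous fun q => fderiv ℝ κ q v := fun v => (contDiff_dirDeriv hκ v).continuous
  have hφd : ∀ v, Continuous fun q => fderiv ℝ φ q v := fun v => (contDiff_dirDeriv hφ v).continuous
  have hφdd : ∀ v, Continuous fun q => fderiv ℝ (fun q => fderiv ℝ φ q v) q v := fun v =>
    (contDiff_dirDeriv (contDiff_dirDeriv hφ v) v).continuous
  have hκdQ : ∀ v, tsupport (fun q => fderiv ℝ κ q v) ⊆ Ω ×ˢ Ioo 0 T := fun v =>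
    (tsupport_fderiv_apply_subset ℝ v).trans hκQ
  -- integrability
  have I1 : ∀ {A B : Plane × ℝ → ℝ}, ContinuousOn A (Ω ×ˢ Ioo 0 T) → Continuous B →
      IntegrableOn (fun q => A q * (κ q * B q)) (Ω ×ˢ Ioo 0 T) := fun hA hB =>
    (integrable_mul_of_tsupport_subset hQ hA (hκ.continuous.mul hB) hκc.mul_right
      ((tsupport_mul_subset_left).trans hκQ)).integrableOn
  have I2 : ∀ {A B : Plane × ℝ → ℝ} (v : Plane × ℝ), ContinuousOn A (Ω ×ˢ Ioo 0 T) → Continuous B →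
      IntegrableOn (fun q => A q * (fderiv ℝ κ q v * B q)) (Ω ×ˢ Ioo 0 T) := fun v hA hB =>
    (integrable_mul_of_tsupport_subset hQ hA ((hκd v).mul hB) (hκc.fderiv_apply ℝ v).mul_right
      ((tsupport_mul_subset_left).trans (hκdQ v))).integrableOn
  have I3 : IntegrableOn (fun q => f q * (κ q * φ q)) (Ω ×ˢ Ioo 0 T) := by
    obtain ⟨C, hC⟩ := hΨ.continuous.bounded_above_of_compact_support hΨc
    exact Integrable.mul_bdd (c := C) hf hΨ.continuous.aestronglyMeasurable (Eventually.of_forall hC)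
  -- One derivative is moved onto `u`, and the part containing `κ ∂φ` is moved back. Second
  -- derivatives of `κ`, which would blow up too fast as the cutoff sharpens, thus disappear.
  have key : ∀ i, ∫ q in Ω ×ˢ Ioo 0 T, u q.1 q.2 * fderiv ℝ
        (fun q => fderiv ℝ (fun q => κ q * φ q) q (stdVec i, 0)) q (stdVec i, 0)
      = (∫ q in Ω ×ˢ Ioo 0 T, (u q.1 q.2 * fderiv ℝ φ q (stdVec i, 0)
          - φ q * spaceDeriv Ω u (stdVec i) q) * fderiv ℝ κ q (stdVec i, 0))
        + ∫ q in Ω ×ˢ Ioo 0 T, u q.1 q.2 *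
          (κ q * fderiv ℝ (fun q => fderiv ℝ φ q (stdVec i, 0)) q (stdVec i, 0)) := by
    intro i
    have e1 := hu.integral_mul_dirDeriv hΩ (contDiff_dirDeriv hΨ (stdVec i, 0))
      (hΨc.fderiv_apply ℝ _) ((tsupport_fderiv_apply_subset ℝ _).trans hΨQ) (stdVec i)
    have e2 := hu.integral_mul_dirDeriv hΩ (hκ.mul (contDiff_dirDeriv hφ (stdVec i, 0)))
      hκc.mul_right ((tsupport_mul_subset_left).trans hκQ) (stdVec i)
    rw [e1]
    simp only [hmul hκ hφ, hmul hκ (contDiff_dirDeriv hφ (stdVec i, 0)), mul_add] at e2 ⊢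
    rw [integral_add (I2 _ hUc (hφd _)) (I1 hUc (hφdd _))] at e2
    rw [integral_add (I2 _ (hVc _) hφ.continuous) (I1 (hVc _) (hφd _))]
    have e3 : ∫ q in Ω ×ˢ Ioo 0 T, (u q.1 q.2 * fderiv ℝ φ q (stdVec i, 0)
          - φ q * spaceDeriv Ω u (stdVec i) q) * fderiv ℝ κ q (stdVec i, 0)
        = (∫ q in Ω ×ˢ Ioo 0 T, u q.1 q.2 * (fderiv ℝ κ q (stdVec i, 0) *
            fderiv ℝ φ q (stdVec i, 0)))
          - ∫ q in Ω ×ˢ Ioo 0 T, spaceDeriv Ω u (stdVec i) q *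
            (fderiv ℝ κ q (stdVec i, 0) * φ q) := by
      rw [← integral_sub (I2 _ hUc (hφd _)) (I2 _ (hVc _) hφ.continuous)]
      congr 1
      ext q
      ring
    rw [e3]
    linarith
  have hs := hu.solves (fun q => κ q * φ q) hΨ hΨc hΨQ
  have hpt : ∀ q : Plane × ℝ, u q.1 q.2 * (deriv (fun t => κ (q.1, t) * φ (q.1, t)) q.2 +
      Laplacian.laplacian (fun x => κ (x, q.2) * φ (x, q.2)) q.1) + f q * (κ q * φ q)
      = (u q.1 q.2 * (fderiv ℝ κ q (0, 1) * φ q) + u q.1 q.2 * (κ q * fderiv ℝ φ q (0, 1)))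
        + ∑ i, u q.1 q.2 * fderiv ℝ
          (fun q => fderiv ℝ (fun q => κ q * φ q) q (stdVec i, 0)) q (stdVec i, 0)
        + f q * (κ q * φ q) := by
    intro q
    rw [deriv_slice_time (F := fun q => κ q * φ q) (hΨ.differentiable (by simp)),
      laplacian_slice (F := fun q => κ q * φ q) hΨ, hmul hκ hφ, ← Finset.mul_sum]
    ring
  simp only [hpt] at hs
  have I4 : ∀ i, IntegrableOn (fun q => u q.1 q.2 * fderiv ℝ
      (fun q => fderiv ℝ (fun q => κ q * φ q) q (stdVec i, 0)) q (stdVec i, 0)) (Ω ×ˢ Ioo 0 T) :=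
    fun i => (integrable_mul_of_tsupport_subset hQ hUc
      (contDiff_dirDeriv (contDiff_dirDeriv hΨ _) _).continuous
      ((hΨc.fderiv_apply ℝ _).fderiv_apply ℝ _)
      (((tsupport_fderiv_apply_subset ℝ _).trans (tsupport_fderiv_apply_subset ℝ _)).trans
        hΨQ)).integrableOn
  have I5 : IntegrableOn (fun q => u q.1 q.2 * (fderiv ℝ κ q (0, 1) * φ q)
      + u q.1 q.2 * (κ q * fderiv ℝ φ q (0, 1))) (Ω ×ˢ Ioo 0 T) :=
    (I2 (0, 1) hUc hφ.continuous).add (I1 hUc (hφd (0, 1)))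
  have I6 : IntegrableOn (fun q => ∑ i, u q.1 q.2 * fderiv ℝ
      (fun q => fderiv ℝ (fun q => κ q * φ q) q (stdVec i, 0)) q (stdVec i, 0)) (Ω ×ˢ Ioo 0 T) :=
    integrable_finsetSum Finset.univ fun i _ => I4 i
  have I7 : IntegrableOn (fun q => (u q.1 q.2 * (fderiv ℝ κ q (0, 1) * φ q)
      + u q.1 q.2 * (κ q * fderiv ℝ φ q (0, 1))) + ∑ i, u q.1 q.2 * fderiv ℝ
      (fun q => fderiv ℝ (fun q => κ q * φ q) q (stdVec i, 0)) q (stdVec i, 0)) (Ω ×ˢ Ioo 0 T) :=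
    I5.add I6
  rw [integral_add I7 I3, integral_add I5 I6,
    integral_add (I2 (0, 1) hUc hφ.continuous) (I1 hUc (hφd (0, 1))),
    integral_finsetSum _ fun i _ => I4 i, Finset.sum_congr rfl fun i _ => key i,
    Finset.sum_add_distrib, ← integral_finsetSum _ fun i _ => I1 hUc (hφdd _)] at hs
  -- All derivatives fall on `φ` here, and the backward heat equation annihilates the sum.
  have e0 : (∫ q in Ω ×ˢ Ioo 0 T, u q.1 q.2 * (κ q * fderiv ℝ φ q (0, 1)))
      + ∫ q in Ω ×ˢ Ioo 0 T, ∑ i, u q.1 q.2 *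
          (κ q * fderiv ℝ (fun q => fderiv ℝ φ q (stdVec i, 0)) q (stdVec i, 0)) = 0 := by
    rw [← integral_add (I1 hUc (hφd _)) (integrable_finsetSum _ fun i _ => I1 hUc (hφdd _))]
    refine integral_eq_zero_of_ae (Eventually.of_forall fun q => ?_)
    simp only [Pi.zero_apply]
    rw [← Finset.mul_sum, ← Finset.mul_sum, ← mul_add, ← mul_add, hφe, mul_zero, mul_zero]
  have e4 : ∫ q in Ω ×ˢ Ioo 0 T, u q.1 q.2 * φ q * fderiv ℝ κ q (0, 1)
      = ∫ q in Ω ×ˢ Ioo 0 T, u q.1 q.2 * (fderiv ℝ κ q (0, 1) * φ q) := by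
    congr 1; ext q; ring
  have e5 : ∫ q in Ω ×ˢ Ioo 0 T, f q * φ q * κ q = ∫ q in Ω ×ˢ Ioo 0 T, f q * (κ q * φ q) := by
    congr 1; ext q; ring
  rw [e4, e5]
  linarith

end

/-! ### Sharpening the cutoff at the lateral boundary -/

section

variable {Ω : Set Plane} {T : ℝ} {f : Plane × ℝ → ℝ} {u : Plane → ℝ → ℝ}

/-- Continuity is known only on the open time interval; a factor supported compactly in it restores
compactness. This is why space is treated before time. -/
theorem exists_bound_mul_time {K : Set Plane} (hK : IsCompact K) {F : Plane × ℝ → ℝ}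
    (hF : ContinuousOn F (K ×ˢ Ioo 0 T)) {ψ : ℝ → ℝ} (hψ : Continuous ψ)
    (hψT : tsupport ψ ⊆ Ioo 0 T) :
    ∃ M, 0 ≤ M ∧ ∀ x ∈ K, ∀ t, |F (x, t) * ψ t| ≤ M := by
  have hc : IsCompact (tsupport ψ) :=
    isCompact_Icc.of_isClosed_subset (isClosed_tsupport _) (hψT.trans Ioo_subset_Icc_self)
  have hcont : ContinuousOn (fun q : Plane × ℝ => F q * ψ q.2) (K ×ˢ tsupport ψ) :=
    (hF.mono (prod_mono_right hψT)).mul (hψ.comp continuous_snd).continuousOn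
  obtain ⟨M, hM⟩ := (hK.prod hc).exists_bound_of_continuousOn hcont
  refine ⟨max M 0, le_max_right _ _, fun x hx t => ?_⟩
  by_cases ht : t ∈ tsupport ψ
  · exact (hM (x, t) ⟨hx, ht⟩).trans (le_max_left _ _)
  · rw [image_eq_zero_of_notMem_tsupport ht, mul_zero, abs_zero]
    exact le_max_right _ _

theorem integrableOn_mul_time (hΩ : IsSmoothBoundedDomain Ω) {F : Plane × ℝ → ℝ}
    (hF : ContinuousOn F (closure Ω ×ˢ Ioo 0 T)) {ψ : ℝ → ℝ} (hψ : Continuous ψ)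
    (hψT : tsupport ψ ⊆ Ioo 0 T) :
    IntegrableOn (fun q => F q * ψ q.2) (Ω ×ˢ Ioo 0 T) := by
  obtain ⟨M, -, hM⟩ := exists_bound_mul_time hΩ.isCompact_closure hF hψ hψT
  have hm : MeasurableSet (Ω ×ˢ Ioo 0 T) := (hΩ.isOpen.prod isOpen_Ioo).measurableSet
  refine IntegrableOn.of_bound ((hΩ.isBounded.prod (Metric.isBounded_Ioo _ _)).measure_lt_top)
    (((hF.mono (prod_mono_left subset_closure)).mul
      (hψ.comp continuous_snd).continuousOn).aestronglyMeasurable hm) M ?_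
  filter_upwards [ae_restrict_mem hm] with q hq
  exact hM q.1 (subset_closure hq.1) q.2

theorem boundaryMeasure_prod_eq (hΩ : IsSmoothBoundedDomain Ω) :
    (boundaryMeasure Ω).prod ((volume : Measure ℝ).restrict (Ioo 0 T))
      = ((boundaryMeasure Ω).prod volume).restrict (frontier Ω ×ˢ Ioo 0 T) := by
  have := hΩ.isFiniteMeasure_boundaryMeasure
  rw [← Measure.prod_restrict, boundaryMeasure,
    Measure.restrict_restrict isClosed_frontier.measurableSet, inter_self]

theorem integrable_lateral_mul_time (hΩ : IsSmoothBoundedDomain Ω) {F : Plane × ℝ → ℝ}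
    (hF : ContinuousOn F (frontier Ω ×ˢ Ioo 0 T)) {ψ : ℝ → ℝ} (hψ : Continuous ψ)
    (hψT : tsupport ψ ⊆ Ioo 0 T) :
    Integrable (fun q => F q * ψ q.2)
      ((boundaryMeasure Ω).prod ((volume : Measure ℝ).restrict (Ioo 0 T))) := by
  have := hΩ.isFiniteMeasure_boundaryMeasure
  obtain ⟨M, -, hM⟩ := exists_bound_mul_time hΩ.isCompact_frontier hF hψ hψT
  have hm : MeasurableSet (frontier Ω ×ˢ Ioo 0 T) :=
    isClosed_frontier.measurableSet.prod measurableSet_Ioo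
  refine Integrable.of_bound (C := M) ?_ ?_
  · rw [boundaryMeasure_prod_eq hΩ]
    exact (hF.mul (hψ.comp continuous_snd).continuousOn).aestronglyMeasurable hm
  · rw [boundaryMeasure_prod_eq hΩ]
    filter_upwards [ae_restrict_mem hm] with q hq
    exact hM q.1 hq.1 q.2

theorem setIntegral_prod_time {F : Plane × ℝ → ℝ} (hF : IntegrableOn F (Ω ×ˢ Ioo 0 T)) :
    ∫ q in Ω ×ˢ Ioo 0 T, F q = ∫ t in Ioo 0 T, ∫ x in Ω, F (x, t) := by
  rw [IntegrableOn, Measure.volume_eq_prod, ← Measure.prod_restrict] at hF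
  rw [Measure.volume_eq_prod, ← Measure.prod_restrict, integral_prod_symm _ hF]

/-- Passage to the limit in the lateral boundary layer. -/
theorem tendsto_integral_cutoff (hΩ : IsSmoothBoundedDomain Ω) {η : ℝ → Plane → ℝ}
    (hηs : ∀ ε > 0, ContDiff ℝ (⊤ : ℕ∞) (η ε)) {w : Plane}
    (hηb : ∃ C, ∀ ε > 0, ∫ x in Ω, |fderiv ℝ (η ε) x w| ≤ C)
    (hη : ∀ f : Plane → ℝ, ContinuousOn f (closure Ω) →
      Tendsto (fun ε => ∫ x in Ω, f x * fderiv ℝ (η ε) x w) (𝓝[>] 0)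
        (𝓝 (-∫ x, f x * inner ℝ w (outwardNormal Ω x) ∂(boundaryMeasure Ω))))
    {F : Plane × ℝ → ℝ} (hF : ContinuousOn F (closure Ω ×ˢ Ioo 0 T)) {ψ : ℝ → ℝ}
    (hψ : Continuous ψ) (hψT : tsupport ψ ⊆ Ioo 0 T) :
    Tendsto (fun ε => ∫ q in Ω ×ˢ Ioo 0 T, F q * (fderiv ℝ (η ε) q.1 w * ψ q.2)) (𝓝[>] 0)
      (𝓝 (-∫ t in Ioo 0 T, ψ t *
        ∫ x, F (x, t) * inner ℝ w (outwardNormal Ω x) ∂(boundaryMeasure Ω))) := by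
  have hd : ∀ ε > 0, Continuous fun x => fderiv ℝ (η ε) x w := fun ε hε =>
    ((hηs ε hε).continuous_fderiv (by simp)).clm_apply continuous_const
  have hI : ∀ ε > 0, IntegrableOn (fun q : Plane × ℝ => F q * (fderiv ℝ (η ε) q.1 w * ψ q.2))
      (Ω ×ˢ Ioo 0 T) := fun ε hε => by
    have := integrableOn_mul_time hΩ
      (hF.mul ((hd ε hε).comp continuous_fst).continuousOn) hψ hψT
    refine this.congr_fun (fun q _ => ?_) (hΩ.isOpen.prod isOpen_Ioo).measurableSet
    exact mul_assoc _ _ _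
  obtain ⟨M, hM0, hM⟩ := exists_bound_mul_time hΩ.isCompact_closure hF hψ hψT
  obtain ⟨C, hC⟩ := hηb
  have hlim : Tendsto (fun ε => ∫ t in Ioo 0 T, ∫ x in Ω, F (x, t) * (fderiv ℝ (η ε) x w * ψ t))
      (𝓝[>] 0) (𝓝 (∫ t in Ioo 0 T, -(ψ t *
        ∫ x, F (x, t) * inner ℝ w (outwardNormal Ω x) ∂(boundaryMeasure Ω)))) := by
    -- The boundary limit holds at each fixed time; the uniform `L¹` bound on the gradients of the
    -- cutoffs dominates in `t`.
    refine tendsto_integral_filter_of_dominated_convergence (fun _ => M * C) ?_ ?_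
      (integrable_const _) ?_
    · filter_upwards [self_mem_nhdsWithin] with ε hε
      have := hI ε hε
      rw [IntegrableOn, Measure.volume_eq_prod, ← Measure.prod_restrict] at this
      exact this.integral_prod_right.aestronglyMeasurable
    · filter_upwards [self_mem_nhdsWithin] with ε hε
      refine Eventually.of_forall fun t => ?_
      have hi : IntegrableOn (fun x => |fderiv ℝ (η ε) x w|) Ω :=
        ((hd ε hε).abs.continuousOn.integrableOn_compact hΩ.isCompact_closure).mono_set subset_closure
      calc ‖∫ x in Ω, F (x, t) * (fderiv ℝ (η ε) x w * ψ t)‖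
          ≤ ∫ x in Ω, M * |fderiv ℝ (η ε) x w| := by
            refine norm_integral_le_of_norm_le (hi.const_mul M) ?_
            filter_upwards [ae_restrict_mem hΩ.isOpen.measurableSet] with x hx
            rw [Real.norm_eq_abs, mul_comm (fderiv ℝ (η ε) x w), ← mul_assoc, abs_mul]
            exact mul_le_mul_of_nonneg_right (hM x (subset_closure hx) t) (abs_nonneg _)
        _ ≤ M * C := by
            rw [integral_const_mul]
            exact mul_le_mul_of_nonneg_left (hC ε hε) hM0
    · filter_upwards [ae_restrict_mem measurableSet_Ioo] with t ht
      have h1 : ContinuousOn (fun x => F (x, t)) (closure Ω) :=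
        hF.comp (by fun_prop) fun x hx => ⟨hx, ht⟩
      have h2 := (hη _ h1).const_mul (ψ t)
      rw [mul_neg] at h2
      refine h2.congr fun ε => ?_
      rw [← integral_const_mul]
      congr 1
      ext x
      ring
  rw [integral_neg] at hlim
  refine hlim.congr' ?_
  filter_upwards [self_mem_nhdsWithin] with ε hε
  exact (setIntegral_prod_time (hI ε hε)).symm

/-- Green's formula localized in time. -/
theorem IsHeatSolution.green_time_cutoff (hΩ : IsSmoothBoundedDomain Ω)
    (hu : IsHeatSolution Ω T f u)
    (hf : IntegrableOn f (Ω ×ˢ Ioo 0 T)) {φ : Plane × ℝ → ℝ} (hφ : ContDiff ℝ (⊤ : ℕ∞) φ)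
    (hφe : ∀ q, fderiv ℝ φ q (0, 1) +
      ∑ i, fderiv ℝ (fun q => fderiv ℝ φ q (stdVec i, 0)) q (stdVec i, 0) = 0)
    {ψ : ℝ → ℝ} (hψ : ContDiff ℝ (⊤ : ℕ∞) ψ) (hψT : tsupport ψ ⊆ Ioo 0 T) :
    (∫ q in Ω ×ˢ Ioo 0 T, u q.1 q.2 * φ q * deriv ψ q.2)
      - (∫ t in Ioo 0 T, ψ t * ∫ x, (fderiv ℝ φ (x, t) (outwardNormal Ω x, 0) * u x t
          - normalDeriv Ω u x t * φ (x, t)) ∂(boundaryMeasure Ω))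
      + ∫ q in Ω ×ˢ Ioo 0 T, f q * φ q * ψ q.2 = 0 := by
  obtain ⟨η, hηs, hηΩ, hη01, hη1, hη⟩ := hΩ.exists_cutoff
  have hφd : ∀ v, Continuous fun q => fderiv ℝ φ q v := fun v => (contDiff_dirDeriv hφ v).continuous
  have hm : MeasurableSet (Ω ×ˢ Ioo 0 T) := (hΩ.isOpen.prod isOpen_Ioo).measurableSet
  have hψd : Continuous (deriv ψ) := hψ.continuous_deriv (by exact_mod_cast le_top)
  have hψc : HasCompactSupport ψ :=
    isCompact_Icc.of_isClosed_subset (isClosed_tsupport _) (hψT.trans Ioo_subset_Icc_self)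
  set F : Fin 2 → Plane × ℝ → ℝ := fun i q => u q.1 q.2 * fderiv ℝ φ q (stdVec i, 0)
          - φ q * spaceDeriv Ω u (stdVec i) q with hF
  have hFc : ∀ i, ContinuousOn (F i) (closure Ω ×ˢ Ioo 0 T) := fun i =>
    (hu.continuousOn.mul (hφd _).continuousOn).sub
      (hφ.continuous.continuousOn.mul (hu.continuousOn_spaceDeriv _))
  have hκs : ∀ ε > 0, ContDiff ℝ (⊤ : ℕ∞) fun q : Plane × ℝ => η ε q.1 * ψ q.2 := fun ε hε =>
    ((hηs ε hε).comp contDiff_fst).mul (hψ.comp contDiff_snd)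
  have hκQ : ∀ ε > 0, tsupport (fun q : Plane × ℝ => η ε q.1 * ψ q.2)
      ⊆ tsupport (η ε) ×ˢ tsupport ψ := fun ε hε =>
    closure_minimal (fun q hq => ⟨subset_tsupport _ (left_ne_zero_of_mul hq),
      subset_tsupport _ (right_ne_zero_of_mul hq)⟩)
      ((isClosed_tsupport _).prod (isClosed_tsupport _))
  have hκc : ∀ ε > 0, HasCompactSupport fun q : Plane × ℝ => η ε q.1 * ψ q.2 := fun ε hε =>
    ((hΩ.isCompact_closure.of_isClosed_subset (isClosed_tsupport _)
      ((hηΩ ε hε).trans subset_closure)).prod hψc).of_isClosed_subset (isClosed_tsupport _)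
      (hκQ ε hε)
  have hκx : ∀ ε > 0, ∀ q v, fderiv ℝ (fun q : Plane × ℝ => η ε q.1 * ψ q.2) q (v, 0)
      = fderiv ℝ (η ε) q.1 v * ψ q.2 := by
    intro ε hε q v
    have := fderiv_slice_space ((hκs ε hε).differentiable (by simp)) q.1 v q.2
    rw [Prod.mk.eta] at this
    rw [← this]
    simp only
    rw [fderiv_mul_const ((hηs ε hε).differentiable (by simp) q.1)]
    simp [mul_comm]
  have hκt : ∀ ε > 0, ∀ q, fderiv ℝ (fun q : Plane × ℝ => η ε q.1 * ψ q.2) q (0, 1)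
      = η ε q.1 * deriv ψ q.2 := by
    intro ε hε q
    have := deriv_slice_time ((hκs ε hε).differentiable (by simp)) q.1 q.2
    rw [Prod.mk.eta] at this
    rw [← this]
    simp only
    rw [deriv_const_mul_field]
  have hid : ∀ ε > 0, (∫ q in Ω ×ˢ Ioo 0 T, u q.1 q.2 * φ q * (η ε q.1 * deriv ψ q.2))
      + ∑ i, (∫ q in Ω ×ˢ Ioo 0 T, F i q * (fderiv ℝ (η ε) q.1 (stdVec i) * ψ q.2))
      + ∫ q in Ω ×ˢ Ioo 0 T, f q * φ q * (η ε q.1 * ψ q.2) = 0 := by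
    intro ε hε
    have := hu.weak_green hΩ.isOpen hf hφ hφe (hκs ε hε) (hκc ε hε)
      ((hκQ ε hε).trans (prod_mono (hηΩ ε hε) hψT))
    simpa only [hκx ε hε, hκt ε hε] using this
  have hfφ : IntegrableOn (fun q => f q * φ q * ψ q.2) (Ω ×ˢ Ioo 0 T) := by
    have hc : Continuous fun q : Plane × ℝ => φ q * ψ q.2 :=
      hφ.continuous.mul (hψ.continuous.comp continuous_snd)
    obtain ⟨C, hC⟩ := (hΩ.isCompact_closure.prod (isCompact_Icc (a := 0) (b := T))).exists_bound_of_continuousOn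
      hc.continuousOn
    have := Integrable.mul_bdd (c := C) hf hc.aestronglyMeasurable (by
      filter_upwards [ae_restrict_mem hm] with q hq
      exact hC q ⟨subset_closure hq.1, Ioo_subset_Icc_self hq.2⟩)
    exact this.congr (Eventually.of_forall fun q => (mul_assoc _ _ _).symm)
  have hψdT : tsupport (deriv ψ) ⊆ Ioo 0 T := tsupport_deriv_subset.trans hψT
  -- In the terms where the space cutoff is not differentiated, its values in `[0, 1]` suffice for
  -- dominated convergence.
  have hlim0 : ∀ {A : Plane × ℝ → ℝ} {k : ℝ → ℝ}, IntegrableOn (fun q => A q * k q.2) (Ω ×ˢ Ioo 0 T) →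
      Continuous k → AEStronglyMeasurable A (volume.restrict (Ω ×ˢ Ioo 0 T)) →
      Tendsto (fun ε => ∫ q in Ω ×ˢ Ioo 0 T, A q * (η ε q.1 * k q.2)) (𝓝[>] 0)
        (𝓝 (∫ q in Ω ×ˢ Ioo 0 T, A q * k q.2)) := by
    intro A k hA hk hAm
    refine tendsto_integral_filter_of_dominated_convergence _ ?_ ?_ hA.norm ?_
    · filter_upwards [self_mem_nhdsWithin] with ε hε
      exact hAm.mul (((hηs ε hε).continuous.comp continuous_fst).mul
        (hk.comp continuous_snd)).aestronglyMeasurable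
    · refine Eventually.of_forall fun ε => ?_
      filter_upwards [ae_restrict_mem hm] with q hq
      have h01 := hη01 ε q.1 (subset_closure hq.1)
      rw [mul_left_comm, norm_mul, Real.norm_of_nonneg h01.1]
      exact mul_le_of_le_one_left (norm_nonneg _) h01.2
    · filter_upwards [ae_restrict_mem hm] with q hq
      have := ((hη1 q.1 hq.1).mul_const (k q.2)).const_mul (A q)
      rwa [one_mul] at this
  have hL1 := hlim0 (A := fun q => u q.1 q.2 * φ q)
    (integrableOn_mul_time hΩ (hu.continuousOn.mul hφ.continuous.continuousOn) hψd hψdT) hψd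
    (((hu.continuousOn.mul hφ.continuous.continuousOn).mono
      (prod_mono_left subset_closure)).aestronglyMeasurable hm)
  have hL3 := hlim0 (A := fun q => f q * φ q) hfφ hψ.continuous
    (hf.aestronglyMeasurable.mul hφ.continuous.aestronglyMeasurable)
  have hL2 := tendsto_finsetSum Finset.univ fun i _ =>
    tendsto_integral_cutoff hΩ hηs (hη (stdVec i)).1 (hη (stdVec i)).2 (hFc i) hψ.continuous hψT
  have hL := ((hL1.add hL2).add hL3)
  have hz := tendsto_nhds_unique (hL.congr' (by
    filter_upwards [self_mem_nhdsWithin] with ε hε using hid ε hε)) tendsto_const_nhds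
  refine Eq.trans ?_ hz
  rw [sub_eq_add_neg]
  congr 2
  have hFb : ∀ i, ∀ t ∈ Ioo 0 T, Integrable (fun x => F i (x, t) * inner ℝ (stdVec i)
      (outwardNormal Ω x)) (boundaryMeasure Ω) := fun i t ht =>
    hΩ.integrable_boundaryMeasure ((((hFc i).comp (f := fun x => (x, t)) (by fun_prop)
      fun x hx => ⟨frontier_subset_closure hx, ht⟩)).mul
      (continuousOn_const.inner hΩ.continuousOn_outwardNormal))
  have hFt : ∀ i, IntegrableOn (fun t => ψ t * ∫ x, F i (x, t) * inner ℝ (stdVec i)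
      (outwardNormal Ω x) ∂(boundaryMeasure Ω)) (Ioo 0 T) := by
    intro i
    have h1 : ContinuousOn (fun q : Plane × ℝ => F i q * inner ℝ (stdVec i) (outwardNormal Ω q.1))
        (frontier Ω ×ˢ Ioo 0 T) :=
      ((hFc i).mono (prod_mono_left frontier_subset_closure)).mul (continuousOn_const.inner
        (hΩ.continuousOn_outwardNormal.comp continuousOn_fst fun q hq => hq.1))
    have := hΩ.isFiniteMeasure_boundaryMeasure
    have h2 := (integrable_lateral_mul_time hΩ h1 hψ.continuous hψT).integral_prod_right
    refine h2.congr (Eventually.of_forall fun t => ?_)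
    simp only
    rw [integral_mul_const, mul_comm]
  rw [Finset.sum_neg_distrib, ← integral_finsetSum _ fun i _ => hFt i]
  congr 1
  refine setIntegral_congr_fun measurableSet_Ioo fun t ht => ?_
  rw [← Finset.mul_sum, ← integral_finsetSum _ fun i _ => hFb i t ht]
  congr 1
  refine integral_congr_ae (Eventually.of_forall fun x => ?_)
  simp only [hF]
  -- Expanding the normal in the standard basis reassembles the coordinate fluxes into normal
  -- derivatives.
  have hν := sum_inner_smul_stdVec (outwardNormal Ω x)
  have e1 : fderiv ℝ φ (x, t) (outwardNormal Ω x, 0)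
      = ∑ i, inner ℝ (stdVec i) (outwardNormal Ω x) * fderiv ℝ φ (x, t) (stdVec i, 0) := by
    have : (outwardNormal Ω x, (0 : ℝ))
        = ∑ i, inner ℝ (stdVec i) (outwardNormal Ω x) • ((stdVec i, 0) : Plane × ℝ) := by
      refine Prod.ext ?_ ?_
      · simpa [Prod.fst_sum] using hν.symm
      · simp
    rw [this, map_sum]
    simp only [map_smul, smul_eq_mul]
  have e2 : normalDeriv Ω u x t
      = ∑ i, inner ℝ (stdVec i) (outwardNormal Ω x) * spaceDeriv Ω u (stdVec i) (x, t) := by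
    unfold normalDeriv spaceDeriv
    nth_rw 1 [← hν]
    rw [map_sum]
    simp
  rw [e1, e2, Finset.sum_mul, Finset.sum_mul, ← Finset.sum_sub_distrib]
  refine Finset.sum_congr rfl fun i _ => ?_
  ring

end

/-! ### Cutoffs in time -/

theorem integrable_mul_stepDeriv {N : ℝ → ℝ} (hN : Continuous N) {δ : ℝ} (hδ : 0 < δ) :
    Integrable fun t => N t * (stepDeriv (t / δ) / δ) := by
  refine Continuous.integrable_of_hasCompactSupport
    (hN.mul ((continuous_stepDeriv.comp (continuous_id.div_const δ)).div_const δ)) ?_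
  refine HasCompactSupport.intro (isCompact_Icc (a := δ) (b := 2 * δ)) fun s hs => ?_
  rw [stepDeriv_eq_zero, zero_div, mul_zero]
  rintro ⟨h1, h2⟩
  exact hs ⟨(one_le_div hδ).1 h1, (div_le_iff₀ hδ).1 h2⟩

/-- The rescaled densities `stepDeriv (t / δ) / δ` converge to the Dirac mass at `0`. -/
theorem tendsto_integral_mul_stepDeriv {N : ℝ → ℝ} (hN : Continuous N) {C : ℝ}
    (hC : ∀ t, |N t| ≤ C) :
    Tendsto (fun δ : ℝ => ∫ t, N t * (stepDeriv (t / δ) / δ)) (𝓝[>] 0) (𝓝 (N 0)) := by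
  have hlim : Tendsto (fun δ : ℝ => ∫ σ, N (δ * σ) * stepDeriv σ) (𝓝[>] 0)
      (𝓝 (∫ σ, N 0 * stepDeriv σ)) := by
    refine tendsto_integral_filter_of_dominated_convergence (fun σ => C * |stepDeriv σ|) ?_ ?_
      (integrable_stepDeriv.abs.const_mul C) ?_
    · exact Eventually.of_forall fun δ => ((hN.comp (continuous_const.mul continuous_id)).mul
        continuous_stepDeriv).aestronglyMeasurable
    · refine Eventually.of_forall fun δ => Eventually.of_forall fun σ => ?_
      rw [Real.norm_eq_abs, abs_mul]
      exact mul_le_mul_of_nonneg_right (hC _) (abs_nonneg _)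
    · refine Eventually.of_forall fun σ => ?_
      have hc : Continuous fun δ : ℝ => N (δ * σ) * stepDeriv σ := by fun_prop
      have := hc.tendsto 0
      rw [zero_mul] at this
      exact this.mono_left nhdsWithin_le_nhds
  rw [integral_const_mul, integral_stepDeriv, mul_one] at hlim
  refine hlim.congr' ?_
  filter_upwards [self_mem_nhdsWithin] with δ hδ
  have hδ : 0 < δ := hδ
  have := Measure.integral_comp_div (fun σ => N (δ * σ) * (stepDeriv σ / δ)) δ
  simp only [mul_div_cancel₀ _ hδ.ne'] at this
  rw [this, abs_of_pos hδ, smul_eq_mul, ← integral_const_mul]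
  congr 1
  ext σ
  field_simp

/-- A smooth cutoff of the interval `]0, T[`. -/
noncomputable def timeCutoff (T δ t : ℝ) : ℝ :=
  Real.smoothTransition (t / δ - 1) * Real.smoothTransition ((T - t) / δ - 1)

theorem contDiff_timeCutoff (T δ : ℝ) : ContDiff ℝ (⊤ : ℕ∞) (timeCutoff T δ) :=
  (Real.smoothTransition.contDiff.comp ((contDiff_id.div_const δ).sub contDiff_const)).mul
    (Real.smoothTransition.contDiff.comp
      (((contDiff_const.sub contDiff_id).div_const δ).sub contDiff_const))

theorem tsupport_timeCutoff {T δ : ℝ} (hδ : 0 < δ) : tsupport (timeCutoff T δ) ⊆ Ioo 0 T := by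
  have h : tsupport (timeCutoff T δ) ⊆ Icc δ (T - δ) := by
    refine closure_minimal (fun t ht => ⟨?_, ?_⟩) isClosed_Icc
    · by_contra hlt
      refine left_ne_zero_of_mul ht (Real.smoothTransition.zero_of_nonpos ?_)
      rw [sub_nonpos, div_le_one hδ]
      exact (not_le.1 hlt).le
    · by_contra hlt
      refine right_ne_zero_of_mul ht (Real.smoothTransition.zero_of_nonpos ?_)
      rw [sub_nonpos, div_le_one hδ]
      linarith [not_le.1 hlt]
  exact h.trans fun t ht => ⟨hδ.trans_le ht.1, by linarith [ht.2]⟩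

/-- The condition `4 * δ ≤ T` separates the two ramps, each of which ends at distance `2 * δ` from
its end of the interval; where one factor varies, the other is 1. -/
theorem deriv_timeCutoff {T δ : ℝ} (hδ : 0 < δ) (hδT : 4 * δ ≤ T) (t : ℝ) :
    deriv (timeCutoff T δ) t = stepDeriv (t / δ) / δ - stepDeriv ((T - t) / δ) / δ := by
  have h1 : HasDerivAt (fun t => Real.smoothTransition (t / δ - 1)) (stepDeriv (t / δ) * (1 / δ)) t :=
    HasDerivAt.comp (h₂ := fun s => Real.smoothTransition (s - 1)) (h := fun t => t / δ) t
      (hasDerivAt_step (t / δ)) ((hasDerivAt_id t).div_const δ)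
  have h2 : HasDerivAt (fun t => Real.smoothTransition ((T - t) / δ - 1))
      (stepDeriv ((T - t) / δ) * (-1 / δ)) t :=
    HasDerivAt.comp (h₂ := fun s => Real.smoothTransition (s - 1)) (h := fun t => (T - t) / δ) t
      (hasDerivAt_step ((T - t) / δ)) (((hasDerivAt_id t).const_sub T).div_const δ)
  have h3 := (h1.mul h2).deriv
  have h4 : stepDeriv (t / δ) * Real.smoothTransition ((T - t) / δ - 1) = stepDeriv (t / δ) := by
    by_cases h : t / δ ∈ Icc (1 : ℝ) 2
    · have : t ≤ 2 * δ := (div_le_iff₀ hδ).1 h.2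
      rw [Real.smoothTransition.one_of_one_le, mul_one]
      have : 2 ≤ (T - t) / δ := (le_div_iff₀ hδ).2 (by linarith)
      linarith
    · rw [stepDeriv_eq_zero h, zero_mul]
  have h5 : stepDeriv ((T - t) / δ) * Real.smoothTransition (t / δ - 1)
      = stepDeriv ((T - t) / δ) := by
    by_cases h : (T - t) / δ ∈ Icc (1 : ℝ) 2
    · have : T - t ≤ 2 * δ := (div_le_iff₀ hδ).1 h.2
      rw [Real.smoothTransition.one_of_one_le, mul_one]
      have : 2 ≤ t / δ := (le_div_iff₀ hδ).2 (by linarith)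
      linarith
    · rw [stepDeriv_eq_zero h, zero_mul]
  refine h3.trans ?_
  linear_combination (1 / δ) * h4 - (1 / δ) * h5

theorem timeCutoff_mem_Icc (T δ t : ℝ) : timeCutoff T δ t ∈ Icc (0 : ℝ) 1 :=
  ⟨mul_nonneg (Real.smoothTransition.nonneg _) (Real.smoothTransition.nonneg _),
    mul_le_one₀ (Real.smoothTransition.le_one _) (Real.smoothTransition.nonneg _)
      (Real.smoothTransition.le_one _)⟩

theorem eventually_timeCutoff_eq_one {T t : ℝ} (ht : t ∈ Ioo 0 T) :
    ∀ᶠ δ in 𝓝[>] (0 : ℝ), timeCutoff T δ t = 1 := by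
  have hpos : 0 < min t (T - t) := lt_min ht.1 (sub_pos.2 ht.2)
  filter_upwards [Ioo_mem_nhdsGT (half_pos hpos)] with δ hδ
  have h1 : 2 ≤ t / δ := (le_div_iff₀ hδ.1).2 (by linarith [hδ.2, min_le_left t (T - t)])
  have h2 : 2 ≤ (T - t) / δ := (le_div_iff₀ hδ.1).2 (by linarith [hδ.2, min_le_right t (T - t)])
  rw [timeCutoff, Real.smoothTransition.one_of_one_le (by linarith),
    Real.smoothTransition.one_of_one_le (by linarith), one_mul]

/-! ### Green's formula up to the initial and final times -/

section

variable {Ω : Set Plane} {T : ℝ} {f : Plane × ℝ → ℝ} {u : Plane → ℝ → ℝ}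

theorem IsHeatSolution.integrableOn_mul (hΩ : IsSmoothBoundedDomain Ω) (hu : IsHeatSolution Ω T f u)
    {t : ℝ} (ht : t ∈ Icc 0 T) {k : Plane → ℝ} (hk : Continuous k) :
    IntegrableOn (fun x => u x t * k x) Ω := by
  obtain ⟨C, hC⟩ := hΩ.isCompact_closure.exists_bound_of_continuousOn hk.continuousOn
  refine Integrable.mul_bdd (c := C) (hu.integrableOn t ht) hk.aestronglyMeasurable ?_
  filter_upwards [ae_restrict_mem hΩ.isOpen.measurableSet] with x hx
  exact hC x (subset_closure hx)

/-- Combines continuity of `u` in `L¹` with that of the test function. It is what gives meaning to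
the limits at the two ends of the time interval, where `u` has no pointwise continuity. -/
theorem IsHeatSolution.continuousOn_moment (hΩ : IsSmoothBoundedDomain Ω)
    (hu : IsHeatSolution Ω T f u) {φ : Plane × ℝ → ℝ} (hφ : Continuous φ) :
    ContinuousOn (fun t => ∫ x in Ω, u x t * φ (x, t)) (Icc 0 T) := by
  intro t₀ ht₀
  have hφt : ∀ t, Continuous fun x => φ (x, t) := fun t => hφ.comp (by fun_prop)
  obtain ⟨C, hC⟩ := (hΩ.isCompact_closure.prod
    (isCompact_Icc (a := 0) (b := T))).exists_bound_of_continuousOn hφ.continuousOn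
  have hΩm := hΩ.isOpen.measurableSet
  have h1 : Tendsto (fun t => ∫ x in Ω, (u x t - u x t₀) * φ (x, t)) (𝓝[Icc 0 T] t₀)
      (𝓝 (∫ x in Ω, (0 : ℝ))) := by
    refine tendsto_integral_of_L1 (fun _ => (0 : ℝ)) aestronglyMeasurable_zero ?_ ?_
    · filter_upwards [self_mem_nhdsWithin] with t ht
      have := (hu.integrableOn_mul hΩ ht (hφt t)).sub (hu.integrableOn_mul hΩ ht₀ (hφt t))
      refine this.congr (Eventually.of_forall fun x => ?_)
      simp only [Pi.sub_apply]
      ring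
    · have h2 := ENNReal.Tendsto.const_mul (a := ENNReal.ofReal C) (hu.continuous_L1 t₀ ht₀)
        (Or.inr ENNReal.ofReal_ne_top)
      rw [mul_zero] at h2
      refine tendsto_of_tendsto_of_tendsto_of_le_of_le' tendsto_const_nhds h2
        (Eventually.of_forall fun _ => zero_le) ?_
      filter_upwards [self_mem_nhdsWithin] with t ht
      rw [← lintegral_const_mul' _ _ ENNReal.ofReal_ne_top]
      refine lintegral_mono_ae ?_
      filter_upwards [ae_restrict_mem hΩm] with x hx
      rw [sub_zero, enorm_mul, mul_comm]
      refine mul_le_mul_left ?_ _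
      rw [← ofReal_norm]
      exact ENNReal.ofReal_le_ofReal (hC (x, t) ⟨subset_closure hx, ht⟩)
  have h2 : Tendsto (fun t => ∫ x in Ω, u x t₀ * φ (x, t)) (𝓝[Icc 0 T] t₀)
      (𝓝 (∫ x in Ω, u x t₀ * φ (x, t₀))) := by
    refine tendsto_integral_filter_of_dominated_convergence (fun x => |u x t₀| * C) ?_ ?_
      ((hu.integrableOn t₀ ht₀).abs.mul_const C) ?_
    · exact Eventually.of_forall fun t => (hu.integrableOn_mul hΩ ht₀ (hφt t)).aestronglyMeasurable
    · filter_upwards [self_mem_nhdsWithin] with t ht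
      filter_upwards [ae_restrict_mem hΩm] with x hx
      rw [norm_mul]
      exact mul_le_mul_of_nonneg_left (hC (x, t) ⟨subset_closure hx, ht⟩) (abs_nonneg _)
    · refine Eventually.of_forall fun x => ?_
      have hc : Continuous fun t => u x t₀ * φ (x, t) :=
        continuous_const.mul (hφ.comp (by fun_prop))
      exact (hc.tendsto t₀).mono_left nhdsWithin_le_nhds
  have h3 := h1.add h2
  rw [integral_zero, zero_add] at h3
  refine h3.congr' ?_
  filter_upwards [self_mem_nhdsWithin] with t ht
  have i1 : IntegrableOn (fun x => (u x t - u x t₀) * φ (x, t)) Ω := by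
    have := (hu.integrableOn_mul hΩ ht (hφt t)).sub (hu.integrableOn_mul hΩ ht₀ (hφt t))
    refine this.congr (Eventually.of_forall fun x => ?_)
    simp only [Pi.sub_apply]
    ring
  rw [← integral_add i1 (hu.integrableOn_mul hΩ ht₀ (hφt t))]
  congr 1
  ext x
  ring

/-- The lateral data are integrable up to both ends of the time interval, and the smooth factors are
bounded on the compact lateral boundary. This dominates the removal of the time cutoff. -/
theorem IsHeatSolution.integrable_boundary_flux (hΩ : IsSmoothBoundedDomain Ω)
    (hu : IsHeatSolution Ω T f u) {φ : Plane × ℝ → ℝ} (hφ : ContDiff ℝ (⊤ : ℕ∞) φ) :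
    Integrable (fun q : Plane × ℝ => fderiv ℝ φ q (outwardNormal Ω q.1, 0) * u q.1 q.2
      - normalDeriv Ω u q.1 q.2 * φ q)
      ((boundaryMeasure Ω).prod ((volume : Measure ℝ).restrict (Ioo 0 T))) := by
  have := hΩ.isFiniteMeasure_boundaryMeasure
  have hm : MeasurableSet (frontier Ω ×ˢ Ioo 0 T) :=
    isClosed_frontier.measurableSet.prod measurableSet_Ioo
  have hK : IsCompact (frontier Ω ×ˢ Icc 0 T) := hΩ.isCompact_frontier.prod isCompact_Icc
  have hsub : frontier Ω ×ˢ Ioo 0 T ⊆ frontier Ω ×ˢ Icc 0 T := prod_mono_right Ioo_subset_Icc_self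
  have hd : ContinuousOn (fun q : Plane × ℝ => fderiv ℝ φ q (outwardNormal Ω q.1, 0))
      (frontier Ω ×ˢ Icc 0 T) :=
    (hφ.continuous_fderiv (by simp)).continuousOn.clm_apply
      ((hΩ.continuousOn_outwardNormal.comp continuousOn_fst fun q hq => hq.1).prodMk
        continuousOn_const)
  obtain ⟨C, hC⟩ := hK.exists_bound_of_continuousOn hd
  obtain ⟨C', hC'⟩ := hK.exists_bound_of_continuousOn hφ.continuous.continuousOn
  refine Integrable.sub (Integrable.bdd_mul (c := C) hu.integrable_trace ?_ ?_)
    (Integrable.mul_bdd (c := C') hu.integrable_normalDeriv hφ.continuous.aestronglyMeasurable ?_)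
  · rw [boundaryMeasure_prod_eq hΩ]
    exact (hd.mono hsub).aestronglyMeasurable hm
  · rw [boundaryMeasure_prod_eq hΩ]
    filter_upwards [ae_restrict_mem hm] with q hq using hC q (hsub hq)
  · rw [boundaryMeasure_prod_eq hΩ]
    filter_upwards [ae_restrict_mem hm] with q hq using hC' q (hsub hq)

/-- **Green's formula** for a solution of the heat equation with vanishing initial value and a
smooth solution of the backward heat equation. -/
theorem IsHeatSolution.green (hΩ : IsSmoothBoundedDomain Ω) (hT : 0 < T)
    (hu : IsHeatSolution Ω T f u)
    (hf : IntegrableOn f (Ω ×ˢ Ioo 0 T)) {φ : Plane × ℝ → ℝ} (hφ : ContDiff ℝ (⊤ : ℕ∞) φ)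
    (hφe : ∀ q, fderiv ℝ φ q (0, 1) +
      ∑ i, fderiv ℝ (fun q => fderiv ℝ φ q (stdVec i, 0)) q (stdVec i, 0) = 0) :
    ∫ t in Ioo 0 T, ∫ x, (fderiv ℝ φ (x, t) (outwardNormal Ω x, 0) * u x t
          - normalDeriv Ω u x t * φ (x, t)) ∂(boundaryMeasure Ω)
      = (∫ q in Ω ×ˢ Ioo 0 T, f q * φ q) - ∫ x in Ω, u x T * φ (x, T) := by
  have := hΩ.isFiniteMeasure_boundaryMeasure
  have hm : MeasurableSet (Ω ×ˢ Ioo 0 T) := (hΩ.isOpen.prod isOpen_Ioo).measurableSet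
  set M : ℝ → ℝ := fun t => ∫ x in Ω, u x t * φ (x, t) with hMdef
  have hM : ContinuousOn M (Icc 0 T) := hu.continuousOn_moment hΩ hφ.continuous
  have hM0 : M 0 = 0 := by
    refine setIntegral_eq_zero_of_forall_eq_zero fun x hx => ?_
    rw [hu.initial x hx, zero_mul]
  obtain ⟨C, hC⟩ := isCompact_Icc.exists_bound_of_continuousOn hM
  -- Extending the moment by its end values gives a bounded continuous function on the line, to
  -- which the Dirac limit applies.
  set N : ℝ → ℝ := fun t => M (projIcc 0 T hT.le t) with hN
  have hNc : Continuous N :=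
    hM.comp_continuous (continuous_subtype_val.comp continuous_projIcc) fun t => (projIcc 0 T hT.le t).2
  have hNb : ∀ t, |N t| ≤ C := fun t => hC _ (projIcc 0 T hT.le t).2
  have hNM : ∀ t ∈ Icc 0 T, N t = M t := fun t ht => by
    simp only [hN, projIcc_of_mem hT.le ht]
  -- The derivative of the time cutoff is an approximate Dirac mass at `0` minus one at `T`; the
  -- second is reduced to the first by `t ↦ T - t`.
  have hA : Tendsto (fun δ => ∫ q in Ω ×ˢ Ioo 0 T, u q.1 q.2 * φ q * deriv (timeCutoff T δ) q.2)
      (𝓝[>] 0) (𝓝 (N 0 - N T)) := by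
    have h1 := tendsto_integral_mul_stepDeriv hNc hNb
    have h2 := tendsto_integral_mul_stepDeriv (N := fun s => N (T - s)) (by fun_prop)
      (fun t => hNb _)
    rw [sub_zero] at h2
    refine (h1.sub h2).congr' ?_
    filter_upwards [Ioo_mem_nhdsGT (show 0 < T / 4 by linarith)] with δ hδ
    have hd : Continuous (deriv (timeCutoff T δ)) :=
      (contDiff_timeCutoff T δ).continuous_deriv (by exact_mod_cast le_top)
    have hs : tsupport (deriv (timeCutoff T δ)) ⊆ Ioo 0 T :=
      tsupport_deriv_subset.trans (tsupport_timeCutoff hδ.1)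
    have hint : IntegrableOn (fun q : Plane × ℝ => u q.1 q.2 * φ q * deriv (timeCutoff T δ) q.2)
        (Ω ×ˢ Ioo 0 T) :=
      integrableOn_mul_time hΩ (hu.continuousOn.mul hφ.continuous.continuousOn) hd hs
    rw [setIntegral_prod_time hint]
    have e1 : ∫ t in Ioo 0 T, ∫ x in Ω, u x t * φ (x, t) * deriv (timeCutoff T δ) t
        = ∫ t, N t * deriv (timeCutoff T δ) t := by
      have h3 : ∫ t in Ioo 0 T, N t * deriv (timeCutoff T δ) t
          = ∫ t, N t * deriv (timeCutoff T δ) t :=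
        setIntegral_eq_integral_of_forall_compl_eq_zero fun t ht => by
          rw [image_eq_zero_of_notMem_tsupport fun h => ht (hs h), mul_zero]
      rw [← h3]
      refine setIntegral_congr_fun measurableSet_Ioo fun t ht => ?_
      rw [hNM t (Ioo_subset_Icc_self ht), integral_mul_const]
    have e2 : ∫ t, N t * (stepDeriv ((T - t) / δ) / δ)
        = ∫ s, N (T - s) * (stepDeriv (s / δ) / δ) := by
      rw [← integral_sub_left_eq_self (fun s => N (T - s) * (stepDeriv (s / δ) / δ)) volume T]
      simp only [sub_sub_cancel]
    have i2 : Integrable fun t => N t * (stepDeriv ((T - t) / δ) / δ) := by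
      have := (integrable_mul_stepDeriv (N := fun s => N (T - s)) (by fun_prop) hδ.1).comp_sub_left T
      simpa only [sub_sub_cancel] using this
    rw [e1, ← e2, ← integral_sub (integrable_mul_stepDeriv hNc hδ.1) i2]
    congr 1
    ext t
    rw [deriv_timeCutoff hδ.1 (by linarith [hδ.2])]
    ring
  rw [hNM 0 (left_mem_Icc.2 hT.le), hNM T (right_mem_Icc.2 hT.le), hM0, zero_sub] at hA
  have hB : Tendsto (fun δ => ∫ t in Ioo 0 T, timeCutoff T δ t *
      ∫ x, (fderiv ℝ φ (x, t) (outwardNormal Ω x, 0) * u x t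
          - normalDeriv Ω u x t * φ (x, t)) ∂(boundaryMeasure Ω)) (𝓝[>] 0)
      (𝓝 (∫ t in Ioo 0 T, ∫ x, (fderiv ℝ φ (x, t) (outwardNormal Ω x, 0) * u x t
          - normalDeriv Ω u x t * φ (x, t)) ∂(boundaryMeasure Ω))) := by
    have hi := (hu.integrable_boundary_flux hΩ hφ).integral_prod_right
    refine tendsto_integral_filter_of_dominated_convergence _ ?_ ?_ hi.norm ?_
    · exact Eventually.of_forall fun δ =>
        (contDiff_timeCutoff T δ).continuous.aestronglyMeasurable.mul hi.aestronglyMeasurable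
    · refine Eventually.of_forall fun δ => Eventually.of_forall fun t => ?_
      rw [norm_mul, Real.norm_of_nonneg (timeCutoff_mem_Icc T δ t).1]
      exact mul_le_of_le_one_left (norm_nonneg _) (timeCutoff_mem_Icc T δ t).2
    · filter_upwards [ae_restrict_mem measurableSet_Ioo] with t ht
      refine tendsto_const_nhds.congr' ?_
      filter_upwards [eventually_timeCutoff_eq_one ht] with δ hδ
      rw [hδ, one_mul]
  have hfφ : IntegrableOn (fun q => f q * φ q) (Ω ×ˢ Ioo 0 T) := by
    obtain ⟨C, hC⟩ := (hΩ.isCompact_closure.prod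
      (isCompact_Icc (a := 0) (b := T))).exists_bound_of_continuousOn hφ.continuous.continuousOn
    refine Integrable.mul_bdd (c := C) hf hφ.continuous.aestronglyMeasurable ?_
    filter_upwards [ae_restrict_mem hm] with q hq
    exact hC q ⟨subset_closure hq.1, Ioo_subset_Icc_self hq.2⟩
  have hD : Tendsto (fun δ => ∫ q in Ω ×ˢ Ioo 0 T, f q * φ q * timeCutoff T δ q.2) (𝓝[>] 0)
      (𝓝 (∫ q in Ω ×ˢ Ioo 0 T, f q * φ q)) := by
    refine tendsto_integral_filter_of_dominated_convergence _ ?_ ?_ hfφ.norm ?_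
    · exact Eventually.of_forall fun δ => hfφ.aestronglyMeasurable.mul
        ((contDiff_timeCutoff T δ).continuous.comp continuous_snd).aestronglyMeasurable
    · refine Eventually.of_forall fun δ => Eventually.of_forall fun q => ?_
      rw [norm_mul, Real.norm_of_nonneg (timeCutoff_mem_Icc T δ q.2).1]
      exact mul_le_of_le_one_right (norm_nonneg _) (timeCutoff_mem_Icc T δ q.2).2
    · filter_upwards [ae_restrict_mem hm] with q hq
      refine tendsto_const_nhds.congr' ?_
      filter_upwards [eventually_timeCutoff_eq_one hq.2] with δ hδ
      rw [hδ, mul_one]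
  have hz := tendsto_nhds_unique (((hA.sub hB).add hD).congr' (by
    filter_upwards [self_mem_nhdsWithin] with δ hδ
    exact hu.green_time_cutoff hΩ hf hφ hφe (contDiff_timeCutoff T δ) (tsupport_timeCutoff hδ)))
    tendsto_const_nhds
  change _ = _ - M T
  linarith

end

/-! ### Exponential solutions of the backward heat equation -/

/-- The real exponential waves `Re (a e^{ℓ q})`. -/
noncomputable def reWave (ℓ : Plane × ℝ →L[ℝ] ℂ) (a : ℂ) (q : Plane × ℝ) : ℝ :=
  (a * Complex.exp (ℓ q)).re

theorem contDiff_reWave (ℓ : Plane × ℝ →L[ℝ] ℂ) (a : ℂ) : ContDiff ℝ (⊤ : ℕ∞) (reWave ℓ a) :=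
  Complex.reCLM.contDiff.comp (contDiff_const.mul (Complex.contDiff_exp.comp ℓ.contDiff))

theorem fderiv_reWave (ℓ : Plane × ℝ →L[ℝ] ℂ) (a : ℂ) (q w : Plane × ℝ) :
    fderiv ℝ (reWave ℓ a) q w = reWave ℓ (a * ℓ w) q := by
  have h : HasFDerivAt (reWave ℓ a) (Complex.reCLM.comp (a • (Complex.exp (ℓ q) • ℓ))) q :=
    Complex.reCLM.hasFDerivAt.comp q ((ℓ.hasFDerivAt.cexp).const_mul a)
  rw [h.fderiv]
  simp only [reWave, ContinuousLinearMap.comp_apply, smul_apply, smul_eq_mul,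
    Complex.reCLM_apply]
  congr 1
  ring

/-- Differentiation in direction `w` multiplies the amplitude by `ℓ w`, so the equation becomes the
algebraic relation on `ℓ`. -/
theorem backward_heat_reWave {ℓ : Plane × ℝ →L[ℝ] ℂ} (hℓ : ℓ (0, 1) + ∑ i, ℓ (stdVec i, 0) ^ 2 = 0)
    (a : ℂ) (q : Plane × ℝ) : fderiv ℝ (reWave ℓ a) q (0, 1) +
      ∑ i, fderiv ℝ (fun q => fderiv ℝ (reWave ℓ a) q (stdVec i, 0)) q (stdVec i, 0) = 0 := by
  have h : ∀ w : Plane × ℝ, (fun q => fderiv ℝ (reWave ℓ a) q w) = reWave ℓ (a * ℓ w) :=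
    fun w => funext fun q => fderiv_reWave ℓ a q w
  simp only [h]
  simp only [fderiv_reWave, reWave]
  rw [← Complex.re_sum, ← Complex.add_re]
  have : a * ℓ (0, 1) * Complex.exp (ℓ q) +
      ∑ i, a * ℓ (stdVec i, 0) * ℓ (stdVec i, 0) * Complex.exp (ℓ q)
      = a * Complex.exp (ℓ q) * (ℓ (0, 1) + ∑ i, ℓ (stdVec i, 0) ^ 2) := by
    rw [mul_add, Finset.mul_sum]
    congr 1
    · ring
    · exact Finset.sum_congr rfl fun i _ => by ring
  rw [this, hℓ, mul_zero, Complex.zero_re]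

/-- Green's formula is proved for real test functions. The amplitudes `a = 1` and `a = -i` recover
real and imaginary parts, hence the complex formula. -/
theorem integrable_of_forall_re_mul {α : Type*} [MeasurableSpace α] {μ : Measure α} {F : α → ℂ}
    (h : ∀ a : ℂ, Integrable (fun x => (a * F x).re) μ) : Integrable F μ := by
  rw [← Integrable.re_im_iff]
  constructor
  · simpa using h 1
  · simpa using h (-Complex.I)

theorem re_mul_integral {α : Type*} [MeasurableSpace α] {μ : Measure α} {F : α → ℂ}
    (h : Integrable F μ) (a : ℂ) : (a * ∫ x, F x ∂μ).re = ∫ x, (a * F x).re ∂μ := by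
  rw [← integral_const_mul]
  exact (integral_re (𝕜 := ℂ) (h.const_mul a)).symm

section

variable {Ω : Set Plane} {T : ℝ} {f : Plane × ℝ → ℝ} {u : Plane → ℝ → ℝ}

/-- **Green's formula** for the complex exponential solutions of the backward heat equation. -/
theorem IsHeatSolution.green_exp (hΩ : IsSmoothBoundedDomain Ω) (hT : 0 < T)
    (hu : IsHeatSolution Ω T f u) (hf : IntegrableOn f (Ω ×ˢ Ioo 0 T)) {ℓ : Plane × ℝ →L[ℝ] ℂ}
    (hℓ : ℓ (0, 1) + ∑ i, ℓ (stdVec i, 0) ^ 2 = 0) :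
    ∫ t in Ioo 0 T, ∫ x, (ℓ (outwardNormal Ω x, 0) * Complex.exp (ℓ (x, t)) * (u x t : ℂ)
          - (normalDeriv Ω u x t : ℂ) * Complex.exp (ℓ (x, t))) ∂(boundaryMeasure Ω)
      = (∫ q in Ω ×ˢ Ioo 0 T, (f q : ℂ) * Complex.exp (ℓ q))
        - ∫ x in Ω, (u x T : ℂ) * Complex.exp (ℓ (x, T)) := by
  have := hΩ.isFiniteMeasure_boundaryMeasure
  have hm : MeasurableSet (Ω ×ˢ Ioo 0 T) := (hΩ.isOpen.prod isOpen_Ioo).measurableSet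
  set F : Plane × ℝ → ℂ := fun q => ℓ (outwardNormal Ω q.1, 0) * Complex.exp (ℓ q) * (u q.1 q.2 : ℂ)
          - (normalDeriv Ω u q.1 q.2 : ℂ) * Complex.exp (ℓ q) with hF
  have hFa : ∀ (a : ℂ) q, (a * F q).re = fderiv ℝ (reWave ℓ a) q (outwardNormal Ω q.1, 0) * u q.1 q.2
      - normalDeriv Ω u q.1 q.2 * reWave ℓ a q := by
    intro a q
    have : a * F q = a * ℓ (outwardNormal Ω q.1, 0) * Complex.exp (ℓ q) * (u q.1 q.2 : ℂ)
        - (normalDeriv Ω u q.1 q.2 : ℂ) * (a * Complex.exp (ℓ q)) := by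
      simp only [hF]
      ring
    rw [this, fderiv_reWave, Complex.sub_re, Complex.re_mul_ofReal, Complex.re_ofReal_mul]
    rfl
  have hFr : ∀ a : ℂ, Integrable (fun q => (a * F q).re)
      ((boundaryMeasure Ω).prod ((volume : Measure ℝ).restrict (Ioo 0 T))) := fun a =>
    (hu.integrable_boundary_flux hΩ (contDiff_reWave ℓ a)).congr
      (Eventually.of_forall fun q => (hFa a q).symm)
  have hFi := integrable_of_forall_re_mul hFr
  have hS : ∀ a : ℂ, ∀ q, (a * ((f q : ℂ) * Complex.exp (ℓ q))).re = f q * reWave ℓ a q := fun a q => by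
    rw [mul_left_comm, Complex.re_ofReal_mul]
    rfl
  have hSi : IntegrableOn (fun q => (f q : ℂ) * Complex.exp (ℓ q)) (Ω ×ˢ Ioo 0 T) := by
    refine integrable_of_forall_re_mul fun a => ?_
    simp only [hS]
    have hc := (contDiff_reWave ℓ a).continuous
    obtain ⟨C, hC⟩ := (hΩ.isCompact_closure.prod
      (isCompact_Icc (a := 0) (b := T))).exists_bound_of_continuousOn hc.continuousOn
    refine Integrable.mul_bdd (c := C) hf hc.aestronglyMeasurable ?_
    filter_upwards [ae_restrict_mem hm] with q hq
    exact hC q ⟨subset_closure hq.1, Ioo_subset_Icc_self hq.2⟩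
  have hR : ∀ a : ℂ, ∀ x, (a * ((u x T : ℂ) * Complex.exp (ℓ (x, T)))).re
      = u x T * reWave ℓ a (x, T) := fun a x => by
    rw [mul_left_comm, Complex.re_ofReal_mul]
    rfl
  have hRi : IntegrableOn (fun x => (u x T : ℂ) * Complex.exp (ℓ (x, T))) Ω := by
    refine integrable_of_forall_re_mul fun a => ?_
    simp only [hR]
    exact hu.integrableOn_mul hΩ (right_mem_Icc.2 hT.le)
      ((contDiff_reWave ℓ a).continuous.comp (by fun_prop))
  have key : ∀ a : ℂ, (a * ∫ t in Ioo 0 T, ∫ x, F (x, t) ∂(boundaryMeasure Ω)).re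
      = (a * ((∫ q in Ω ×ˢ Ioo 0 T, (f q : ℂ) * Complex.exp (ℓ q))
        - ∫ x in Ω, (u x T : ℂ) * Complex.exp (ℓ (x, T)))).re := by
    intro a
    have hg := hu.green hΩ hT hf (contDiff_reWave ℓ a) (backward_heat_reWave hℓ a)
    rw [← integral_prod_symm F hFi, re_mul_integral hFi, integral_prod_symm _ (hFr a), mul_sub,
      Complex.sub_re, re_mul_integral hSi, re_mul_integral hRi]
    simp only [hFa, hS, hR]
    exact hg
  refine Complex.ext ?_ ?_
  · simpa using key 1
  · simpa using key (-Complex.I)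

end

/-- The exponent of `expWave` as a real linear map. -/
noncomputable def waveExponent (ω ωp : Plane) (c κ τ : ℝ) : Plane × ℝ →L[ℝ] ℂ :=
  (τ : ℂ) • (Complex.ofRealCLM.comp (c • (innerSL ℝ ω).comp (ContinuousLinearMap.fst ℝ Plane ℝ)
      - ContinuousLinearMap.snd ℝ Plane ℝ)
    + Complex.I • Complex.ofRealCLM.comp
      (κ • (innerSL ℝ ωp).comp (ContinuousLinearMap.fst ℝ Plane ℝ)))

theorem waveExponent_apply (ω ωp : Plane) (c κ τ : ℝ) (q : Plane × ℝ) :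
    waveExponent ω ωp c κ τ q
      = τ * ((-q.2 + c * inner ℝ q.1 ω : ℝ) + (κ * inner ℝ q.1 ωp : ℝ) * Complex.I) := by
  simp only [waveExponent, smul_apply, add_apply,
    ContinuousLinearMap.comp_apply, sub_apply, Complex.ofRealCLM_apply,
    innerSL_apply_apply, ContinuousLinearMap.coe_fst', ContinuousLinearMap.coe_snd', smul_eq_mul,
    real_inner_comm q.1]
  push_cast
  ring

theorem exp_waveExponent (ω ωp : Plane) (c κ τ : ℝ) (q : Plane × ℝ) :
    Complex.exp (waveExponent ω ωp c κ τ q) = expWave ω ωp c κ τ q := by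
  rw [waveExponent_apply, expWave]

/-- The imaginary frequency of `vSol`, divided by `τ`. -/
noncomputable def waveFreq (c τ : ℝ) : ℝ := c * Real.sqrt (1 - 1 / (c ^ 2 * τ))

theorem tendsto_waveFreq (c : ℝ) (hc : 0 < c) : Tendsto (waveFreq c) atTop (𝓝 c) := by
  have h1 : Tendsto (fun τ : ℝ => 1 / (c ^ 2 * τ)) atTop (𝓝 0) :=
    tendsto_const_nhds.div_atTop (tendsto_id.const_mul_atTop (by positivity))
  have h2 := ((tendsto_const_nhds (x := (1 : ℝ))).sub h1).sqrt.const_mul c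
  rw [sub_zero, Real.sqrt_one, mul_one] at h2
  exact h2

/-- The lower bound on `τ` keeps the radicand positive. The relation makes `z · z = τ² (c² - κ²) =
τ`, so that time and space enter the exponent at the same scale `τ`. -/
theorem sq_waveFreq {c τ : ℝ} (hc : 0 < c) (hτ : (c ^ 2)⁻¹ < τ) :
    waveFreq c τ ^ 2 = c ^ 2 - 1 / τ := by
  have hτ0 : 0 < τ := lt_trans (by positivity) hτ
  have h : 0 ≤ 1 - 1 / (c ^ 2 * τ) := by
    rw [sub_nonneg, div_le_one (by positivity)]
    have := (inv_lt_iff_one_lt_mul₀ (by positivity)).1 hτ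
    linarith
  rw [waveFreq, mul_pow, Real.sq_sqrt h]
  field_simp

section

variable {ω ωp : Plane}

theorem sum_sq_freq (hω : ‖ω‖ = 1) (hωp : ‖ωp‖ = 1) (horth : inner ℝ ω ωp = 0)
    (a b : ℝ) :
    ∑ i, ((a : ℂ) * (ω i : ℂ) + (b : ℂ) * Complex.I * (ωp i : ℂ)) ^ 2 = (a ^ 2 - b ^ 2 : ℝ) := by
  have h1 : ω 0 ^ 2 + ω 1 ^ 2 = 1 := by
    have := EuclideanSpace.real_norm_sq_eq ω
    rw [hω, Fin.sum_univ_two] at this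
    linarith
  have h2 : ωp 0 ^ 2 + ωp 1 ^ 2 = 1 := by
    have := EuclideanSpace.real_norm_sq_eq ωp
    rw [hωp, Fin.sum_univ_two] at this
    linarith
  have h3 : ω 0 * ωp 0 + ω 1 * ωp 1 = 0 := by
    rw [← horth, PiLp.inner_apply, Fin.sum_univ_two]
    simp [mul_comm]
  have h1' : (ω 0 : ℂ) ^ 2 + (ω 1 : ℂ) ^ 2 = 1 := by
    simpa using congrArg (fun r : ℝ => (r : ℂ)) h1
  have h2' : (ωp 0 : ℂ) ^ 2 + (ωp 1 : ℂ) ^ 2 = 1 := by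
    simpa using congrArg (fun r : ℝ => (r : ℂ)) h2
  have h3' : (ω 0 : ℂ) * ωp 0 + (ω 1 : ℂ) * ωp 1 = 0 := by
    simpa using congrArg (fun r : ℝ => (r : ℂ)) h3
  rw [Fin.sum_univ_two]
  push_cast
  linear_combination (a : ℂ) ^ 2 * h1' - (b : ℂ) ^ 2 * h2' + 2 * a * b * Complex.I * h3'
    + (b : ℂ) ^ 2 * ((ωp 0 : ℂ) ^ 2 + (ωp 1 : ℂ) ^ 2) * Complex.I_sq

theorem waveExponent_backward_heat (hω : ‖ω‖ = 1) (hωp : ‖ωp‖ = 1) (horth : inner ℝ ω ωp = 0)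
    {c τ : ℝ} (hc : 0 < c) (hτ : (c ^ 2)⁻¹ < τ) :
    waveExponent ω ωp c (waveFreq c τ) τ (0, 1)
      + ∑ i, waveExponent ω ωp c (waveFreq c τ) τ (stdVec i, 0) ^ 2 = 0 := by
  have hτ0 : 0 < τ := lt_trans (by positivity) hτ
  have h1 : ∀ i, waveExponent ω ωp c (waveFreq c τ) τ (stdVec i, 0)
      = ((τ * c : ℝ) : ℂ) * (ω i : ℂ) + ((τ * waveFreq c τ : ℝ) : ℂ) * Complex.I * (ωp i : ℂ) := by
    intro i
    have h : ∀ w : Plane, inner ℝ (stdVec i) w = w i := fun w => by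
      simp [stdVec, EuclideanSpace.inner_single_left]
    rw [waveExponent_apply]
    simp only [h]
    push_cast
    ring
  simp only [h1]
  rw [sum_sq_freq hω hωp horth, waveExponent_apply, mul_pow, mul_pow, sq_waveFreq hc hτ]
  have hτC : (τ : ℂ) ≠ 0 := by exact_mod_cast hτ0.ne'
  simp only [inner_zero_left, mul_zero, add_zero, Complex.ofReal_zero, zero_mul]
  push_cast
  field_simp
  ring

theorem vSol_eq_exp (hω : ‖ω‖ = 1) (hωp : ‖ωp‖ = 1) (horth : inner ℝ ω ωp = 0)
    {c τ : ℝ} (hc : 0 < c) (hτ : (c ^ 2)⁻¹ < τ) (x : Plane) (t : ℝ) :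
    vSol ω ωp c τ x t = Complex.exp (waveExponent ω ωp c (waveFreq c τ) τ (x, t)) := by
  have hτ0 : 0 < τ := lt_trans (by positivity) hτ
  have hz : ∀ k, zVec ω ωp c τ k
      = ((τ * c : ℝ) : ℂ) * (ω k : ℂ) + ((τ * waveFreq c τ : ℝ) : ℂ) * Complex.I * (ωp k : ℂ) := by
    intro k
    simp only [zVec, waveFreq]
    push_cast
    ring
  have hs : ∑ k, zVec ω ωp c τ k * zVec ω ωp c τ k = (τ : ℂ) := by
    simp only [hz, ← pow_two]
    rw [sum_sq_freq hω hωp horth, mul_pow, mul_pow, sq_waveFreq hc hτ]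
    norm_cast
    field_simp
    ring
  have hi : ∀ w : Plane, inner ℝ x w = x 0 * w 0 + x 1 * w 1 := fun w => by
    rw [PiLp.inner_apply, Fin.sum_univ_two]
    simp [mul_comm]
  rw [vSol, hs, waveExponent_apply, hi, hi]
  simp only [hz, Fin.sum_univ_two]
  congr 1
  push_cast
  ring

/-- The indicator function in terms of the source and the final value of the solution. -/
theorem indicatorFun_zero_eq (hω : ‖ω‖ = 1) (hωp : ‖ωp‖ = 1) (horth : inner ℝ ω ωp = 0)
    {Ω : Set Plane} {T : ℝ} {f : Plane × ℝ → ℝ} {u : Plane → ℝ → ℝ}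
    (hΩ : IsSmoothBoundedDomain Ω) (hT : 0 < T)
    (hu : IsHeatSolution Ω T f u) (hf : IntegrableOn f (Ω ×ˢ Ioo 0 T)) {c τ : ℝ} (hc : 0 < c)
    (hτ : (c ^ 2)⁻¹ < τ) :
    indicatorFun Ω T u ω ωp c τ 0
      = (∫ q in Ω ×ˢ Ioo 0 T, (f q : ℂ) * expWave ω ωp c (waveFreq c τ) τ q)
        - ∫ x in Ω, (u x T : ℂ) * expWave ω ωp c (waveFreq c τ) τ (x, T) := by
  set ℓ := waveExponent ω ωp c (waveFreq c τ) τ with hℓ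
  have hv : ∀ x t, vSol ω ωp c τ x t = Complex.exp (ℓ (x, t)) := vSol_eq_exp hω hωp horth hc hτ
  have hd : ∀ x n t, fderiv ℝ (fun y => vSol ω ωp c τ y t) x n
      = ℓ (n, 0) * Complex.exp (ℓ (x, t)) := by
    intro x n t
    have h : HasFDerivAt (fun y => Complex.exp (ℓ (y, t)))
        (Complex.exp (ℓ (x, t)) • ℓ.comp (ContinuousLinearMap.inl ℝ Plane ℝ)) x :=
      (ℓ.hasFDerivAt.comp x (hasFDerivAt_prodMk_left (𝕜 := ℝ) x t)).cexp
    simp only [hv]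
    rw [h.fderiv]
    simp [mul_comm]
  have hg := hu.green_exp hΩ hT hf (waveExponent_backward_heat hω hωp horth hc hτ)
  rw [indicatorFun, mul_zero, Real.exp_zero, Complex.ofReal_one, one_mul,
    intervalIntegral.integral_of_le hT.le, integral_Ioc_eq_integral_Ioo]
  simp only [hd]
  simp only [hv, ← exp_waveExponent]
  exact hg

end

theorem norm_indicatorFun (Ω : Set Plane) (T : ℝ) (u : Plane → ℝ → ℝ) (ω ωp : Plane) (c τ s : ℝ) :
    ‖indicatorFun Ω T u ω ωp c τ s‖ = Real.exp (τ * s) * ‖indicatorFun Ω T u ω ωp c τ 0‖ := by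
  simp only [indicatorFun, norm_mul, mul_zero, Real.exp_zero, Complex.ofReal_one, one_mul]
  rw [Complex.norm_real, Real.norm_of_nonneg (Real.exp_pos _).le]

/-! ### Asymptotics of the indicator function -/

/-- The hypothesis says that `y` behaves like `L τ⁻³ e^{τH}`. The power is invisible to the
logarithmic rate and to exponential growth, and decides only the borderline case `H + s = 0`. -/
theorem asymptotics_of_tendsto {y : ℝ → ℝ} {H L : ℝ} (hL : 0 < L)
    (h : Tendsto (fun τ : ℝ => τ ^ 3 * Real.exp (-(τ * H)) * y τ) atTop (𝓝 L)) :
    (∀ᶠ τ in atTop, y τ ≠ 0) ∧ Tendsto (fun τ : ℝ => Real.log (y τ) / τ) atTop (𝓝 H) ∧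
    ∀ s : ℝ, (H + s ≤ 0 → Tendsto (fun τ : ℝ => Real.exp (τ * s) * y τ) atTop (𝓝 0)) ∧
      (0 < H + s → Tendsto (fun τ : ℝ => Real.exp (τ * s) * y τ) atTop atTop) := by
  have h0 : ∀ᶠ τ in atTop, y τ ≠ 0 := by
    filter_upwards [h.eventually_ne hL.ne'] with τ hτ
    exact right_ne_zero_of_mul hτ
  have hexp : ∀ s τ : ℝ, τ ≠ 0 → Real.exp (τ * s) * y τ
      = τ ^ 3 * Real.exp (-(τ * H)) * y τ * (Real.exp ((H + s) * τ) / τ ^ (3 : ℝ)) := by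
    intro s τ hτ
    have e : Real.exp (τ * s) = Real.exp (-(τ * H)) * Real.exp ((H + s) * τ) := by
      rw [← Real.exp_add]
      ring_nf
    have e3 : τ ^ (3 : ℝ) = τ ^ 3 := by exact_mod_cast Real.rpow_natCast τ 3
    rw [e, e3]
    field_simp
  refine ⟨h0, ?_, fun s => ⟨fun hs => ?_, fun hs => ?_⟩⟩
  · have h1 : Tendsto (fun τ : ℝ => Real.log (τ ^ 3 * Real.exp (-(τ * H)) * y τ) * τ⁻¹
        - 3 * (Real.log τ / τ) + H) atTop (𝓝 (Real.log L * 0 - 3 * 0 + H)) :=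
      (((h.log hL.ne').mul tendsto_inv_atTop_zero).sub
        (Real.isLittleO_log_id_atTop.tendsto_div_nhds_zero.const_mul 3)).add_const H
    simp only [mul_zero, sub_zero, zero_add] at h1
    refine h1.congr' ?_
    filter_upwards [h0, eventually_gt_atTop 0] with τ hy hτ
    rw [Real.log_mul (by positivity) hy, Real.log_mul (by positivity) (by positivity), Real.log_pow,
      Real.log_exp]
    push_cast
    field_simp
    ring
  · have h1 : Tendsto (fun τ : ℝ => Real.exp ((H + s) * τ) / τ ^ (3 : ℝ)) atTop (𝓝 0) := by
      have h2 : Tendsto (fun τ : ℝ => (τ ^ (3 : ℝ))⁻¹) atTop (𝓝 0) :=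
        tendsto_inv_atTop_zero.comp (tendsto_rpow_atTop (by norm_num))
      refine squeeze_zero' ?_ ?_ h2
      · filter_upwards [eventually_gt_atTop 0] with τ hτ
        positivity
      · filter_upwards [eventually_gt_atTop 0] with τ hτ
        rw [div_eq_mul_inv]
        refine mul_le_of_le_one_left (by positivity) (Real.exp_le_one_iff.2 ?_)
        exact mul_nonpos_of_nonpos_of_nonneg hs hτ.le
    have h2 := h.mul h1
    rw [mul_zero] at h2
    refine h2.congr' ?_
    filter_upwards [eventually_ne_atTop 0] with τ hτ using (hexp s τ hτ).symm
  · refine (h.pos_mul_atTop hL (tendsto_exp_mul_div_rpow_atTop 3 (H + s) hs)).congr' ?_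
    filter_upwards [eventually_ne_atTop 0] with τ hτ using (hexp s τ hτ).symm

theorem norm_setIntegral_mul_le {α : Type*} [MeasurableSpace α] {μ : Measure α} {S : Set α}
    (hS : MeasurableSet S) {F : α → ℝ} (hF : IntegrableOn F S μ) {E : α → ℂ} {C : ℝ}
    (hE : ∀ x ∈ S, ‖E x‖ ≤ C) : ‖∫ x in S, (F x : ℂ) * E x ∂μ‖ ≤ C * ∫ x in S, |F x| ∂μ := by
  rw [← integral_const_mul]
  refine norm_integral_le_of_norm_le (hF.abs.const_mul C) ?_
  filter_upwards [ae_restrict_mem hS] with x hx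
  rw [norm_mul, Complex.norm_real, Real.norm_eq_abs, mul_comm]
  exact mul_le_mul_of_nonneg_right (hE x hx) (abs_nonneg _)

/-- An exponential gap `H - M` absorbs the factor `τ ^ 3`. This disposes of the final-time term and
of all cylinders but one. -/
theorem tendsto_pow_mul_of_le_exp {H M C : ℝ} (hMH : M < H) {E J : ℝ → ℂ}
    (hE : ∀ τ, ‖E τ‖ = Real.exp (τ * H)) (hJ : ∀ τ, 0 ≤ τ → ‖J τ‖ ≤ Real.exp (τ * M) * C) :
    Tendsto (fun τ : ℝ => ((τ ^ 3 : ℝ) : ℂ) * ((E τ)⁻¹ * J τ)) atTop (𝓝 0) := by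
  have h1 := (tendsto_rpow_mul_exp_neg_mul_atTop_nhds_zero 3 (H - M) (sub_pos.2 hMH)).mul_const C
  rw [zero_mul] at h1
  refine squeeze_zero_norm' ?_ h1
  filter_upwards [eventually_ge_atTop 0] with τ hτ
  have e3 : τ ^ (3 : ℝ) = τ ^ 3 := by exact_mod_cast Real.rpow_natCast τ 3
  have e : Real.exp (-(H - M) * τ) = (Real.exp (τ * H))⁻¹ * Real.exp (τ * M) := by
    rw [← Real.exp_neg, ← Real.exp_add]
    ring_nf
  rw [norm_mul, norm_mul, norm_inv, hE, Complex.norm_real, Real.norm_of_nonneg (by positivity), e3,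
    e, mul_assoc, mul_assoc]
  gcongr
  exact hJ τ hτ

/-! ### The source and the support plane of `D` -/

theorem prod_time_ae_eq (P : Set Plane) {a b : ℝ} {S : Set ℝ} (h1 : Ioo a b ⊆ S)
    (h2 : S ⊆ Icc a b) : (P ×ˢ S : Set (Plane × ℝ)) =ᵐ[volume] (P ×ˢ Ioo a b : Set (Plane × ℝ)) := by
  refine Measure.set_prod_ae_eq (ae_eq_refl _) ?_
  refine (LE.le.eventuallyLE h2).trans Ioo_ae_eq_Icc.symm.le |>.antisymm
    (LE.le.eventuallyLE h1)

/-- The set made of `p` and the open half-plane below it is convex, so the maximum stays strict on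
the convex hull, and a strict maximum point is extreme. This makes the nonvanishing assumption on
the density available at `p`. -/
theorem mem_hullVertices {P : Set Plane} {p ω : Plane} (hp : p ∈ closure P)
    (hmax : ∀ x ∈ closure P, x ≠ p → inner ℝ x ω < inner ℝ p ω) : p ∈ hullVertices P := by
  have hsub : convexHull ℝ (closure P) ⊆ {x | x = p ∨ inner ℝ x ω < inner ℝ p ω} := by
    refine convexHull_min (fun x hx => or_iff_not_imp_left.2 (hmax x hx)) ?_
    rw [convex_iff_forall_pos]
    rintro x hx y hy a b ha hb hab
    have hxy : inner ℝ (a • x + b • y) ω = a * inner ℝ x ω + b * inner ℝ y ω := by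
      rw [inner_add_left, real_inner_smul_left, real_inner_smul_left]
    have hb' : b = 1 - a := by linarith
    rcases hx with rfl | hx <;> rcases hy with rfl | hy
    · left
      rw [← add_smul, hab, one_smul]
    · right
      rw [hxy, hb']
      nlinarith
    · right
      rw [hxy, hb']
      nlinarith
    · right
      rw [hxy, hb']
      nlinarith
  refine mem_extremePoints.2 ⟨subset_convexHull ℝ _ hp, ?_⟩
  rintro x hx y hy ⟨a, b, ha, hb, hab, e⟩
  have hxy : inner ℝ p ω = a * inner ℝ x ω + b * inner ℝ y ω := by
    rw [← e, inner_add_left, real_inner_smul_left, real_inner_smul_left]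
  have hb' : b = 1 - a := by linarith
  rw [hb'] at hxy
  rcases hsub hx with h | h <;> rcases hsub hy with h' | h'
  · exact ⟨h, h'⟩
  · rw [h] at hxy
    nlinarith
  · rw [h'] at hxy
    nlinarith
  · nlinarith

/-- Identifies the exponent of the wave, divided by `τ`, with a multiple of the functional that
defines the support function. -/
theorem stDot_omegaC (q : Plane × ℝ) (ω : Plane) (c : ℝ) :
    Real.sqrt (c ^ 2 + 1) * stDot q (omegaC ω c) = -q.2 + c * inner ℝ q.1 ω := by
  have : Real.sqrt (c ^ 2 + 1) ≠ 0 := (Real.sqrt_pos.2 (by positivity)).ne'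
  simp only [stDot, omegaC, Prod.smul_fst, Prod.smul_snd, real_inner_smul_right, smul_eq_mul]
  field_simp
  ring

theorem continuous_stDot (r : Plane × ℝ) : Continuous fun q => stDot q r := by
  unfold stDot
  fun_prop

section

variable {Ω : Set Plane} {T : ℝ} {N : ℕ} {P : Fin N → Set Plane} {Tj : Fin N → ℝ}
  {ρ : Fin N → Plane × ℝ → ℝ}

theorem IsPolygonInterior.isOpen {P : Set Plane} (h : IsPolygonInterior P) : IsOpen P := by
  obtain ⟨k, v, -, -, h, -⟩ := h
  exact h

theorem IsPolygonInterior.isBounded {P : Set Plane} (h : IsPolygonInterior P) :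
    Bornology.IsBounded P := by
  obtain ⟨k, v, -, -, -, -, h, -⟩ := h
  exact h

theorem IsPolygonInterior.isCompact_closure {P : Set Plane} (h : IsPolygonInterior P) :
    IsCompact (closure P) :=
  h.isBounded.isCompact_closure

theorem IsAdmissibleSource.subset_domain (hΩ : IsSmoothBoundedDomain Ω)
    (h : IsAdmissibleSource Ω T P Tj ρ) (j : Fin N) : P j ⊆ Ω :=
  (interior_maximal (h.subset j) (h.polygon j).isOpen).trans hΩ.interior_closure_subset

theorem IsAdmissibleSource.integrableOn (h : IsAdmissibleSource Ω T P Tj ρ) (j : Fin N) :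
    IntegrableOn (ρ j) (P j ×ˢ Ioo (Tj j) T) := by
  have : IsFiniteMeasure (volume.restrict (P j ×ˢ Ioo (Tj j) T)) := by
    rw [isFiniteMeasure_restrict]
    exact (((h.polygon j).isBounded.prod (Metric.isBounded_Ioo _ _)).measure_lt_top).ne
  exact (h.bounded j).integrable le_top

theorem IsAdmissibleSource.measurableSet (h : IsAdmissibleSource Ω T P Tj ρ) (j : Fin N) :
    MeasurableSet (P j ×ˢ Icc (Tj j) T) :=
  (h.polygon j).isOpen.measurableSet.prod measurableSet_Icc

theorem IsAdmissibleSource.integrableOn_Icc (h : IsAdmissibleSource Ω T P Tj ρ) (j : Fin N) :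
    IntegrableOn (ρ j) (P j ×ˢ Icc (Tj j) T) :=
  (h.integrableOn j).congr_set_ae (prod_time_ae_eq _ Ioo_subset_Icc_self subset_rfl)

theorem IsAdmissibleSource.integrable_source (h : IsAdmissibleSource Ω T P Tj ρ) :
    Integrable (source T P Tj ρ) :=
  integrable_finsetSum _ fun j _ =>
    (integrable_indicator_iff (h.measurableSet j)).2 (h.integrableOn_Icc j)

theorem IsAdmissibleSource.integral_source_mul (hΩ : IsSmoothBoundedDomain Ω)
    (h : IsAdmissibleSource Ω T P Tj ρ) {E : Plane × ℝ → ℂ} (hE : Continuous E) :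
    ∫ q in Ω ×ˢ Ioo 0 T, (source T P Tj ρ q : ℂ) * E q
      = ∑ j, ∫ q in P j ×ˢ Ioo (Tj j) T, (ρ j q : ℂ) * E q := by
  have e : ∀ q, (source T P Tj ρ q : ℂ) * E q
      = ∑ j, (P j ×ˢ Icc (Tj j) T).indicator (fun q => (ρ j q : ℂ) * E q) q := by
    intro q
    rw [source, Complex.ofReal_sum, Finset.sum_mul]
    refine Finset.sum_congr rfl fun j _ => ?_
    by_cases hq : q ∈ P j ×ˢ Icc (Tj j) T
    · rw [indicator_of_mem hq, indicator_of_mem hq]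
    · rw [indicator_of_notMem hq, indicator_of_notMem hq, Complex.ofReal_zero, zero_mul]
  have hi : ∀ j, IntegrableOn (fun q => (ρ j q : ℂ) * E q) (P j ×ˢ Icc (Tj j) T) := by
    intro j
    obtain ⟨C, hC⟩ := ((h.polygon j).isCompact_closure.prod
      (isCompact_Icc (a := Tj j) (b := T))).exists_bound_of_continuousOn hE.continuousOn
    refine Integrable.mul_bdd (c := C) (h.integrableOn_Icc j).ofReal hE.aestronglyMeasurable ?_
    filter_upwards [ae_restrict_mem (h.measurableSet j)] with q hq
    exact hC q ⟨subset_closure hq.1, hq.2⟩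
  simp only [e]
  rw [integral_finsetSum _ fun j _ =>
    ((integrable_indicator_iff (h.measurableSet j)).2 (hi j)).integrableOn]
  refine Finset.sum_congr rfl fun j _ => ?_
  rw [setIntegral_indicator (h.measurableSet j)]
  refine setIntegral_congr_set ?_
  rw [prod_inter_prod, inter_eq_right.2 (h.subset_domain hΩ j)]
  refine prod_time_ae_eq _ (fun t ht => ?_) inter_subset_right
  exact ⟨⟨(h.time_nonneg j).trans_lt ht.1, ht.2⟩, Ioo_subset_Icc_self ht⟩

theorem IsAdmissibleSource.isOpen_sourceSet (h : IsAdmissibleSource Ω T P Tj ρ) :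
    IsOpen (sourceSet T P Tj) :=
  isOpen_iUnion fun j => (h.polygon j).isOpen.prod isOpen_Ioo

theorem IsAdmissibleSource.closure_sourceSet (h : IsAdmissibleSource Ω T P Tj ρ) :
    closure (sourceSet T P Tj) = ⋃ j, closure (P j) ×ˢ Icc (Tj j) T := by
  rw [sourceSet, closure_iUnion_of_finite]
  refine iUnion_congr fun j => ?_
  rw [closure_prod_eq, closure_Ioo (h.time_lt j).ne]

theorem IsAdmissibleSource.bddAbove (h : IsAdmissibleSource Ω T P Tj ρ) (r : Plane × ℝ) :
    BddAbove ((fun q => stDot q r) '' sourceSet T P Tj) := by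
  have hc : IsCompact (closure (sourceSet T P Tj)) := by
    rw [h.closure_sourceSet]
    exact isCompact_iUnion fun j => (h.polygon j).isCompact_closure.prod isCompact_Icc
  exact (hc.image (continuous_stDot r)).bddAbove.mono (image_mono subset_closure)

theorem IsAdmissibleSource.stDot_le (h : IsAdmissibleSource Ω T P Tj ρ) (r : Plane × ℝ)
    {q : Plane × ℝ} (hq : q ∈ closure (sourceSet T P Tj)) :
    stDot q r ≤ supportFun (sourceSet T P Tj) r :=
  closure_minimal (t := {q | stDot q r ≤ supportFun (sourceSet T P Tj) r})
    (fun _ hq => le_csSup (h.bddAbove r) (mem_image_of_mem _ hq))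
    (isClosed_le (continuous_stDot r) continuous_const) hq

/-- In a regular direction the support plane touches `D` exactly at a vertex of the bottom of one of
the cylinders, all other cylinders being at a positive distance from it. -/
theorem IsAdmissibleSource.exists_peak (h : IsAdmissibleSource Ω T P Tj ρ) {ω : Plane} {c : ℝ}
    (hc : 0 < c) (hreg : IsRegularDir (sourceSet T P Tj) (omegaC ω c)) :
    ∃ j₀ p, p ∈ closure (P j₀) ∧
      (∀ x ∈ closure (P j₀), x ≠ p → inner ℝ x ω < inner ℝ p ω) ∧
      Real.sqrt (c ^ 2 + 1) * supportFun (sourceSet T P Tj) (omegaC ω c)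
        = -Tj j₀ + c * inner ℝ p ω ∧
      ∀ j, j ≠ j₀ → ∃ M < Real.sqrt (c ^ 2 + 1) * supportFun (sourceSet T P Tj) (omegaC ω c),
        ∀ q ∈ P j ×ˢ Ioo (Tj j) T, -q.2 + c * inner ℝ q.1 ω ≤ M := by
  set H := Real.sqrt (c ^ 2 + 1) * supportFun (sourceSet T P Tj) (omegaC ω c) with hH
  have hr : 0 < Real.sqrt (c ^ 2 + 1) := Real.sqrt_pos.2 (by positivity)
  have hle : ∀ q ∈ closure (sourceSet T P Tj), -q.2 + c * inner ℝ q.1 ω ≤ H := fun q hq => by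
    rw [← stDot_omegaC]
    exact mul_le_mul_of_nonneg_left (h.stDot_le _ hq) hr.le
  obtain ⟨⟨p, t₀⟩, ⟨hq, hqH⟩, huniq⟩ := hreg
  have hq0 : -t₀ + c * inner ℝ p ω = H := by
    rw [hH, ← hqH, stDot_omegaC]
  -- Regularity speaks of the frontier, but no point of the open set `D` reaches the supremum:
  -- moving slightly back in time within a cylinder would increase the functional.
  have huniq' : ∀ q ∈ closure (sourceSet T P Tj), -q.2 + c * inner ℝ q.1 ω = H → q = (p, t₀) := by
    intro q hq hqe
    refine huniq q ⟨?_, ?_⟩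
    · rw [h.isOpen_sourceSet.frontier_eq]
      refine ⟨hq, fun hqD => ?_⟩
      obtain ⟨j, hqj⟩ := mem_iUnion.1 hqD
      obtain ⟨t, ht1, ht2⟩ := exists_between hqj.2.1
      have := hle (q.1, t) (subset_closure (mem_iUnion.2 ⟨j, hqj.1, ht1, ht2.trans hqj.2.2⟩))
      simp only at this
      linarith
    · rw [← stDot_omegaC] at hqe
      exact mul_left_cancel₀ hr.ne' hqe
  have hcl := h.closure_sourceSet
  have hqc : (p, t₀) ∈ closure (sourceSet T P Tj) := frontier_subset_closure hq
  rw [hcl] at hqc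
  obtain ⟨j₀, hp, ht₀⟩ := mem_iUnion.1 hqc
  simp only at hp ht₀
  have hbot : ∀ x ∈ closure (P j₀), (x, Tj j₀) ∈ closure (sourceSet T P Tj) := fun x hx => by
    rw [hcl]
    exact mem_iUnion.2 ⟨j₀, hx, left_mem_Icc.2 (h.time_lt j₀).le⟩
  -- The functional decreases strictly in time, so contact occurs at the bottom of the cylinder.
  have ht : t₀ = Tj j₀ := by
    have := hle _ (hbot p hp)
    simp only at this
    linarith [ht₀.1]
  subst ht
  refine ⟨j₀, p, hp, fun x hx hxp => ?_, hq0.symm, fun j hj => ?_⟩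
  · by_contra hlt
    have h1 := hle _ (hbot x hx)
    simp only at h1
    have h2 : c * inner ℝ p ω ≤ c * inner ℝ x ω := mul_le_mul_of_nonneg_left (not_lt.1 hlt) hc.le
    have := huniq' _ (hbot x hx) (by simp only; linarith)
    exact hxp (congrArg Prod.fst this)
  · have hK : IsCompact (closure (P j) ×ˢ Icc (Tj j) T) :=
      (h.polygon j).isCompact_closure.prod isCompact_Icc
    rcases (closure (P j) ×ˢ Icc (Tj j) T).eq_empty_or_nonempty with hem | hne
    · refine ⟨H - 1, by linarith, fun q hq => ?_⟩
      have : q ∈ closure (P j) ×ˢ Icc (Tj j) T := ⟨subset_closure hq.1, Ioo_subset_Icc_self hq.2⟩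
      rw [hem] at this
      exact this.elim
    -- The maximum over another closed cylinder serves as `M`. If it equalled the supremum, its
    -- maximizer would be the contact point, against disjointness of the closed polygons.
    · obtain ⟨q₁, hq₁, hmax⟩ := hK.exists_isMaxOn hne
        (f := fun q : Plane × ℝ => -q.2 + c * inner ℝ q.1 ω) (by fun_prop)
      have hq₁c : q₁ ∈ closure (sourceSet T P Tj) := by
        rw [hcl]
        exact mem_iUnion.2 ⟨j, hq₁⟩
      refine ⟨_, lt_of_le_of_ne (hle q₁ hq₁c) fun heq => ?_, fun q hq =>
        hmax (show q ∈ closure (P j) ×ˢ Icc (Tj j) T from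
          ⟨subset_closure hq.1, Ioo_subset_Icc_self hq.2⟩)⟩
      have := huniq' q₁ hq₁c heq
      rw [this] at hq₁
      exact (h.disjoint j j₀ hj).le_bot ⟨hq₁.1, hp⟩

theorem IsSmoothBoundedDomain.final_height_le (hΩ : IsSmoothBoundedDomain Ω) (ω : Plane) (c : ℝ)
    {x : Plane} (hx : x ∈ Ω) : -T + c * inner ℝ x ω
      ≤ Real.sqrt (c ^ 2 + 1) * sSup ((fun x : Plane => stDot (x, T) (omegaC ω c)) '' Ω) := by
  have hb : BddAbove ((fun x : Plane => stDot (x, T) (omegaC ω c)) '' Ω) :=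
    (hΩ.isCompact_closure.image ((continuous_stDot (omegaC ω c)).comp
      (Continuous.prodMk_left T))).bddAbove.mono (image_mono subset_closure)
  have h1 := stDot_omegaC (x, T) ω c
  simp only at h1
  rw [← h1]
  exact mul_le_mul_of_nonneg_left (le_csSup hb (mem_image_of_mem _ hx)) (Real.sqrt_nonneg _)

/-- The indicator function is, up to a nonzero constant and a unimodular factor, asymptotic to
`τ⁻³ e^{τ √(c² + 1) h_D(ω(c))}`. -/
theorem exists_tendsto_norm_indicatorFun (hΩ : IsSmoothBoundedDomain Ω) (hT : 0 < T)
    (hsrc : IsAdmissibleSource Ω T P Tj ρ)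
    {u : Plane → ℝ → ℝ} (hu : IsHeatSolution Ω T (source T P Tj ρ) u)
    {ω ωp : Plane} (hω : ‖ω‖ = 1) (hωp : ‖ωp‖ = 1) (horth : inner ℝ ω ωp = 0)
    {c : ℝ} (hc : 0 < c)
    (hreg : IsRegularDir (sourceSet T P Tj) (omegaC ω c))
    (hsup : sSup ((fun x : Plane => stDot (x, T) (omegaC ω c)) '' Ω)
      < supportFun (sourceSet T P Tj) (omegaC ω c)) :
    ∃ L : ℝ, 0 < L ∧ Tendsto (fun τ : ℝ => τ ^ 3 * Real.exp (-(τ *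
      (Real.sqrt (c ^ 2 + 1) * supportFun (sourceSet T P Tj) (omegaC ω c)))) *
        ‖indicatorFun Ω T u ω ωp c τ 0‖) atTop (𝓝 L) := by
  obtain ⟨j₀, p, hp, hmax, hHp, hrest⟩ := hsrc.exists_peak hc hreg
  set H := Real.sqrt (c ^ 2 + 1) * supportFun (sourceSet T P Tj) (omegaC ω c) with hH
  obtain ⟨θ, hθ, -, hhol⟩ := hsrc.holder j₀
  obtain ⟨U, hU, C, g, hg, hg0, hρg⟩ := hhol p (mem_hullVertices hp hmax)
  obtain ⟨l, hl, hlim⟩ := tendsto_integral_vertex (ωp := ωp) (hsrc.polygon j₀) hω hp hmax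
    (hsrc.time_lt j₀) (hsrc.bounded j₀) hU
    ((hg.uniformContinuousOn hθ).continuousOn.continuousAt hU) hg0 hρg hc (tendsto_waveFreq c hc)
  set E : ℝ → ℂ := fun τ => expWave ω ωp c (waveFreq c τ) τ (p, Tj j₀) with hEdef
  have hE : ∀ τ, ‖E τ‖ = Real.exp (τ * H) := fun τ => by
    rw [hHp, hEdef]
    exact norm_expWave _ _ _ _ _ _
  have hpiece : ∀ j, j ≠ j₀ → Tendsto (fun τ : ℝ => ((τ ^ 3 : ℝ) : ℂ) * ((E τ)⁻¹ *
      ∫ q in P j ×ˢ Ioo (Tj j) T, (ρ j q : ℂ) * expWave ω ωp c (waveFreq c τ) τ q)) atTop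
      (𝓝 0) := by
    intro j hj
    obtain ⟨M, hM, hMq⟩ := hrest j hj
    refine tendsto_pow_mul_of_le_exp hM hE fun τ hτ => norm_setIntegral_mul_le
      ((hsrc.polygon j).isOpen.prod isOpen_Ioo).measurableSet (hsrc.integrableOn j) fun q hq => ?_
    rw [norm_expWave]
    exact Real.exp_le_exp.2 (mul_le_mul_of_nonneg_left (hMq q hq) hτ)
  have hfinal : Tendsto (fun τ : ℝ => ((τ ^ 3 : ℝ) : ℂ) * ((E τ)⁻¹ *
      ∫ x in Ω, (u x T : ℂ) * expWave ω ωp c (waveFreq c τ) τ (x, T))) atTop (𝓝 0) := by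
    refine tendsto_pow_mul_of_le_exp (mul_lt_mul_of_pos_left hsup
      (Real.sqrt_pos.2 (by positivity : 0 < c ^ 2 + 1))) hE fun τ hτ => norm_setIntegral_mul_le
      hΩ.isOpen.measurableSet (hu.integrableOn T (right_mem_Icc.2 hT.le)) fun x hx => ?_
    rw [norm_expWave]
    exact Real.exp_le_exp.2 (mul_le_mul_of_nonneg_left (hΩ.final_height_le ω c hx) hτ)
  -- After division by the wave at the contact point and multiplication by `τ ^ 3`, only the piece
  -- `j₀` survives in the limit.
  have hsum : Tendsto (fun τ : ℝ => ∑ j, ((τ ^ 3 : ℝ) : ℂ) * ((E τ)⁻¹ *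
      ∫ q in P j ×ˢ Ioo (Tj j) T, (ρ j q : ℂ) * expWave ω ωp c (waveFreq c τ) τ q)) atTop
      (𝓝 (∑ j, if j = j₀ then l else 0)) := by
    refine tendsto_finsetSum _ fun j _ => ?_
    by_cases hj : j = j₀
    · rw [if_pos hj, hj]
      exact hlim
    · rw [if_neg hj]
      exact hpiece j hj
  rw [Finset.sum_ite_eq' Finset.univ j₀ fun _ => l, if_pos (Finset.mem_univ _)] at hsum
  have htot := (hsum.sub hfinal).norm
  rw [sub_zero] at htot
  refine ⟨‖l‖, norm_pos_iff.2 hl, htot.congr' ?_⟩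
  filter_upwards [eventually_gt_atTop (c ^ 2)⁻¹, eventually_ge_atTop 0] with τ hτ hτ0
  rw [← Finset.mul_sum, ← Finset.mul_sum, ← mul_sub, ← mul_sub,
    ← hsrc.integral_source_mul hΩ (continuous_expWave ω ωp c (waveFreq c τ) τ),
    ← indicatorFun_zero_eq hω hωp horth hΩ hT hu hsrc.integrable_source.integrableOn hc hτ,
    norm_mul, norm_mul, norm_inv, hE, Complex.norm_real, Real.norm_of_nonneg (by positivity),
    Real.exp_neg, mul_assoc]

end

end HeatSource

/-! ### The theorem -/

theorem theorem2p2 (Ω : Set Plane) (hΩ : IsSmoothBoundedDomain Ω) (T : ℝ) (hT : 0 < T)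
    (N : ℕ) (P : Fin N → Set Plane) (Tj : Fin N → ℝ) (ρ : Fin N → Plane × ℝ → ℝ)
    (hsrc : IsAdmissibleSource Ω T P Tj ρ)
    (u : Plane → ℝ → ℝ) (hu : IsHeatSolution Ω T (source T P Tj ρ) u)
    (ω ωp : Plane) (hω : ‖ω‖ = 1) (hωp : ‖ωp‖ = 1) (horth : inner ℝ ω ωp = 0)
    (c : ℝ) (hc : 0 < c)
    (hreg : IsRegularDir (sourceSet T P Tj) (omegaC ω c))
    (hsup : sSup ((fun x : Plane => stDot (x, T) (omegaC ω c)) '' Ω)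
      < supportFun (sourceSet T P Tj) (omegaC ω c)) :
    (∀ᶠ τ in atTop, indicatorFun Ω T u ω ωp c τ 0 ≠ 0) ∧
    Tendsto (fun τ : ℝ => Real.log ‖indicatorFun Ω T u ω ωp c τ 0‖ / τ) atTop
      (𝓝 (Real.sqrt (c ^ 2 + 1) * supportFun (sourceSet T P Tj) (omegaC ω c))) ∧
    ∀ s : ℝ,
      (supportFun (sourceSet T P Tj) (omegaC ω c) ≤ -s / Real.sqrt (c ^ 2 + 1) →
        Tendsto (fun τ : ℝ => ‖indicatorFun Ω T u ω ωp c τ s‖) atTop (𝓝 0)) ∧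
      (-s / Real.sqrt (c ^ 2 + 1) < supportFun (sourceSet T P Tj) (omegaC ω c) →
        Tendsto (fun τ : ℝ => ‖indicatorFun Ω T u ω ωp c τ s‖) atTop atTop) := by

  obtain ⟨L, hL, hlim⟩ := exists_tendsto_norm_indicatorFun hΩ hT hsrc hu hω hωp horth hc hreg hsup
  have hr : 0 < Real.sqrt (c ^ 2 + 1) := Real.sqrt_pos.2 (by positivity)
  obtain ⟨h0, hlog, hs⟩ := asymptotics_of_tendsto hL hlim
  refine ⟨h0.mono fun τ hτ => norm_ne_zero_iff.1 hτ, hlog, fun s => ⟨fun h => ?_, fun h => ?_⟩⟩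
  · simp only [norm_indicatorFun Ω T u ω ωp c _ s]
    refine (hs s).1 ?_
    have := (le_div_iff₀ hr).1 h
    linarith
  · simp only [norm_indicatorFun Ω T u ω ωp c _ s]
    refine (hs s).2 ?_
    have := (div_lt_iff₀ hr).1 h
    linarith
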